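/- Conventions. For a partial order $M$ let $M^D$ be its Dedekind–MacNeille completion (cuts with non-empty lower and upper part). A path from $a$ to $b$ in $M^D$ is given by a finite sequence $a=c_0,c_1,\dots,c_n=b$ of points of $M^D$ with alternately $c_k<c_{k+1}$ and $c_k>c_{k+1}$, and maximal chains $\sigma_k$ of the interval between $c_k$ and $c_{k+1}$, such that two of these chains meet only if they are consecutive, and then only in their common endpoint; the path is the set $\{a\}\cup\bigcup_k\sigma_k$. $M$ is a cycle-free partial order (CFPO) if any two points of $M$ are joined by exactly one path in $M^D$; $\mathrm{path}\langle a,b\rangle$ denotes the set of points of $M$ on it. For $B\subseteq M$ and $x,y\in M\setminus B$ put $x\sim_B y$ iff $\mathrm{path}\langle x,y\rangle\cap B=\emptyset$. For sets $C,D\subseteq M$ let $\mathrm{path}\langle C,D\rangle$ be the set of points outside $C$ that lie on $\mathrm{path}\langle c,d\rangle$ for all $c\in C$, $d\in D$. For a partial order $X$, $X_{ap}$ is the set of pairs $(i,j)\in X^2$ with $i<j$ and no point of $X$ strictly between; for $A\subseteq M$, $A_{ap}$ refers to the suborder $A$. A 1-orbit of $M$ is an orbit of $\mathrm{Aut}(M)$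 on the points of $M$. For an invariant set $A$ and $a\in A$, the upper (lower) cones of $a$ in $A$ are the classes of the points of $A$ above (below) $a$ under the relation $a\notin\mathrm{path}\langle y,z\rangle$. $\mathrm{Aut}(M)$ acts cone transitively on $A$ if it is transitive on $A$ and, for each $a\in A$, the stabilizer of $a$ is transitive on the upper cones and on the lower cones of $a$ in $A$. A CFPO $X$ is cone transitive if $\mathrm{Aut}(X)$ acts cone transitively on $X$. A tree is a (possibly empty) partial order in which the points below any given point are linearly ordered and any two points have a common lower bound; $(T,L)$ denotes a tree with a maximal chain $L$. $\mathrm{Dec}(X,S,(T,L))$ is the partial order on the disjoint union of $X$, a copy $S_x$ of $S$ for each $x\in X$ and a copy $(T_{(i,j)},L_{(i,j)})$ of $(T,L)$ for each $(i,j)\in X_{ap}$, whose order is the transitive closure of the orders of $X$, of the $S_x$ and of the $T_{(i,j)}$, together with $x<y$ for $y\in S_x$, and $i<y<j$ for $y\in L_{(i,j)}$. **Theorem.** Let $M$ be a CFPO and let $A$ be a 1-orbit of $M$ on which $\mathrm{Aut}(M)$ acts cone transitively. Suppose that every class $C\in(M\setminus A)/\!\sim_A$ satisfies both of the following. 1.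 If $\mathrm{path}\langle C,M\setminus C\rangle\neq\emptyset$, then $\mathrm{path}\langle C,M\setminus C\rangle=\{a_C\}$ for some $a_C\in A$. 2. If $\mathrm{path}\langle C,M\setminus C\rangle=\emptyset$, then $(M\setminus C)/\!\sim_C$ has exactly two elements $B_C$ and $B'_C$ (suitably labelled), and there is $(a_C,a'_C)\in A_{ap}$ with $\mathrm{path}\langle C,B_C\rangle=\{a_C\}$ and $\mathrm{path}\langle C,B'_C\rangle=\{a'_C\}$. Then there are a cone transitive CFPO $X$ and trees $S$ and $(T,L)$ such that $\mathrm{Aut}(M)\cong\mathrm{Aut}(\mathrm{Dec}(X,S,(T,L)))$ as abstract groups. -/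

import Mathlib

universe u

namespace CFPO

/-! ### Completion, paths and cycle-free partial orders -/

/-- The (conditional) Dedekind-MacNeille completion `M^D` of a partial order: the Dedekind cuts
with non-empty lower and upper part.  No artificial least or greatest element is added. -/
abbrev Completion (M : Type*) [PartialOrder M] : Type _ :=
  {z : DedekindCut M // z.left.Nonempty ∧ z.right.Nonempty}

/-- The canonical embedding of `M` into `M^D`. -/
def toCompletion {M : Type*} [PartialOrder M] (a : M) : Completion M :=
  ⟨DedekindCut.principal a, ⟨a, le_refl a⟩, ⟨a, le_refl a⟩⟩

/-- `s` is a maximal chain of the interval `[u, v]`. -/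
def IsMaxChainBetween {P : Type*} [PartialOrder P] (u v : P) (s : Set P) : Prop :=
  s ⊆ Set.Icc u v ∧ IsChain (· ≤ ·) s ∧
    ∀ t : Set P, t ⊆ Set.Icc u v → IsChain (· ≤ ·) t → s ⊆ t → t = s

/-- `p` is a path from `a` to `b` in `P`: there is an alternating sequence
`a = c 0, c 1, …, c n = b` (each `c k` comparable with and different from `c (k + 1)`,
up and down steps alternating), and `p` is the union of maximal chains `σ k` of the intervals
between `c k` and `c (k + 1)`, where two of these chains may only meet if they are consecutive,
and then only in the common endpoint.  The path with `n = 0` is `{a}`. -/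
def IsPath {P : Type*} [PartialOrder P] (a b : P) (p : Set P) : Prop :=
  ∃ (n : ℕ) (c : ℕ → P) (σ : ℕ → Set P),
    c 0 = a ∧ c n = b ∧
    (∀ k < n, (c k < c (k + 1) ∧ IsMaxChainBetween (c k) (c (k + 1)) (σ k)) ∨
      (c (k + 1) < c k ∧ IsMaxChainBetween (c (k + 1)) (c k) (σ k))) ∧
    (∀ k, k + 2 ≤ n → (c k < c (k + 1) ↔ c (k + 2) < c (k + 1))) ∧
    (∀ i j, i < j → j < n → ∀ z ∈ σ i, z ∈ σ j → j = i + 1 ∧ z = c j) ∧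
    p = {a} ∪ ⋃ k ∈ Set.Iio n, σ k

/-- A cycle-free partial order: any two points of `M` are joined by exactly one path in `M^D`. -/
def IsCFPO (M : Type*) [PartialOrder M] : Prop :=
  ∀ a b : M, ∃! p : Set (Completion M), IsPath (toCompletion a) (toCompletion b) p

/-- `path⟨a, b⟩`: the points of `M` on the path from `a` to `b`
(which is unique when `M` is a CFPO). -/
def path {M : Type*} [PartialOrder M] (a b : M) : Set M :=
  {m | ∃ p : Set (Completion M),
    IsPath (toCompletion a) (toCompletion b) p ∧ toCompletion m ∈ p}

/-- `path⟨C, D⟩` for sets of points: the points outside `C` that lie on every path from a point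
of `C` to a point of `D`, that is, the points through which `C` has to be left towards `D`. -/
def setPath {M : Type*} [PartialOrder M] (C D : Set M) : Set M :=
  {m | m ∉ C ∧ ∀ c ∈ C, ∀ d ∈ D, m ∈ path c d}

/-- The set `(M ∖ B) / ∼_B` of classes of the relation
`x ∼_B y ↔ path⟨x, y⟩ ∩ B = ∅` on `M ∖ B`. -/
def pathClasses {M : Type*} [PartialOrder M] (B : Set M) : Set (Set M) :=
  {C | ∃ x, x ∉ B ∧ C = {y | y ∉ B ∧ path x y ∩ B = ∅}}

/-! ### Orbits and cone transitivity -/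

/-- `A` is a 1-orbit: an orbit of `Aut(M)` acting on the points of `M`. -/
def IsOneOrbit {M : Type*} [PartialOrder M] (A : Set M) : Prop :=
  ∃ x : M, A = {y | ∃ φ : M ≃o M, φ x = y}

/-- The upper cones of `a` in `A`: the classes of the points of `A` above `a`, where `y` and `z`
are in the same cone if the path between them avoids `a`. -/
def upperCones {M : Type*} [PartialOrder M] (A : Set M) (a : M) : Set (Set M) :=
  {K | ∃ y ∈ A, a < y ∧ K = {z | z ∈ A ∧ a < z ∧ a ∉ path y z}}

/-- The lower cones of `a` in `A`. -/
def lowerCones {M : Type*} [PartialOrder M] (A : Set M) (a : M) : Set (Set M) :=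
  {K | ∃ y ∈ A, y < a ∧ K = {z | z ∈ A ∧ z < a ∧ a ∉ path y z}}

/-- `Aut(M)` acts cone transitively on the `Aut(M)`-invariant set `A`: it is transitive on `A`,
and the stabilizer of each `a ∈ A` is transitive on the upper cones and on the lower cones of `a`
in `A`. -/
def ActsConeTransitivelyOn {M : Type*} [PartialOrder M] (A : Set M) : Prop :=
  (∀ x ∈ A, ∀ y ∈ A, ∃ φ : M ≃o M, φ x = y) ∧
  (∀ a ∈ A, ∀ K ∈ upperCones A a, ∀ K' ∈ upperCones A a,
    ∃ φ : M ≃o M, φ a = a ∧ φ '' K = K') ∧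
  (∀ a ∈ A, ∀ K ∈ lowerCones A a, ∀ K' ∈ lowerCones A a,
    ∃ φ : M ≃o M, φ a = a ∧ φ '' K = K')

/-- A cone transitive CFPO. -/
def IsConeTransitiveCFPO (X : Type*) [PartialOrder X] : Prop :=
  IsCFPO X ∧ ActsConeTransitivelyOn (Set.univ : Set X)

/-! ### The two conditions on the classes -/

/-- If all paths from `C` to its complement have a common point outside `C`, then `C` is attached
at a single point of `A`. -/
def AttachedAtPoint {M : Type*} [PartialOrder M] (A C : Set M) : Prop :=
  (setPath C Cᶜ).Nonempty → ∃ a ∈ A, setPath C Cᶜ = {a}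

/-- If the paths from `C` to its complement have no common point outside `C`, then the complement
of `C` has exactly two `∼_C`-classes, and `C` lies between an adjacent pair of `A` (adjacent in
the suborder `A`), being attached to one class at each member of the pair. -/
def LiesBetweenAdjacent {M : Type*} [PartialOrder M] (A C : Set M) : Prop :=
  setPath C Cᶜ = ∅ →
    ∃ B B' : Set M, B ≠ B' ∧ pathClasses C = {B, B'} ∧
      ∃ a a' : A, a ⋖ a' ∧ setPath C B = {(a : M)} ∧ setPath C B' = {(a' : M)}

/-! ### Trees -/

/-- A tree: the points below any point are linearly ordered, and any two points have a common
lower bound. -/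
def IsTree (T : Type*) [PartialOrder T] : Prop :=
  (∀ x y z : T, y ≤ x → z ≤ x → y ≤ z ∨ z ≤ y) ∧ ∀ x y : T, ∃ z, z ≤ x ∧ z ≤ y

/-! ### Decoration -/

/-- The adjacent pairs `X_ap` of `X`. -/
abbrev AdjPair (X : Type*) [PartialOrder X] : Type _ := {p : X × X // p.1 ⋖ p.2}

/-- The universe of `Dec(X, S, (T, L))`: the points of `X`, a copy of `S` for every point of `X`,
and a copy of `T` for every adjacent pair of `X`.  (The order uses `L`.) -/
inductive Dec (X S : Type*) [PartialOrder X] {T : Type*} (L : Set T) : Type _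
  | base (x : X) : Dec X S L
  | above (x : X) (s : S) : Dec X S L
  | between (e : AdjPair X) (t : T) : Dec X S L

namespace Dec

variable {X S T : Type*} [PartialOrder X] [PartialOrder S] [PartialOrder T] {L : Set T}

/-- The relation whose transitive closure is the order of `Dec(X, S, (T, L))`. -/
inductive Step : Dec X S L → Dec X S L → Prop
  | base {x y : X} : x ≤ y → Step (base x) (base y)
  | above {x : X} {s s' : S} : s ≤ s' → Step (above x s) (above x s')
  | base_above (x : X) (s : S) : Step (base x) (above x s)
  | between {e : AdjPair X} {t t' : T} : t ≤ t' → Step (between e t) (between e t')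
  | base_between (e : AdjPair X) {t : T} : t ∈ L → Step (base e.1.1) (between e t)
  | between_base (e : AdjPair X) {t : T} : t ∈ L → Step (between e t) (base e.1.2)

/-- Auxiliary: the point of `X` below which a point of the decoration is attached. -/
def foot : Dec X S L → X
  | base x => x
  | above x _ => x
  | between e _ => e.1.1

/-- Auxiliary: an upper bound for the order on the points with a given foot. -/
def FibreLE : Dec X S L → Dec X S L → Prop
  | base _, _ => True
  | above x s, above x' s' => x = x' ∧ s ≤ s'
  | between e t, between e' t' => e = e' ∧ t ≤ t'
  | _, _ => False

theorem foot_le_of_step {a b : Dec X S L} (h : Step a b) : foot a ≤ foot b := by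
  cases h with
  | base h => exact h
  | between_base e _ => exact e.2.le
  | _ => exact le_rfl

theorem foot_le_of_closure {a b : Dec X S L} (h : Relation.ReflTransGen Step a b) :
    foot a ≤ foot b := by
  induction h with
  | refl => exact le_rfl
  | tail _ h ih => exact ih.trans (foot_le_of_step h)

theorem fibreLE_of_closure {a b : Dec X S L} (h : Relation.ReflTransGen Step a b)
    (hf : foot b ≤ foot a) : FibreLE a b := by
  induction h using Relation.ReflTransGen.head_induction_on with
  | refl => cases b <;> simp [FibreLE]
  | head h h' ih =>
    have h1 := foot_le_of_step h
    have h2 := ih (hf.trans h1)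
    cases h with
    | base _ => trivial
    | base_above _ _ => trivial
    | base_between _ _ => trivial
    | above hs =>
      cases b with
      | above _ _ => exact ⟨h2.1, hs.trans h2.2⟩
      | _ => exact h2
    | between ht =>
      cases b with
      | between _ _ => exact ⟨h2.1, ht.trans h2.2⟩
      | _ => exact h2
    | between_base e _ =>
      exact absurd ((foot_le_of_closure h').trans hf) (not_le_of_gt e.2.lt)

/-- `Dec(X, S, (T, L))` is ordered by the (reflexive and) transitive closure of `Step`. -/
instance : PartialOrder (Dec X S L) where
  le := Relation.ReflTransGen Step
  le_refl _ := Relation.ReflTransGen.refl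
  le_trans _ _ _ := Relation.ReflTransGen.trans
  le_antisymm a b h h' := by
    have hf := (foot_le_of_closure h).antisymm (foot_le_of_closure h')
    have h1 := fibreLE_of_closure h hf.ge
    have h2 := fibreLE_of_closure h' hf.le
    cases a <;> cases b <;> simp_all only [FibreLE, foot]
    · rw [h1.2.antisymm h2.2]
    · rw [h1.2.antisymm h2.2]

end Dec

end CFPO

/-! Two points are joined around `z` if a finite sequence of comparabilities leads from one to the
other and no interval of the sequence contains `z`. Everything rests on replacing paths by this
relation: `M` is a CFPO if and only if `M^D` satisfies `CycleFree`, and then the path from `a` to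
`b` is the set of points around which `a` and `b` are not joined (`CycleFree.isPath_iff`,
`IsCFPO.cycleFree`, `isCFPO_of_cycleFree`).

The conditions on the classes say that each point has either one gate or two adjacent gates in `A`,
and that every path to `A` passes through a gate (`IsCFPO.gated`). Hence paths in `A` are traces of
paths in `M`, and `A` itself is a cone transitive CFPO (`isConeTransitiveCFPO_coe`). It is the
required `X`.

The points outside `A` fall into blocks according to their gates, and a comparability between
different blocks passes through gates. So an automorphism of `M` amounts to an automorphism of `A`
together with compatible maps between blocks. All blocks at points look alike because `A` is an
orbit. All blocks at adjacent pairs look alike because, once one of them is non-empty, cone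
transitivity makes `Aut(M)` transitive on adjacent pairs (`exists_map_adjPair`). Therefore `Aut(M)`
is a wreath product of `Aut(A)` with the groups of automorphisms supported in one model block of
each kind (`Charts.autEquiv`).

The trees need not resemble the blocks; only their automorphism groups matter. Position on the paths
from a root `a ∈ A` turns `M^D` into a tree, and the order of `M^D` is recovered from this tree and
the direction in which each point is approached (`CycleFree.le_iff_exists_meet`). Colours record
this direction, membership in `M`, and the name of each point outside the block. The
colour-preserving automorphisms are then exactly those supported in the block (`supportedEquiv`).
Colours are coded by well-ordered chains attached to the nodes (`Enc.autEquiv`), and `L` is the root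
of `T` with its chain. In the resulting decoration the points of `X` are recognizable from the
order, so its automorphism group is the same wreath product (`Dec.autEquiv`). -/

namespace CFPO

/-! ### Separation of points in a partial order. -/

section Joined

variable {P : Type*} [PartialOrder P]

/-- `u` and `v` are comparable, and `z` is not in the interval between them. -/
def Link (z u v : P) : Prop :=
  (u ≤ v ∧ ¬(u ≤ z ∧ z ≤ v)) ∨ (v ≤ u ∧ ¬(v ≤ z ∧ z ≤ u))

/-- `u` and `v` can be joined by a sequence of intervals that avoids `z`. -/
def Joined (z : P) : P → P → Prop := Relation.TransGen (Link z)

/-- `u` and `v` can be joined by a sequence of comparable points. -/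
def Linked : P → P → Prop := Relation.ReflTransGen fun u v : P => u ≤ v ∨ v ≤ u

theorem Link.symm {z u v : P} (h : Link z u v) : Link z v u := Or.symm h

theorem Link.ne {z u v : P} (h : Link z u v) : u ≠ z := by
  rintro rfl
  rcases h with ⟨h, h'⟩ | ⟨h, h'⟩
  · exact h' ⟨le_rfl, h⟩
  · exact h' ⟨h, le_rfl⟩

theorem Joined.symm {z u v : P} (h : Joined z u v) : Joined z v u := by
  induction h with
  | single h => exact .single h.symm
  | tail _ h ih => exact .head h.symm ih

theorem Joined.trans {z u v w : P} (h : Joined z u v) (h' : Joined z v w) : Joined z u w :=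
  Relation.TransGen.trans h h'

theorem Joined.ne_left {z u v : P} (h : Joined z u v) : u ≠ z := by
  induction h with
  | single h => exact h.ne
  | tail _ _ ih => exact ih

theorem Joined.ne_right {z u v : P} (h : Joined z u v) : v ≠ z := h.symm.ne_left

theorem Joined.of_le {z u v : P} (h : u ≤ v) (h' : ¬(u ≤ z ∧ z ≤ v)) : Joined z u v :=
  .single (Or.inl ⟨h, h'⟩)

theorem Joined.of_ge {z u v : P} (h : v ≤ u) (h' : ¬(v ≤ z ∧ z ≤ u)) : Joined z u v :=
  .single (Or.inr ⟨h, h'⟩)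

theorem Joined.refl {z u : P} (h : u ≠ z) : Joined z u u :=
  .of_le le_rfl fun h' => h (h'.1.antisymm h'.2)

theorem Link.split {c u v : P} (h : Link c u v) (a : P) : Link a u v ∨ Joined c u a := by
  rcases h with ⟨h, h'⟩ | ⟨h, h'⟩
  · by_cases ha : u ≤ a ∧ a ≤ v
    · exact Or.inr (.of_le ha.1 fun hc => h' ⟨hc.1, hc.2.trans ha.2⟩)
    · exact Or.inl (Or.inl ⟨h, ha⟩)
  · by_cases ha : v ≤ a ∧ a ≤ u
    · exact Or.inr (.of_ge ha.2 fun hc => h' ⟨ha.1.trans hc.1, hc.2⟩)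
    · exact Or.inl (Or.inr ⟨h, ha⟩)

/-- A sequence of intervals avoiding `c` either avoids `a` or leads to `a`. -/
theorem Joined.split {c m b : P} (h : Joined c m b) (a : P) : Joined a m b ∨ Joined c m a := by
  induction h with
  | single h =>
    rcases h.split a with h | h
    · exact Or.inl (.single h)
    · exact Or.inr h
  | tail h1 h2 ih =>
    rcases ih with ih | ih
    · rcases h2.split a with h | h
      · exact Or.inl (ih.tail h)
      · exact Or.inr (Joined.trans h1 h)
    · exact Or.inr ih

/-- The step from `p` to `q` runs through `a`. If `b` lies on its part from `p` to `a`, stopping at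
`b` avoids `a`; otherwise stopping at `a` avoids `b`. -/
theorem joined_or_joined_of_step {a b p q m : P} (hab : a ≠ b)
    (ha : Joined a m p) (hb : Joined b m p) (hq : (p ≤ a ∧ a ≤ q) ∨ (q ≤ a ∧ a ≤ p)) :
    Joined a m b ∨ Joined b m a := by
  rcases hq with ⟨h1, h2⟩ | ⟨h1, h2⟩
  · by_cases hb' : p ≤ b ∧ b ≤ a
    · exact Or.inl (ha.trans (.of_le hb'.1 fun h' => hab (h'.2.antisymm hb'.2)))
    · exact Or.inr (hb.trans (.of_le h1 hb'))
  · by_cases hb' : a ≤ b ∧ b ≤ p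
    · exact Or.inl (ha.trans (.of_ge hb'.2 fun h' => hab (hb'.1.antisymm h'.1)))
    · exact Or.inr (hb.trans (.of_ge h2 hb'))

/-- A sequence of intervals that starts at `m` and leads to `a` meets one of `a ≠ b` first. -/
theorem joined_or_joined {a b m : P} (hab : a ≠ b) (h : Linked m a) :
    Joined a m b ∨ Joined b m a := by
  by_contra hcon
  have key : ∀ {p}, Linked m p → Joined a m p ∧ Joined b m p := by
    intro p hp
    induction hp with
    | refl =>
      refine ⟨.refl ?_, .refl ?_⟩
      · rintro rfl; exact hcon (Or.inr (.refl hab))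
      · rintro rfl; exact hcon (Or.inl (.refl hab.symm))
    | @tail p q _ hpq ih =>
      have h1 : ¬((p ≤ a ∧ a ≤ q) ∨ (q ≤ a ∧ a ≤ p)) := fun h' =>
        hcon (joined_or_joined_of_step hab ih.1 ih.2 h')
      have h2 : ¬((p ≤ b ∧ b ≤ q) ∨ (q ≤ b ∧ b ≤ p)) := fun h' =>
        hcon (joined_or_joined_of_step hab.symm ih.2 ih.1 h').symm
      push Not at h1 h2
      rcases hpq with h | h
      · exact ⟨ih.1.trans (.of_le h fun h' => h1.1 h'.1 h'.2),
          ih.2.trans (.of_le h fun h' => h2.1 h'.1 h'.2)⟩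
      · exact ⟨ih.1.trans (.of_ge h fun h' => h1.2 h'.1 h'.2),
          ih.2.trans (.of_ge h fun h' => h2.2 h'.1 h'.2)⟩
  exact (key h).1.ne_right rfl

/-- The order-theoretic form of cycle-freeness: every point separates the points below it from the
points above it, and separates points on the same side of it unless they have a common bound on
that side. -/
structure CycleFree (P : Type*) [PartialOrder P] : Prop where
  linked : ∀ a b : P, Linked a b
  not_joined : ∀ {u z v : P}, u < z → z < v → ¬Joined z u v
  below : ∀ {u z v : P}, u < z → v < z → Joined z u v → ∃ w, w < z ∧ u ≤ w ∧ v ≤ w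
  above : ∀ {u z v : P}, z < u → z < v → Joined z u v → ∃ w, z < w ∧ w ≤ u ∧ w ≤ v

/-- Bounded pairs have least upper and greatest lower bounds. -/
structure PairComplete (P : Type*) [PartialOrder P] : Prop where
  sup : ∀ {u v b : P}, u ≤ b → v ≤ b → ∃ w, u ≤ w ∧ v ≤ w ∧ ∀ x, u ≤ x → v ≤ x → w ≤ x
  inf : ∀ {u v b : P}, b ≤ u → b ≤ v → ∃ w, w ≤ u ∧ w ≤ v ∧ ∀ x, x ≤ u → x ≤ v → x ≤ w

/-- All intervals are chains. -/
def ChainIntervals (P : Type*) [PartialOrder P] : Prop :=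
  ∀ {a x y b : P}, a ≤ x → x ≤ b → a ≤ y → y ≤ b → x ≤ y ∨ y ≤ x

namespace CycleFree

variable (hP : CycleFree P)
include hP

theorem not_joined_of_le {u z v : P} (h : u ≤ z) (h' : z ≤ v) : ¬Joined z u v := by
  intro hj
  exact hP.not_joined (h.lt_of_ne hj.ne_left) (h'.lt_of_ne hj.ne_right.symm) hj

theorem not_joined_iff {u z v : P} (h : u ≤ v) : ¬Joined z u v ↔ u ≤ z ∧ z ≤ v :=
  ⟨fun h' => by_contra fun hz => h' (.of_le h hz), fun h' => hP.not_joined_of_le h'.1 h'.2⟩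

/-- If `x` and `y` were incomparable, the detour `a ≤ y ≤ b` would avoid `x`, although `x` lies
between `a` and `b`. -/
theorem chainIntervals : ChainIntervals P := by
  intro a x y b ax xb ay yb
  by_contra h
  push Not at h
  exact hP.not_joined_of_le ax xb
    (Joined.trans (.of_le ay fun h' => h.1 h'.2) (.of_le yb fun h' => h.2 h'.1))

/-- Of two different points, one can be reached first from `m`. Together with `not_joined_trans`
this makes position on the paths from `m` a partial order. -/
theorem eq_of_not_joined {m a b : P} (h : ¬Joined a m b) (h' : ¬Joined b m a) : a = b := by
  by_contra hab
  exact (joined_or_joined hab (hP.linked m a)).elim h h'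

end CycleFree

theorem not_joined_trans {a b c m : P} (h : ¬Joined c m a) (h' : ¬Joined a m b) :
    ¬Joined c m b := fun hj => (hj.split a).elim h' h

end Joined

end CFPO

/-! ### Alternating paths, and their description by separation. -/

namespace CFPO

section Pth

open Set

variable {P : Type*} [PartialOrder P]

/-- Alternating paths built from intervals that meet only in common endpoints.  The Boolean is
the direction of the last segment (both directions are allowed for the trivial path). -/
inductive Pth (a : P) : P → Bool → Set P → Prop
  | nil (d : Bool) : Pth a a d {a}
  | up {c y : P} {p : Set P} : Pth a c false p → c < y → (∀ z ∈ p, c ≤ z → z ≤ y → z = c) →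
      Pth a y true (p ∪ Icc c y)
  | dn {c y : P} {p : Set P} : Pth a c true p → y < c → (∀ z ∈ p, y ≤ z → z ≤ c → z = c) →
      Pth a y false (p ∪ Icc y c)

theorem Pth.end_mem {a y : P} {d : Bool} {p : Set P} (h : Pth a y d p) : y ∈ p := by
  cases h with
  | nil => rfl
  | up _ h _ => exact Or.inr ⟨h.le, le_rfl⟩
  | dn _ h _ => exact Or.inr ⟨le_rfl, h.le⟩

theorem Pth.joined {a y z : P} {d : Bool} {p : Set P} (h : Pth a y d p) (hz : z ∉ p) :
    Joined z a y := by
  induction h with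
  | nil => exact .refl fun h => hz h.symm
  | up _ h _ ih => exact (ih fun h => hz (Or.inl h)).trans (.of_le h.le fun h => hz (Or.inr h))
  | dn _ h _ ih => exact (ih fun h => hz (Or.inl h)).trans (.of_ge h.le fun h => hz (Or.inr h))

/-- This straightens a sequence of comparabilities into an alternating path, one step at a time. If
the added interval meets an earlier segment, the path is cut back to that point by induction;
otherwise only the last segment changes. The inclusion matters because a point avoided by the old
path and the new interval stays avoided. -/
theorem Pth.extend (hc : ChainIntervals P) (hl : PairComplete P) {a y : P} {d : Bool} {p : Set P}
    (h : Pth a y d p) : ∀ t ∈ p, ∀ y',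
      (t ≤ y' → ∃ d' p', Pth a y' d' p' ∧ p' ⊆ p ∪ Icc t y') ∧
      (y' ≤ t → ∃ d' p', Pth a y' d' p' ∧ p' ⊆ p ∪ Icc y' t) := by
  induction h with
  | nil d =>
    rintro t rfl y'
    refine ⟨fun h => ?_, fun h => ?_⟩
    · rcases h.eq_or_lt with rfl | h
      · exact ⟨d, _, .nil d, subset_union_left⟩
      · exact ⟨_, _, .up (.nil _) h (by rintro z rfl _ _; rfl), Subset.rfl⟩
    · rcases h.eq_or_lt with rfl | h
      · exact ⟨d, _, .nil d, subset_union_left⟩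
      · exact ⟨_, _, .dn (.nil _) h (by rintro z rfl _ _; rfl), Subset.rfl⟩
  | @up c y p h0 hcy hp ih =>
    intro t ht y'
    refine ⟨fun hty => ?_, fun hty => ?_⟩
    · by_cases hJ : ∃ t' ∈ p, t ≤ t' ∧ t' ≤ y'
      · obtain ⟨t', ht', h1, h2⟩ := hJ
        obtain ⟨d', p', hp', hs⟩ := (ih t' ht' y').1 h2
        exact ⟨d', p', hp', hs.trans (union_subset_union subset_union_left
          (Icc_subset_Icc_left h1))⟩
      · push Not at hJ
        have ht2 : t ∈ Icc c y := ht.resolve_left fun h => hJ t h le_rfl hty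
        have hct : c < t := ht2.1.lt_of_ne fun h => hJ c h0.end_mem h.ge (h.le.trans hty)
        refine ⟨_, _, .up h0 (hct.trans_le hty) fun z hz h1 h2 => ?_, ?_⟩
        · rcases hc h1 h2 hct.le hty with h3 | h3
          · exact hp z hz h1 (h3.trans ht2.2)
          · exact absurd h2 (hJ z hz h3)
        · rintro z (hz | hz)
          · exact Or.inl (Or.inl hz)
          · rcases hc hz.1 hz.2 hct.le hty with h3 | h3
            · exact Or.inl (Or.inr ⟨hz.1, h3.trans ht2.2⟩)
            · exact Or.inr ⟨h3, hz.2⟩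
    · by_cases hJ : ∃ t' ∈ p, y' ≤ t' ∧ t' ≤ t
      · obtain ⟨t', ht', h1, h2⟩ := hJ
        obtain ⟨d', p', hp', hs⟩ := (ih t' ht' y').2 h1
        exact ⟨d', p', hp', hs.trans (union_subset_union subset_union_left
          (Icc_subset_Icc_right h2))⟩
      · push Not at hJ
        have ht2 : t ∈ Icc c y := ht.resolve_left fun h => hJ t h hty le_rfl
        have hyc : ¬y' ≤ c := fun h => hJ c h0.end_mem h ht2.1
        -- The new path ascends from `c` to the least upper bound of `c` and `y'` and descends from
        -- there; no turn is needed if that bound is `y'`.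
        obtain ⟨w, hcw, hyw, hw⟩ := hl.sup ht2.1 hty
        have hwt : w ≤ t := hw t ht2.1 hty
        rcases hyw.eq_or_lt with rfl | hyw
        · refine ⟨_, _, .up h0 (hcw.lt_of_not_ge hyc) fun z hz h1 h2 =>
            hp z hz h1 (h2.trans (hty.trans ht2.2)), ?_⟩
          exact (union_subset_union_right _
            (Icc_subset_Icc_right (hty.trans ht2.2))).trans subset_union_left
        · have hcw' : c < w := hcw.lt_of_ne fun h => hyc (h ▸ hyw.le)
          refine ⟨_, _, .dn (.up h0 hcw' fun z hz h1 h2 =>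
            hp z hz h1 (h2.trans (hwt.trans ht2.2))) hyw ?_, ?_⟩
          · rintro z (hz | hz) h1 h2
            · exact absurd (h2.trans hwt) (hJ z hz h1)
            · exact h2.antisymm (hw z hz.1 h1)
          · rintro z ((hz | hz) | hz)
            · exact Or.inl (Or.inl hz)
            · exact Or.inl (Or.inr ⟨hz.1, hz.2.trans (hwt.trans ht2.2)⟩)
            · exact Or.inr ⟨hz.1, hz.2.trans hwt⟩
  | @dn c y p h0 hcy hp ih =>
    intro t ht y'
    refine ⟨fun hty => ?_, fun hty => ?_⟩
    · by_cases hJ : ∃ t' ∈ p, t ≤ t' ∧ t' ≤ y'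
      · obtain ⟨t', ht', h1, h2⟩ := hJ
        obtain ⟨d', p', hp', hs⟩ := (ih t' ht' y').1 h2
        exact ⟨d', p', hp', hs.trans (union_subset_union subset_union_left
          (Icc_subset_Icc_left h1))⟩
      · push Not at hJ
        have ht2 : t ∈ Icc y c := ht.resolve_left fun h => hJ t h le_rfl hty
        have hyc : ¬c ≤ y' := hJ c h0.end_mem ht2.2
        obtain ⟨w, hcw, hyw, hw⟩ := hl.inf ht2.2 hty
        have hwt : t ≤ w := hw t ht2.2 hty
        rcases hyw.eq_or_lt with rfl | hyw
        · refine ⟨_, _, .dn h0 (hcw.lt_of_not_ge hyc) fun z hz h1 h2 =>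
            hp z hz ((ht2.1.trans hty).trans h1) h2, ?_⟩
          exact (union_subset_union_right _
            (Icc_subset_Icc_left (ht2.1.trans hty))).trans subset_union_left
        · have hcw' : w < c := hcw.lt_of_ne fun h => hyc (h ▸ hyw.le)
          refine ⟨_, _, .up (.dn h0 hcw' fun z hz h1 h2 =>
            hp z hz ((ht2.1.trans hwt).trans h1) h2) hyw ?_, ?_⟩
          · rintro z (hz | hz) h1 h2
            · exact absurd h2 (hJ z hz (hwt.trans h1))
            · exact (hw z hz.2 h2).antisymm h1
          · rintro z ((hz | hz) | hz)
            · exact Or.inl (Or.inl hz)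
            · exact Or.inl (Or.inr ⟨(ht2.1.trans hwt).trans hz.1, hz.2⟩)
            · exact Or.inr ⟨hwt.trans hz.1, hz.2⟩
    · by_cases hJ : ∃ t' ∈ p, y' ≤ t' ∧ t' ≤ t
      · obtain ⟨t', ht', h1, h2⟩ := hJ
        obtain ⟨d', p', hp', hs⟩ := (ih t' ht' y').2 h1
        exact ⟨d', p', hp', hs.trans (union_subset_union subset_union_left
          (Icc_subset_Icc_right h2))⟩
      · push Not at hJ
        have ht2 : t ∈ Icc y c := ht.resolve_left fun h => hJ t h hty le_rfl
        have hct : t < c := ht2.2.lt_of_ne fun h => hJ c h0.end_mem (hty.trans h.le) h.ge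
        refine ⟨_, _, .dn h0 (hty.trans_lt hct) fun z hz h1 h2 => ?_, ?_⟩
        · rcases hc h1 h2 hty hct.le with h3 | h3
          · exact absurd h3 (hJ z hz h1)
          · exact hp z hz (ht2.1.trans h3) h2
        · rintro z (hz | hz)
          · exact Or.inl (Or.inl hz)
          · rcases hc hz.1 hz.2 hty hct.le with h3 | h3
            · exact Or.inr ⟨hz.1, h3⟩
            · exact Or.inl (Or.inr ⟨ht2.1.trans h3, hz.2⟩)

theorem Joined.exists_pth (hc : ChainIntervals P) (hl : PairComplete P) {z a b : P}
    (h : Joined z a b) : ∃ d p, Pth a b d p ∧ z ∉ p := by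
  have step : ∀ {u v : P}, Link z u v → (∃ d p, Pth a u d p ∧ z ∉ p) →
      ∃ d p, Pth a v d p ∧ z ∉ p := by
    rintro u v (⟨h, hz⟩ | ⟨h, hz⟩) ⟨d, p, hp, hzp⟩
    · obtain ⟨d', p', hp', hs⟩ := (hp.extend hc hl _ hp.end_mem v).1 h
      exact ⟨d', p', hp', fun hz' => (hs hz').elim hzp hz⟩
    · obtain ⟨d', p', hp', hs⟩ := (hp.extend hc hl _ hp.end_mem v).2 h
      exact ⟨d', p', hp', fun hz' => (hs hz').elim hzp hz⟩
  have h0 : ∃ d p, Pth a a d p ∧ z ∉ p := ⟨true, _, .nil _, fun h' => h.ne_left h'.symm⟩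
  induction h with
  | single h => exact step h h0
  | tail _ h ih => exact step h ih

theorem Linked.exists_pth (hc : ChainIntervals P) (hl : PairComplete P) {a b : P}
    (h : Linked a b) : ∃ d p, Pth a b d p := by
  induction h with
  | refl => exact ⟨true, _, .nil _⟩
  | @tail u v _ h ih =>
    obtain ⟨d, p, hp⟩ := ih
    rcases h with h | h
    · obtain ⟨d', p', hp', -⟩ := (hp.extend hc hl _ hp.end_mem v).1 h
      exact ⟨d', p', hp'⟩
    · obtain ⟨d', p', hp', -⟩ := (hp.extend hc hl _ hp.end_mem v).2 h
      exact ⟨d', p', hp'⟩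

theorem isMaxChainBetween_Icc (hc : ChainIntervals P) (u v : P) :
    IsMaxChainBetween u v (Icc u v) :=
  ⟨Subset.rfl, fun _ hx _ hy _ => hc hx.1 hx.2 hy.1 hy.2, fun _ ht _ h => ht.antisymm h⟩

theorem IsMaxChainBetween.eq_Icc (hc : ChainIntervals P) {u v : P} {s : Set P}
    (h : IsMaxChainBetween u v s) : s = Icc u v :=
  (h.2.2 _ Subset.rfl (isMaxChainBetween_Icc hc u v).2.1 h.1).symm

/-- The data of `IsPath`, without the description of the set of points. -/
def PathData (n : ℕ) (c : ℕ → P) (σ : ℕ → Set P) : Prop :=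
  (∀ k < n, (c k < c (k + 1) ∧ IsMaxChainBetween (c k) (c (k + 1)) (σ k)) ∨
      (c (k + 1) < c k ∧ IsMaxChainBetween (c (k + 1)) (c k) (σ k))) ∧
    (∀ k, k + 2 ≤ n → (c k < c (k + 1) ↔ c (k + 2) < c (k + 1))) ∧
    (∀ i j, i < j → j < n → ∀ z ∈ σ i, z ∈ σ j → j = i + 1 ∧ z = c j)

theorem isPath_iff {a b : P} {p : Set P} :
    IsPath a b p ↔ ∃ n c σ, PathData n c σ ∧ c 0 = a ∧ c n = b ∧ p = {a} ∪ ⋃ k ∈ Iio n, σ k := by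
  constructor
  · rintro ⟨n, c, σ, h1, h2, h3, h4, h5, h6⟩
    exact ⟨n, c, σ, ⟨h3, h4, h5⟩, h1, h2, h6⟩
  · rintro ⟨n, c, σ, ⟨h3, h4, h5⟩, h1, h2, h6⟩
    exact ⟨n, c, σ, h1, h2, h3, h4, h5, h6⟩

omit [PartialOrder P] in
theorem iUnion_Iio_succ (σ : ℕ → Set P) (n : ℕ) :
    ⋃ k ∈ Iio (n + 1), σ k = (⋃ k ∈ Iio n, σ k) ∪ σ n := by
  ext z
  simp only [mem_iUnion, mem_Iio, mem_union, exists_prop, Nat.lt_succ_iff_lt_or_eq]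
  constructor
  · rintro ⟨k, hk | rfl, hz⟩
    · exact Or.inl ⟨k, hk, hz⟩
    · exact Or.inr hz
  · rintro (⟨k, hk, hz⟩ | hz)
    · exact ⟨k, Or.inl hk, hz⟩
    · exact ⟨n, Or.inr rfl, hz⟩

theorem PathData.left_mem (hc : ChainIntervals P) {n : ℕ} {c : ℕ → P} {σ : ℕ → Set P}
    (h : PathData n c σ) {k : ℕ} (hk : k < n) : c k ∈ σ k ∧ c (k + 1) ∈ σ k ∧ c k ≠ c (k + 1) := by
  rcases h.1 k hk with ⟨h1, h2⟩ | ⟨h1, h2⟩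
  · rw [h2.eq_Icc hc]; exact ⟨⟨le_rfl, h1.le⟩, ⟨h1.le, le_rfl⟩, h1.ne⟩
  · rw [h2.eq_Icc hc]; exact ⟨⟨h1.le, le_rfl⟩, ⟨le_rfl, h1.le⟩, h1.ne'⟩

theorem PathData.snoc (hc : ChainIntervals P) {n : ℕ} {c : ℕ → P} {σ : ℕ → Set P}
    (h : PathData n c σ) {y : P} {s : Set P}
    (hs : (c n < y ∧ IsMaxChainBetween (c n) y s) ∨ (y < c n ∧ IsMaxChainBetween y (c n) s))
    (halt : ∀ k, k + 1 = n → (c k < c n ↔ y < c n))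
    (hmeet : ∀ k < n, ∀ z ∈ σ k, z ∈ s → z = c n) :
    PathData (n + 1) (Function.update c (n + 1) y) (Function.update σ n s) := by
  have hcu : ∀ k ≤ n, Function.update c (n + 1) y k = c k := fun k hk =>
    Function.update_of_ne (by omega) _ _
  have hσu : ∀ k < n, Function.update σ n s k = σ k := fun k hk =>
    Function.update_of_ne (by omega) _ _
  refine ⟨fun k hk => ?_, fun k hk => ?_, fun i j hij hj z hi hz => ?_⟩
  · rcases Nat.lt_succ_iff_lt_or_eq.1 hk with hk | rfl
    · rw [hcu k hk.le, hcu (k + 1) hk, hσu k hk]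
      exact h.1 k hk
    · rw [hcu k le_rfl, Function.update_self, Function.update_self]
      exact hs
  · rcases Nat.lt_or_ge (k + 1) n with hk' | hk'
    · rw [hcu k (by omega), hcu (k + 1) (by omega), hcu (k + 2) (by omega)]
      exact h.2.1 k hk'
    · obtain rfl : n = k + 1 := by omega
      rw [hcu k (by omega), hcu (k + 1) (by omega), Function.update_self]
      exact halt k rfl
  · rw [hσu i (by omega)] at hi
    rcases Nat.lt_succ_iff_lt_or_eq.1 hj with hj | rfl
    · rw [hσu j hj] at hz
      rw [hcu j hj.le]
      exact h.2.2 i j hij hj z hi hz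
    · rw [Function.update_self] at hz
      obtain rfl := hmeet i hij z hi hz
      rw [hcu j le_rfl]
      refine ⟨?_, rfl⟩
      -- If the chains were not consecutive, `c j` would also be a common point of the chains `i`
      -- and `m`, hence equal to `c m`; but successive points of the sequence differ.
      by_contra hne
      obtain ⟨m, rfl⟩ : ∃ m, j = m + 1 := ⟨j - 1, by omega⟩
      have hm := h.left_mem hc (Nat.lt_succ_self m)
      exact hm.2.2 (h.2.2 i m (by omega) (by omega) _ hi hm.2.1).2.symm

theorem Pth.exists_data (hc : ChainIntervals P) {a y : P} {d : Bool} {p : Set P}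
    (h : Pth a y d p) : ∃ n c σ, PathData n c σ ∧ c 0 = a ∧ c n = y ∧
      p = {a} ∪ (⋃ k ∈ Iio n, σ k) ∧ ∀ k, k + 1 = n → (c k < c n ↔ d = true) := by
  have main : ∀ {c₀ y : P} {p s : Set P} {d : Bool},
      (∃ n c σ, PathData n c σ ∧ c 0 = a ∧ c n = c₀ ∧
        p = {a} ∪ (⋃ k ∈ Iio n, σ k) ∧ ∀ k, k + 1 = n → (c k < c n ↔ d = true)) →
      ((c₀ < y ∧ IsMaxChainBetween c₀ y s) ∨ (y < c₀ ∧ IsMaxChainBetween y c₀ s)) →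
      (d = true ↔ y < c₀) → (∀ z ∈ p, z ∈ s → z = c₀) →
      ∃ n c σ, PathData n c σ ∧ c 0 = a ∧ c n = y ∧
        p ∪ s = {a} ∪ (⋃ k ∈ Iio n, σ k) ∧ ∀ k, k + 1 = n → (c k < c n ↔ (!d) = true) := by
    rintro c₀ y p s d ⟨n, c, σ, hd, h0, rfl, rfl, hdir⟩ hs hds hz
    refine ⟨n + 1, Function.update c (n + 1) y, Function.update σ n s,
      hd.snoc hc hs (fun k hk => (hdir k hk).trans hds) fun k hk z hzk => hz z (Or.inr ?_), ?_, ?_,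
      ?_, ?_⟩
    · exact mem_biUnion (x := k) hk hzk
    · rw [Function.update_of_ne (by omega), h0]
    · rw [Function.update_self]
    · rw [iUnion_Iio_succ, Function.update_self, union_assoc]
      congr 2
      exact iUnion₂_congr fun k hk => (Function.update_of_ne (by simp at hk; omega) _ _).symm
    · intro k hk
      obtain rfl : k = n := by omega
      rw [Function.update_self, Function.update_of_ne (by omega)]
      rcases hs with ⟨hs, -⟩ | ⟨hs, -⟩
      · simp [hs, show d = false by simpa [hs.not_gt] using hds]
      · simp [hs.not_gt, hds.2 hs]
  induction h with
  | nil d => exact ⟨0, fun _ => a, fun _ => ∅, ⟨by simp, by simp, by simp⟩, rfl, rfl, by simp,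
      by simp⟩
  | up _ h1 h2 ih =>
    exact main ih (Or.inl ⟨h1, isMaxChainBetween_Icc hc _ _⟩) (by simp [h1.not_gt])
      fun z hz hz' => h2 z hz hz'.1 hz'.2
  | dn _ h1 h2 ih =>
    exact main ih (Or.inr ⟨h1, isMaxChainBetween_Icc hc _ _⟩) (by simp [h1])
      fun z hz hz' => h2 z hz hz'.1 hz'.2

theorem Pth.isPath (hc : ChainIntervals P) {a y : P} {d : Bool} {p : Set P}
    (h : Pth a y d p) : IsPath a y p := by
  obtain ⟨n, c, σ, h1, h2, h3, h4, -⟩ := h.exists_data hc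
  exact isPath_iff.2 ⟨n, c, σ, h1, h2, h3, h4⟩

theorem PathData.pth (hc : ChainIntervals P) {c : ℕ → P} {σ : ℕ → Set P} : ∀ {n : ℕ},
    PathData n c σ → ∃ d, Pth (c 0) (c n) d ({c 0} ∪ ⋃ k ∈ Iio n, σ k) ∧
      ∀ k, k + 1 = n → (c k < c n ↔ d = true)
  | 0, _ => ⟨true, by simpa using .nil true, by simp⟩
  | n + 1, h => by
    obtain ⟨d, hd, hdir⟩ := PathData.pth hc (n := n)
      ⟨fun k hk => h.1 k (by omega), fun k hk => h.2.1 k (by omega),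
        fun i j hij hj => h.2.2 i j hij (by omega)⟩
    have hmeet : ∀ z ∈ {c 0} ∪ ⋃ k ∈ Iio n, σ k, z ∈ σ n → z = c n := by
      have aux : ∀ i < n, ∀ z ∈ σ i, z ∈ σ n → z = c n := fun i hi z h1 h2 =>
        (h.2.2 i n hi (by omega) z h1 h2).2
      rintro z (rfl | hz) hz'
      · rcases Nat.eq_zero_or_pos n with rfl | hn
        · rfl
        · exact aux 0 hn _ (h.left_mem hc (by omega)).1 hz'
      · obtain ⟨i, hi, hz⟩ := mem_iUnion₂.1 hz
        exact aux i hi z hz hz'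
    -- The trivial path carries either direction, so the direction has to be controlled only for `0
    -- < n`.
    have hd' : ∀ {d' : Bool}, (0 < n → d = d') → Pth (c 0) (c n) d' ({c 0} ∪ ⋃ k ∈ Iio n, σ k) := by
      intro d' hdd
      rcases Nat.eq_zero_or_pos n with rfl | hn
      · simpa using .nil d'
      · exact hdd hn ▸ hd
    rw [iUnion_Iio_succ, ← union_assoc]
    have hprev : 0 < n → (d = true ↔ c (n + 1) < c n) := fun hn => by
      obtain ⟨m, rfl⟩ : ∃ m, n = m + 1 := ⟨n - 1, by omega⟩
      exact (hdir m rfl).symm.trans (h.2.1 m le_rfl)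
    rcases h.1 n (Nat.lt_succ_self n) with ⟨h1, h2⟩ | ⟨h1, h2⟩
    · rw [h2.eq_Icc hc] at hmeet ⊢
      refine ⟨true, .up (hd' fun hn => ?_) h1 fun z hz h3 h4 => hmeet z hz ⟨h3, h4⟩, ?_⟩
      · have := hprev hn
        simpa [h1.not_gt] using this
      · intro k hk
        obtain rfl : k = n := by omega
        simp [h1]
    · rw [h2.eq_Icc hc] at hmeet ⊢
      refine ⟨false, .dn (hd' fun hn => (hprev hn).2 h1) h1 fun z hz h3 h4 => hmeet z hz ⟨h3, h4⟩,
        ?_⟩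
      intro k hk
      obtain rfl : k = n := by omega
      simp [h1.not_gt]

theorem IsPath.exists_pth (hc : ChainIntervals P) {a b : P} {p : Set P} (h : IsPath a b p) :
    ∃ d, Pth a b d p := by
  obtain ⟨n, c, σ, h1, rfl, rfl, rfl⟩ := isPath_iff.1 h
  obtain ⟨d, hd, -⟩ := h1.pth hc
  exact ⟨d, hd⟩

theorem Pth.linked {a y : P} {d : Bool} {p : Set P} (h : Pth a y d p) : Linked a y := by
  induction h with
  | nil => exact .refl
  | up _ h _ ih => exact ih.tail (Or.inl h.le)
  | dn _ h _ ih => exact ih.tail (Or.inr h.le)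

theorem Pth.prev_up {a c : P} {p : Set P} (h : Pth a c true p) :
    c = a ∨ ∃ e ∈ p, e < c ∧ ∀ x, e ≤ x → x ≤ c → x ∈ p := by
  cases h with
  | nil => exact Or.inl rfl
  | @up e _ p _ h _ => exact Or.inr ⟨e, Or.inr ⟨le_rfl, h.le⟩, h, fun x h1 h2 => Or.inr ⟨h1, h2⟩⟩

theorem Pth.prev_dn {a c : P} {p : Set P} (h : Pth a c false p) :
    c = a ∨ ∃ e ∈ p, c < e ∧ ∀ x, c ≤ x → x ≤ e → x ∈ p := by
  cases h with
  | nil => exact Or.inl rfl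
  | @dn e _ p _ h _ => exact Or.inr ⟨e, Or.inr ⟨h.le, le_rfl⟩, h, fun x h1 h2 => Or.inr ⟨h1, h2⟩⟩

/-- In a cycle-free order, every point of an alternating path separates its endpoints. -/
theorem Pth.not_joined (hP : CycleFree P) {a y : P} {d : Bool} {p : Set P} (h : Pth a y d p) :
    ∀ z ∈ p, ¬Joined z a y := by
  induction h with
  | nil => rintro z rfl hz; exact hz.ne_left rfl
  | @up c y p h0 hcy hp ih =>
    intro z hz hj
    by_cases hzp : z ∈ p
    · by_cases hzc : z = c
      · subst hzc
        rcases h0.prev_dn with rfl | ⟨e, he, hze, hep⟩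
        · exact hj.ne_left rfl
        -- The point `e` is reached before the turn `z`, so `e` and `y` would be joined around `z`
        -- while both lie above it. Their common lower bound above `z` would lie in two consecutive
        -- segments, which meet only in `z`.
        have hae : Joined z a e := by
          by_contra hcon
          exact hze.ne' (hP.eq_of_not_joined (ih e he) hcon)
        obtain ⟨w, hzw, hwe, hwy⟩ := hP.above hze hcy (hae.symm.trans hj)
        exact hzw.ne' (hp w (hep w hzw.le hwe) hzw.le hwy)
      · refine ih z hzp (hj.trans (.of_ge hcy.le fun h => hzc (hp z hzp h.1 h.2)))
    · have hz2 := hz.resolve_left hzp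
      exact hP.not_joined_of_le hz2.1 hz2.2 ((h0.joined hzp).symm.trans hj)
  | @dn c y p h0 hcy hp ih =>
    intro z hz hj
    by_cases hzp : z ∈ p
    · by_cases hzc : z = c
      · subst hzc
        rcases h0.prev_up with rfl | ⟨e, he, hze, hep⟩
        · exact hj.ne_left rfl
        have hae : Joined z a e := by
          by_contra hcon
          exact hze.ne (hP.eq_of_not_joined (ih e he) hcon)
        obtain ⟨w, hzw, hwe, hwy⟩ := hP.below hze hcy (hae.symm.trans hj)
        exact hzw.ne (hp w (hep w hwe hzw.le) hwy hzw.le)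
      · refine ih z hzp (hj.trans (.of_le hcy.le fun h => hzc (hp z hzp h.1 h.2)))
    · have hz2 := hz.resolve_left hzp
      exact hP.not_joined_of_le hz2.1 hz2.2 (((h0.joined hzp).symm.trans hj).symm)

/-- A path leaves no choice for its points: those on it separate its endpoints (`Pth.not_joined`),
and around those off it the path itself joins them (`Pth.joined`). A path exists because linked
points can be joined by straightening. -/
theorem CycleFree.isPath_iff (hP : CycleFree P) (hl : PairComplete P) {a b : P} {p : Set P} :
    IsPath a b p ↔ p = {z | ¬Joined z a b} := by
  have key : ∀ {p}, IsPath a b p → p = {z | ¬Joined z a b} := by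
    intro p h
    obtain ⟨d, hd⟩ := h.exists_pth hP.chainIntervals
    ext z
    exact ⟨fun hz => hd.not_joined hP z hz, fun hz => by_contra fun hzp => hz (hd.joined hzp)⟩
  refine ⟨key, ?_⟩
  rintro rfl
  obtain ⟨d, p, hp⟩ := (hP.linked a b).exists_pth hP.chainIntervals hl
  have := hp.isPath hP.chainIntervals
  rwa [key this] at this

end Pth

end CFPO

/-! ### Cycle-freeness of the Dedekind–MacNeille completion. -/

namespace CFPO

section Completion

open Set

variable {M : Type*} [PartialOrder M]

theorem Completion.le_iff_right {x y : Completion M} : x ≤ y ↔ y.1.right ⊆ x.1.right :=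
  Concept.intent_subset_intent_iff.symm

theorem toCompletion_le_iff {a : M} {x : Completion M} : toCompletion a ≤ x ↔ a ∈ x.1.left :=
  DedekindCut.principal_le_iff

theorem le_toCompletion_iff {a : M} {x : Completion M} : x ≤ toCompletion a ↔ a ∈ x.1.right :=
  DedekindCut.le_principal_iff

theorem toCompletion_le {a b : M} : toCompletion a ≤ toCompletion b ↔ a ≤ b :=
  DedekindCut.principal_le_principal

theorem toCompletion_injective : Function.Injective (toCompletion : M → Completion M) :=
  fun _ _ h => (toCompletion_le.1 h.le).antisymm (toCompletion_le.1 h.ge)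

theorem Completion.le_of_forall_left {x y : Completion M}
    (h : ∀ m, toCompletion m ≤ x → toCompletion m ≤ y) : x ≤ y :=
  fun m hm => toCompletion_le_iff.1 (h m (toCompletion_le_iff.2 hm))

theorem Completion.le_of_forall_right {x y : Completion M}
    (h : ∀ m, y ≤ toCompletion m → x ≤ toCompletion m) : x ≤ y :=
  Completion.le_iff_right.2 fun m hm => le_toCompletion_iff.1 (h m (le_toCompletion_iff.2 hm))

theorem Completion.exists_le (x : Completion M) : ∃ a, toCompletion a ≤ x :=
  x.2.1.imp fun _ => toCompletion_le_iff.2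

theorem Completion.exists_ge (x : Completion M) : ∃ a, x ≤ toCompletion a :=
  x.2.2.imp fun _ => le_toCompletion_iff.2

/-- Bounds are formed in the lattice of all cuts; the given bound `b` keeps the upper or the lower
part non-empty. -/
theorem Completion.pairComplete : PairComplete (Completion M) where
  sup {u v b} hu hv := by
    obtain ⟨a, ha⟩ := u.exists_le
    obtain ⟨c, hc⟩ := b.exists_ge
    refine ⟨⟨u.1 ⊔ v.1, ⟨a, ?_⟩, ⟨c, ?_⟩⟩, ?_, ?_, fun x h h' => ?_⟩
    · exact (le_sup_left : u.1 ≤ u.1 ⊔ v.1) (toCompletion_le_iff.1 ha)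
    · exact DedekindCut.le_principal_iff.1 (sup_le (hu.trans hc) (hv.trans hc))
    · exact (le_sup_left : u.1 ≤ u.1 ⊔ v.1)
    · exact (le_sup_right : v.1 ≤ u.1 ⊔ v.1)
    · exact (sup_le h h' : u.1 ⊔ v.1 ≤ x.1)
  inf {u v b} hu hv := by
    obtain ⟨a, ha⟩ := u.exists_ge
    obtain ⟨c, hc⟩ := b.exists_le
    refine ⟨⟨u.1 ⊓ v.1, ⟨c, ?_⟩, ⟨a, ?_⟩⟩, ?_, ?_, fun x h h' => ?_⟩
    · exact DedekindCut.principal_le_iff.1 (le_inf (hc.trans hu) (hc.trans hv))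
    · exact DedekindCut.le_principal_iff.1
        ((inf_le_left : u.1 ⊓ v.1 ≤ u.1).trans (DedekindCut.le_principal_iff.2
          (le_toCompletion_iff.1 ha)))
    · exact (inf_le_left : u.1 ⊓ v.1 ≤ u.1)
    · exact (inf_le_right : u.1 ⊓ v.1 ≤ v.1)
    · exact (le_inf h h' : x.1 ≤ u.1 ⊓ v.1)

theorem isCFPO_of_cycleFree (h : CycleFree (Completion M)) : IsCFPO M := fun _ _ =>
  ⟨_, (h.isPath_iff Completion.pairComplete).2 rfl,
    fun _ hp => (h.isPath_iff Completion.pairComplete).1 hp⟩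

theorem exists_maxChainBetween {P : Type*} [PartialOrder P] {u x v : P} (hux : u ≤ x)
    (hxv : x ≤ v) : ∃ s, IsMaxChainBetween u v s ∧ x ∈ s := by
  obtain ⟨s, hs, hxs⟩ := (IsChain.singleton (r := ((· ≤ ·) : Icc u v → Icc u v → Prop))
    (a := ⟨x, hux, hxv⟩)).exists_maxChain
  refine ⟨Subtype.val '' s, ⟨?_, ?_, ?_⟩, ⟨_, hxs rfl, rfl⟩⟩
  · rintro _ ⟨y, -, rfl⟩
    exact y.2
  · rintro _ ⟨y, hy, rfl⟩ _ ⟨z, hz, rfl⟩ hyz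
    exact hs.1 hy hz fun h => hyz (congrArg _ h)
  · intro t ht htc hst
    refine Subset.antisymm (fun y hy => ?_) hst
    have := hs.2 (t := Subtype.val ⁻¹' t)
      (fun a ha b hb hab => htc ha hb fun h => hab (Subtype.ext h))
      (fun a ha => hst ⟨a, ha, rfl⟩)
    exact ⟨⟨y, ht hy⟩, this ▸ hy, rfl⟩

theorem isPath_of_maxChain {P : Type*} [PartialOrder P] {u v : P} (h : u < v) {s : Set P}
    (hs : IsMaxChainBetween u v s) : IsPath u v ({u} ∪ s) := by
  refine ⟨1, fun k => if k = 0 then u else v, fun _ => s, rfl, rfl, fun k hk => Or.inl ?_,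
    fun k hk => by omega, fun i j hi hj => by omega, ?_⟩
  · obtain rfl : k = 0 := by omega
    exact ⟨h, hs⟩
  · congr 1
    ext z
    simp

/-- After enlarging the interval to one with endpoints in `M`, maximal chains through `x` and
through `y` both give paths between the same points of `M`, so uniqueness of paths puts `x` and `y`
on one chain. -/
theorem IsCFPO.chainIntervals (hM : IsCFPO M) : ChainIntervals (Completion M) := by
  intro u x y v ux xv uy yv
  obtain ⟨a, ha⟩ := u.exists_le
  obtain ⟨b, hb⟩ := v.exists_ge
  have hax := ha.trans ux
  have hxb := xv.trans hb
  have hay := ha.trans uy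
  have hyb := yv.trans hb
  rcases (hax.trans hxb).eq_or_lt with hab | hab
  · exact Or.inl (hxb.trans (hab ▸ hay))
  · obtain ⟨s, hs, hxs⟩ := exists_maxChainBetween hax hxb
    obtain ⟨t, ht, hyt⟩ := exists_maxChainBetween hay hyb
    have h1 : y ∈ ({toCompletion a} : Set (Completion M)) ∪ s :=
      (hM a b).unique (isPath_of_maxChain hab hs) (isPath_of_maxChain hab ht) ▸ Or.inr hyt
    rcases h1 with rfl | h1
    · exact Or.inr hax
    · exact hs.2.1.total hxs h1

theorem IsCFPO.not_joined (hM : IsCFPO M) {a b : M} {d : Bool} {p : Set (Completion M)}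
    {z : Completion M} (h : Pth (toCompletion a) (toCompletion b) d p) (hz : z ∈ p) :
    ¬Joined z (toCompletion a) (toCompletion b) := by
  intro hj
  obtain ⟨d', p', hp', hzp⟩ := hj.exists_pth hM.chainIntervals Completion.pairComplete
  have := (hM a b).unique (h.isPath hM.chainIntervals) (hp'.isPath hM.chainIntervals)
  exact hzp (this ▸ hz)

/-- A failure of one of the separation conditions would put `z` on a path between two points of `M`
that are also joined around `z`, against `IsCFPO.not_joined`. The path is a single interval for
`not_joined`, an ascent to `z` and a descent for `below`, and the reverse for `above`. -/
theorem IsCFPO.cycleFree (hM : IsCFPO M) : CycleFree (Completion M) where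
  linked u v := by
    obtain ⟨a, ha⟩ := u.exists_le
    obtain ⟨b, hb⟩ := v.exists_le
    obtain ⟨p, hp, -⟩ := hM a b
    obtain ⟨d, hd⟩ := hp.exists_pth hM.chainIntervals
    exact (Relation.ReflTransGen.head (r := fun u v : Completion M => u ≤ v ∨ v ≤ u)
      (Or.inr ha) hd.linked).tail (Or.inl hb)
  not_joined {u z v} huz hzv hj := by
    obtain ⟨a, ha⟩ := u.exists_le
    obtain ⟨b, hb⟩ := v.exists_ge
    have hab : toCompletion a < toCompletion b :=
      (ha.trans_lt huz).trans (hzv.trans_le hb)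
    refine hM.not_joined (.up (.nil false) hab (by rintro z rfl _ _; rfl))
      (Or.inr ⟨ha.trans huz.le, hzv.le.trans hb⟩ : z ∈ _) ?_
    exact (Joined.of_le ha fun h => huz.not_ge h.2).trans
      (hj.trans (.of_le hb fun h => hzv.not_ge h.1))
  below {u z v} hu hv hj := by
    by_contra hcon
    push Not at hcon
    obtain ⟨a, ha⟩ := u.exists_le
    obtain ⟨b, hb⟩ := v.exists_le
    refine hM.not_joined (.dn (.up (.nil false) (ha.trans_lt hu) (by rintro z rfl _ _; rfl))
      (hb.trans_lt hv) ?_) (Or.inr ⟨hb.trans hv.le, le_rfl⟩ : z ∈ _) ?_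
    -- Ascent and descent meet only in `z`: a common point `w < z` is comparable with `u` and with
    -- `v`, and every case produces a common upper bound of `u` and `v` below `z`.
    · intro w hw hbw hwz
      have haw : toCompletion a ≤ w := hw.elim (fun h => h.ge) And.left
      by_contra hne
      have hwz := hwz.lt_of_ne hne
      have huv : ¬u ≤ v := fun h => hcon v hv h le_rfl
      have hvu : ¬v ≤ u := fun h => hcon u hu le_rfl h
      rcases hM.chainIntervals haw hwz.le ha hu.le with h1 | h1
      · rcases hM.chainIntervals hbw hwz.le hb hv.le with h2 | h2
        · exact (hM.chainIntervals (hbw.trans h1) hu.le hb hv.le).elim huv hvu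
        · exact hvu (h2.trans h1)
      · rcases hM.chainIntervals hbw hwz.le hb hv.le with h2 | h2
        · exact huv (h1.trans h2)
        · exact hcon w hwz h1 h2
    · exact (Joined.of_le ha fun h => hu.not_ge h.2).trans
        (hj.trans (.of_ge hb fun h => hv.not_ge h.2))
  above {u z v} hu hv hj := by
    by_contra hcon
    push Not at hcon
    obtain ⟨a, ha⟩ := u.exists_ge
    obtain ⟨b, hb⟩ := v.exists_ge
    refine hM.not_joined (.up (.dn (.nil true) (hu.trans_le ha) (by rintro z rfl _ _; rfl))
      (hv.trans_le hb) ?_) (Or.inr ⟨le_rfl, hv.le.trans hb⟩ : z ∈ _) ?_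
    · intro w hw hzw hwb
      have hwa : w ≤ toCompletion a := hw.elim (fun h => h.le) And.right
      by_contra hne
      have hzw := hzw.lt_of_ne' hne
      have huv : ¬u ≤ v := fun h => hcon u hu le_rfl h
      have hvu : ¬v ≤ u := fun h => hcon v hv h le_rfl
      rcases hM.chainIntervals hzw.le hwa hu.le ha with h1 | h1
      · rcases hM.chainIntervals hzw.le hwb hv.le hb with h2 | h2
        · exact hcon w hzw h1 h2
        · exact hvu (h2.trans h1)
      · rcases hM.chainIntervals hzw.le hwb hv.le hb with h2 | h2
        · exact huv (h1.trans h2)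
        · exact (hM.chainIntervals hu.le (h1.trans hwb) hv.le hb).elim huv hvu
    · exact (Joined.of_ge ha fun h => hu.not_ge h.1).trans
        (hj.trans (.of_le hb fun h => hv.not_ge h.1))

theorem IsCFPO.mem_path_iff (hM : IsCFPO M) {m a b : M} :
    m ∈ path a b ↔ ¬Joined (toCompletion m) (toCompletion a) (toCompletion b) := by
  constructor
  · rintro ⟨p, hp, hm⟩
    rw [(hM.cycleFree.isPath_iff Completion.pairComplete).1 hp] at hm
    exact hm
  · intro h
    exact ⟨_, (hM.cycleFree.isPath_iff Completion.pairComplete).2 rfl, h⟩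

end Completion

/-! ### Calculus of paths between points of `M`. -/

section Path

open Set

variable {M : Type*} [PartialOrder M] (hM : IsCFPO M)
include hM

theorem IsCFPO.path_comm (a b : M) : path a b = path b a := by
  ext m
  rw [hM.mem_path_iff, hM.mem_path_iff]
  exact not_congr ⟨Joined.symm, Joined.symm⟩

theorem IsCFPO.left_mem_path (a b : M) : a ∈ path a b :=
  hM.mem_path_iff.2 fun h => h.ne_left rfl

theorem IsCFPO.right_mem_path (a b : M) : b ∈ path a b :=
  hM.mem_path_iff.2 fun h => h.ne_right rfl

theorem IsCFPO.mem_path_or {m a b : M} (h : m ∈ path a b) (c : M) :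
    m ∈ path a c ∨ m ∈ path c b := by
  simp only [hM.mem_path_iff] at *
  by_contra hcon
  push Not at hcon
  exact h (hcon.1.trans hcon.2)

theorem IsCFPO.mem_path_trans {m a b c : M} (h : c ∈ path m a) (h' : a ∈ path m b) :
    c ∈ path m b := by
  simp only [hM.mem_path_iff] at *
  exact not_joined_trans h h'

theorem IsCFPO.mem_path_antisymm {m a b : M} (h : a ∈ path m b) (h' : b ∈ path m a) : a = b := by
  simp only [hM.mem_path_iff] at *
  exact toCompletion_injective (hM.cycleFree.eq_of_not_joined h h')

theorem IsCFPO.path_of_le {a b : M} (h : a ≤ b) : path a b = Icc a b := by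
  ext m
  rw [hM.mem_path_iff, hM.cycleFree.not_joined_iff (toCompletion_le.2 h), toCompletion_le,
    toCompletion_le]
  rfl

theorem IsCFPO.path_self (a : M) : path a a = {a} := by
  rw [hM.path_of_le le_rfl, Icc_self]

theorem IsCFPO.chain {a x y b : M} (ax : a ≤ x) (xb : x ≤ b) (ay : a ≤ y) (yb : y ≤ b) :
    x ≤ y ∨ y ≤ x := by
  simpa only [toCompletion_le] using hM.chainIntervals (toCompletion_le.2 ax)
    (toCompletion_le.2 xb) (toCompletion_le.2 ay) (toCompletion_le.2 yb)

/-- A walk in `M^D` may leave `M`. The invariant is that every point of `M` below the current point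
can be reached inside `M`. -/
theorem IsCFPO.linked (a b : M) : Linked a b := by
  have key : ∀ {y}, Linked (toCompletion a) y → ∀ m, toCompletion m ≤ y → Linked a m := by
    intro y h
    induction h with
    | refl => exact fun m h => .single (Or.inr (toCompletion_le.1 h))
    | @tail y y' _ h ih =>
      intro m' hm'
      rcases h with h | h
      · obtain ⟨m, hm⟩ := y.exists_le
        obtain ⟨b, hb⟩ := y'.exists_ge
        exact ((ih m hm).tail (Or.inl (toCompletion_le.1 ((hm.trans h).trans hb)))).tail
          (Or.inr (toCompletion_le.1 (hm'.trans hb)))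
      · exact ih m' (hm'.trans h)
  exact key (hM.cycleFree.linked _ _) b le_rfl

end Path

/-! ### Extension of automorphisms to the completion. -/

section CompletionMap

variable {M N : Type*} [PartialOrder M] [PartialOrder N]

open Set

/-- The order isomorphism of completions induced by an order isomorphism. -/
def completionMap (φ : M ≃o N) : Completion M ≃o Completion N where
  toFun x := ⟨⟨φ.symm ⁻¹' x.1.left, φ.symm ⁻¹' x.1.right, by
      ext b
      rw [mem_upperPolar_iff, mem_preimage, ← DedekindCut.upperBounds_left, mem_upperBounds]
      exact ⟨fun h a ha => φ.le_symm_apply.2 (h (by simpa using ha)),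
        fun h a ha => φ.symm.le_iff_le.1 (h _ ha)⟩, by
      ext b
      rw [mem_lowerPolar_iff, mem_preimage, ← DedekindCut.lowerBounds_right, mem_lowerBounds]
      exact ⟨fun h a ha => φ.symm_apply_le.2 (h (by simpa using ha)),
        fun h a ha => φ.symm.le_iff_le.1 (h _ ha)⟩⟩,
    x.2.1.preimage φ.symm.surjective, x.2.2.preimage φ.symm.surjective⟩
  invFun x := ⟨⟨φ ⁻¹' x.1.left, φ ⁻¹' x.1.right, by
      ext b
      rw [mem_upperPolar_iff, mem_preimage, ← DedekindCut.upperBounds_left, mem_upperBounds]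
      exact ⟨fun h a ha => φ.symm_apply_le.1 (h (by simpa using ha)),
        fun h a ha => φ.le_iff_le.1 (h _ ha)⟩, by
      ext b
      rw [mem_lowerPolar_iff, mem_preimage, ← DedekindCut.lowerBounds_right, mem_lowerBounds]
      exact ⟨fun h a ha => φ.le_symm_apply.1 (h (by simpa using ha)),
        fun h a ha => φ.le_iff_le.1 (h _ ha)⟩⟩,
    x.2.1.preimage φ.surjective, x.2.2.preimage φ.surjective⟩
  left_inv x := by
    apply Subtype.ext
    apply DedekindCut.ext
    ext m
    exact iff_of_eq (congrArg (· ∈ x.1.left) (φ.symm_apply_apply m))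
  right_inv x := by
    apply Subtype.ext
    apply DedekindCut.ext
    ext m
    exact iff_of_eq (congrArg (· ∈ x.1.left) (φ.apply_symm_apply m))
  map_rel_iff' {x y} :=
    ⟨fun h m hm => by simpa using h (show φ m ∈ φ.symm ⁻¹' x.1.left by simpa using hm),
      fun h m hm => h hm⟩

theorem toCompletion_le_completionMap {φ : M ≃o N} {x : Completion M} {m : N} :
    toCompletion m ≤ completionMap φ x ↔ toCompletion (φ.symm m) ≤ x := by
  rw [toCompletion_le_iff, toCompletion_le_iff]
  rfl

theorem completionMap_toCompletion (φ : M ≃o N) (a : M) :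
    completionMap φ (toCompletion a) = toCompletion (φ a) := by
  apply le_antisymm <;> refine Completion.le_of_forall_left fun m hm => ?_
  · rw [toCompletion_le_completionMap, toCompletion_le] at hm
    exact toCompletion_le.2 (φ.symm_apply_le.1 hm)
  · rw [toCompletion_le_completionMap, toCompletion_le]
    exact φ.symm_apply_le.2 (toCompletion_le.1 hm)

theorem Joined.map {P Q : Type*} [PartialOrder P] [PartialOrder Q] (f : P ↪o Q) {z u v : P}
    (h : Joined z u v) : Joined (f z) (f u) (f v) := by
  have step : ∀ {u v}, Link z u v → Link (f z) (f u) (f v) := fun h => by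
    simpa only [Link, f.le_iff_le] using h
  induction h with
  | single h => exact .single (step h)
  | tail _ h ih => exact ih.tail (step h)

theorem joined_map_iff {P Q : Type*} [PartialOrder P] [PartialOrder Q] (f : P ≃o Q) {z u v : P} :
    Joined (f z) (f u) (f v) ↔ Joined z u v :=
  ⟨fun h => by simpa using h.map f.symm.toOrderEmbedding, fun h => h.map f.toOrderEmbedding⟩

theorem IsCFPO.map_mem_path_iff (hM : IsCFPO M) (φ : M ≃o M) {m a b : M} :
    φ m ∈ path (φ a) (φ b) ↔ m ∈ path a b := by
  rw [hM.mem_path_iff, hM.mem_path_iff]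
  simp only [← completionMap_toCompletion, joined_map_iff]

end CompletionMap

end CFPO

namespace CFPO

open Set

/-! ### Gates from the points of `M` to `A`. -/

section Gates

variable {M : Type*} [PartialOrder M] {A : Set M}

/-- The gates from `m` to `A`: the points of `A` that can be reached from `m` without meeting any
other point of `A`. -/
def gates (A : Set M) (m : M) : Set M := {a | a ∈ A ∧ ∀ b ∈ A, b ∈ path m a → b = a}

/-- Every point has one gate to `A`, or two gates which are adjacent in `A`, and every path to a
point of `A` leads through a gate. -/
structure Gated (A : Set M) : Prop where
  gates_cases : ∀ m, (∃ a : A, gates A m = {(a : M)}) ∨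
    ∃ a a' : A, a ⋖ a' ∧ gates A m = {(a : M), (a' : M)}
  exists_gate : ∀ m, ∀ b ∈ A, ∃ g ∈ gates A m, g ∈ path m b

theorem IsCFPO.gates_of_mem (hM : IsCFPO M) {a : M} (ha : a ∈ A) : gates A a = {a} := by
  ext b
  constructor
  · rintro ⟨-, h⟩
    exact (h a ha (hM.left_mem_path a b)).symm
  · rintro rfl
    refine ⟨ha, fun c _ hc => ?_⟩
    rwa [hM.path_self] at hc

theorem IsCFPO.gates_eq_singleton (hM : IsCFPO M) {a m : M} (ha : a ∈ A)
    (h : ∀ b ∈ A, a ∈ path m b) : gates A m = {a} := by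
  ext b
  constructor
  · rintro ⟨hb, h'⟩
    exact (h' a ha (h b hb)).symm
  · rintro rfl
    exact ⟨ha, fun c hc hcb => hM.mem_path_antisymm hcb (h c hc)⟩

theorem IsCFPO.gates_eq_pair (hM : IsCFPO M) {a a' m : M} (ha : a ∈ A) (ha' : a' ∈ A)
    (h : ∀ b ∈ A, a ∈ path m b ∨ a' ∈ path m b) (h1 : a ∉ path m a') (h2 : a' ∉ path m a) :
    gates A m = {a, a'} := by
  ext b
  constructor
  · rintro ⟨hb, h'⟩
    exact (h b hb).imp (fun h => (h' a ha h).symm) fun h => (h' a' ha' h).symm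
  · rintro (rfl | rfl)
    · refine ⟨ha, fun c hc hcb => ?_⟩
      exact (h c hc).elim (hM.mem_path_antisymm hcb)
        fun h => absurd (hM.mem_path_trans h hcb) h2
    · refine ⟨ha', fun c hc hcb => ?_⟩
      exact (h c hc).elim (fun h => absurd (hM.mem_path_trans h hcb) h1)
        (hM.mem_path_antisymm hcb)

/-- A pair through which all paths to `A` lead may degenerate: if one member lies on the path from
`m` to the other, it is the only gate. Otherwise both are gates. -/
theorem IsCFPO.gated_of_forall (hM : IsCFPO M)
    (h : ∀ m ∉ A, (∃ a ∈ A, ∀ b ∈ A, a ∈ path m b) ∨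
      ∃ a a' : A, a ⋖ a' ∧ ∀ b ∈ A, (a : M) ∈ path m b ∨ (a' : M) ∈ path m b) : Gated A := by
  have key : ∀ m, (∃ a ∈ A, ∀ b ∈ A, a ∈ path m b) ∨
      ∃ a a' : A, a ⋖ a' ∧ (∀ b ∈ A, (a : M) ∈ path m b ∨ (a' : M) ∈ path m b) ∧
        gates A m = {(a : M), (a' : M)} := by
    intro m
    by_cases hm : m ∈ A
    · exact Or.inl ⟨m, hm, fun b _ => hM.left_mem_path m b⟩
    rcases h m hm with h | ⟨a, a', haa, h⟩
    · exact Or.inl h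
    by_cases h1 : (a : M) ∈ path m a'
    · exact Or.inl ⟨a, a.2, fun b hb => (h b hb).elim id (hM.mem_path_trans h1)⟩
    by_cases h2 : (a' : M) ∈ path m a
    · exact Or.inl ⟨a', a'.2, fun b hb => (h b hb).elim (hM.mem_path_trans h2) id⟩
    exact Or.inr ⟨a, a', haa, h, hM.gates_eq_pair a.2 a'.2 h h1 h2⟩
  refine ⟨fun m => ?_, fun m b hb => ?_⟩
  · rcases key m with ⟨a, ha, h⟩ | ⟨a, a', haa, -, h⟩
    · exact Or.inl ⟨⟨a, ha⟩, hM.gates_eq_singleton ha h⟩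
    · exact Or.inr ⟨a, a', haa, h⟩
  · rcases key m with ⟨a, ha, h⟩ | ⟨a, a', haa, h', h⟩
    · exact ⟨a, hM.gates_eq_singleton ha h ▸ rfl, h b hb⟩
    · rw [h]
      rcases h' b hb with h | h
      · exact ⟨a, Or.inl rfl, h⟩
      · exact ⟨a', Or.inr rfl, h⟩

/-- For `m ∉ A`, the whole of `A` lies outside the class `C` of `m`. If `C` is attached at a point,
that point is on every path from `m` to `A`. Otherwise each point of `A` lies in `B` or `B'`, and
the corresponding member of the adjacent pair is on the path. -/
theorem IsCFPO.gated (hM : IsCFPO M)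
    (hC : ∀ C ∈ pathClasses A, AttachedAtPoint A C ∧ LiesBetweenAdjacent A C) : Gated A := by
  refine hM.gated_of_forall fun m hm => ?_
  set C : Set M := {y | y ∉ A ∧ path m y ∩ A = ∅} with hCdef
  have hmC : m ∈ C := ⟨hm, by
    rw [hM.path_self]
    exact singleton_inter_eq_empty.2 hm⟩
  have hAC : ∀ b ∈ A, b ∉ C := fun b hb h => h.1 hb
  obtain ⟨h1, h2⟩ := hC C ⟨m, hm, rfl⟩
  rcases (setPath C Cᶜ).eq_empty_or_nonempty with he | he
  · obtain ⟨B, B', -, hB, a, a', haa, ha, ha'⟩ := h2 he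
    refine Or.inr ⟨a, a', haa, fun b hb => ?_⟩
    have hbB : {y | y ∉ C ∧ path b y ∩ C = ∅} ∈ ({B, B'} : Set (Set M)) :=
      hB ▸ ⟨b, hAC b hb, rfl⟩
    have hbb : b ∈ {y | y ∉ C ∧ path b y ∩ C = ∅} := ⟨hAC b hb, by
      rw [hM.path_self]
      exact singleton_inter_eq_empty.2 (hAC b hb)⟩
    rcases hbB with h | h
    · exact Or.inl ((ha.ge rfl : (a : M) ∈ setPath C B).2 m hmC b (h ▸ hbb))
    · exact Or.inr ((ha'.ge rfl : (a' : M) ∈ setPath C B').2 m hmC b (h ▸ hbb))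
  · obtain ⟨a, haA, ha⟩ := h1 he
    exact Or.inl ⟨a, haA, fun b hb => (ha.ge rfl : a ∈ setPath C Cᶜ).2 m hmC b (hAC b hb)⟩

theorem gates_subset (m : M) : gates A m ⊆ A := fun _ h => h.1

theorem IsCFPO.gates_map (hM : IsCFPO M) {φ : M ≃o M} (hφ : ∀ a, φ a ∈ A ↔ a ∈ A) {m g : M} :
    φ g ∈ gates A (φ m) ↔ g ∈ gates A m := by
  refine and_congr (hφ g) ⟨fun h b hb hbm => ?_, fun h b hb hbm => ?_⟩
  · exact φ.injective (h _ ((hφ b).2 hb) ((hM.map_mem_path_iff φ).2 hbm))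
  · obtain ⟨b, rfl⟩ := φ.surjective b
    exact congrArg φ (h b ((hφ b).1 hb) ((hM.map_mem_path_iff φ).1 hbm))

namespace Gated

variable (hM : IsCFPO M) (hG : Gated A)
include hM hG

omit hM in
theorem comparable {m g g' : M} (hg : g ∈ gates A m) (hg' : g' ∈ gates A m) :
    g ≤ g' ∨ g' ≤ g := by
  rcases hG.gates_cases m with ⟨a, h⟩ | ⟨a, a', haa, h⟩
  · rw [h] at hg hg'
    exact Or.inl (hg.trans hg'.symm).le
  · rw [h] at hg hg'
    have := haa.le
    rcases hg with rfl | rfl <;> rcases hg' with rfl | rfl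
    · exact Or.inl le_rfl
    · exact Or.inl haa.le
    · exact Or.inr haa.le
    · exact Or.inl le_rfl

/-- If the path meets `A`, it meets a gate of `x` on the way. If it misses `A`, no point of `A` can
come between, and the gates stay the same. This dichotomy controls all comparabilities between
blocks. -/
theorem crossing (x y : M) :
    (x ∉ A ∧ y ∉ A ∧ gates A x = gates A y) ∨ ∃ g ∈ gates A x, g ∈ path x y := by
  by_contra hcon
  push Not at hcon
  have hA : ∀ b ∈ A, b ∉ path x y := fun b hb h => by
    obtain ⟨g, hg, h'⟩ := hG.exists_gate x b hb
    exact hcon.2 g hg (hM.mem_path_trans h' h)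
  have aux : ∀ {x y : M}, (∀ b ∈ A, b ∉ path x y) → gates A x ⊆ gates A y := by
    intro x y h g hg
    refine ⟨hg.1, fun b hb hby => ?_⟩
    rcases hM.mem_path_or hby x with h' | h'
    · rw [hM.path_comm] at h'
      exact absurd h' (h b hb)
    · exact hg.2 b hb h'
  refine hcon.1 (fun h => hA x h (hM.left_mem_path x y)) (fun h => hA y h (hM.right_mem_path x y))
    ((aux hA).antisymm (aux fun b hb h => hA b hb ?_))
  rwa [hM.path_comm] at h

theorem crossing_left {x y : M} (h : x ≤ y) :
    (x ∉ A ∧ y ∉ A ∧ gates A x = gates A y) ∨ ∃ g ∈ gates A x, x ≤ g ∧ g ≤ y := by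
  have := crossing hM hG x y
  rwa [hM.path_of_le h] at this

theorem crossing_right {x y : M} (h : x ≤ y) :
    (x ∉ A ∧ y ∉ A ∧ gates A x = gates A y) ∨ ∃ g ∈ gates A y, x ≤ g ∧ g ≤ y := by
  have := crossing hM hG y x
  rw [hM.path_comm, hM.path_of_le h] at this
  exact this.imp (fun h => ⟨h.2.1, h.1, h.2.2.symm⟩) id

/-- Each `u ∈ U` lies below a gate of `m` that is itself below `m`. The gates are at most two and
comparable, so the largest gate below `m` bounds all of `U`. Suprema in the completion of `A`
thereby agree with those in `M^D`. -/
theorem exists_between_of_upper {U : Set M} (hU : U ⊆ A) (hne : U.Nonempty) {m : M}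
    (hm : ∀ u ∈ U, u ≤ m) : ∃ a ∈ A, (∀ u ∈ U, u ≤ a) ∧ a ≤ m := by
  have hg : ∀ u ∈ U, ∃ g ∈ gates A m, u ≤ g ∧ g ≤ m := fun u hu => by
    obtain ⟨g, hg, h⟩ := hG.exists_gate m u (hU hu)
    rw [hM.path_comm, hM.path_of_le (hm u hu)] at h
    exact ⟨g, hg, h⟩
  obtain ⟨u₀, hu₀⟩ := hne
  rcases hG.gates_cases m with ⟨a, h⟩ | ⟨a, a', haa, h⟩
  · rw [h] at hg
    refine ⟨a, a.2, fun u hu => ?_, ?_⟩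
    · obtain ⟨_, rfl, h1, -⟩ := hg u hu
      exact h1
    · obtain ⟨_, rfl, -, h1⟩ := hg u₀ hu₀
      exact h1
  · rw [h] at hg
    have haa' : (a : M) ≤ a' := haa.le
    by_cases hm' : (a' : M) ≤ m
    · refine ⟨a', a'.2, fun u hu => ?_, hm'⟩
      obtain ⟨_, rfl | rfl, h1, -⟩ := hg u hu
      · exact h1.trans haa'
      · exact h1
    · have hg' : ∀ u ∈ U, u ≤ a ∧ (a : M) ≤ m := fun u hu => by
        obtain ⟨_, rfl | rfl, h1⟩ := hg u hu
        · exact h1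
        · exact absurd h1.2 hm'
      exact ⟨a, a.2, fun u hu => (hg' u hu).1, (hg' u₀ hu₀).2⟩

theorem exists_between_of_lower {U : Set M} (hU : U ⊆ A) (hne : U.Nonempty) {m : M}
    (hm : ∀ u ∈ U, m ≤ u) : ∃ a ∈ A, (∀ u ∈ U, a ≤ u) ∧ m ≤ a := by
  have hg : ∀ u ∈ U, ∃ g ∈ gates A m, m ≤ g ∧ g ≤ u := fun u hu => by
    obtain ⟨g, hg, h⟩ := hG.exists_gate m u (hU hu)
    rw [hM.path_of_le (hm u hu)] at h
    exact ⟨g, hg, h⟩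
  obtain ⟨u₀, hu₀⟩ := hne
  rcases hG.gates_cases m with ⟨a, h⟩ | ⟨a, a', haa, h⟩
  · rw [h] at hg
    refine ⟨a, a.2, fun u hu => ?_, ?_⟩
    · obtain ⟨_, rfl, -, h1⟩ := hg u hu
      exact h1
    · obtain ⟨_, rfl, h1, -⟩ := hg u₀ hu₀
      exact h1
  · rw [h] at hg
    have haa' : (a : M) ≤ a' := haa.le
    by_cases hm' : m ≤ a
    · refine ⟨a, a.2, fun u hu => ?_, hm'⟩
      obtain ⟨_, rfl | rfl, -, h1⟩ := hg u hu
      · exact h1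
      · exact haa'.trans h1
    · have hg' : ∀ u ∈ U, m ≤ a' ∧ (a' : M) ≤ u := fun u hu => by
        obtain ⟨_, rfl | rfl, h1⟩ := hg u hu
        · exact absurd h1.1 hm'
        · exact h1
      exact ⟨a', a'.2, fun u hu => (hg' u hu).2, (hg' u₀ hu₀).1⟩

theorem linked (a b : A) : Linked a b := by
  have key : ∀ {m : M}, Linked (a : M) m → ∀ g : A, (g : M) ∈ gates A m → Linked a g := by
    intro m h
    induction h with
    | refl =>
      intro g hg
      rw [hM.gates_of_mem a.2] at hg
      rw [Subtype.ext hg]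
      exact .refl
    | @tail m m' _ h ih =>
      intro g' hg'
      rcases crossing hM hG m m' with h1 | ⟨g, hg, h1⟩
      · exact ih g' (h1.2.2 ▸ hg')
      rcases crossing hM hG m' m with h2 | ⟨k, hk, h2⟩
      · exact ih g' (h2.2.2 ▸ hg')
      rw [hM.path_comm] at h2
      -- Both gates lie on the interval between `m` and `m'`, which is a chain.
      have hgk : g ≤ k ∨ k ≤ g := by
        rcases h with h | h
        · rw [hM.path_of_le h] at h1 h2
          exact hM.chain h1.1 h1.2 h2.1 h2.2
        · rw [hM.path_comm, hM.path_of_le h] at h1 h2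
          exact hM.chain h1.1 h1.2 h2.1 h2.2
      exact ((ih ⟨g, hg.1⟩ hg).tail (c := (⟨k, hk.1⟩ : A)) hgk).tail
        (comparable hG hk hg')
  exact key (hM.linked (a : M) b) b (by rw [hM.gates_of_mem b.2]; rfl)

end Gated

end Gates

/-! ### The suborder `A` is a CFPO with the paths of `M`. -/

section Embedding

variable {M : Type*} [PartialOrder M] {A : Set M}

/-- The embedding of the completion of a suborder which takes a cut to the supremum of its lower
part. -/
def completionEmb (A : Set M) : Completion A ↪o Completion M :=
  OrderEmbedding.ofMapLEIff
    (fun z => ⟨⟨lowerBounds (upperBounds (Subtype.val '' z.1.left)),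
      upperBounds (Subtype.val '' z.1.left), upperPolar_lowerPolar_upperPolar _ _, rfl⟩,
      (z.2.1.image _).mono (subset_lowerBounds_upperBounds _), by
        obtain ⟨b, hb⟩ := z.2.2
        refine ⟨b, ?_⟩
        rintro _ ⟨a, ha, rfl⟩
        exact (Concept.rel_extent_intent (c := z.1) ha hb : a ≤ b)⟩) fun z z' => by
    constructor
    · intro h a ha
      have h1 : (a : M) ∈ lowerBounds (upperBounds (Subtype.val '' z'.1.left)) :=
        h (subset_lowerBounds_upperBounds _ ⟨a, ha, rfl⟩)
      change a ∈ z'.1.left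
      rw [← DedekindCut.lowerBounds_right]
      intro b hb
      refine h1 ?_
      rintro _ ⟨c, hc, rfl⟩
      exact (Concept.rel_extent_intent (c := z'.1) hc hb : c ≤ b)
    · intro h
      exact lowerBounds_mono_set (upperBounds_mono_set (image_mono h))

theorem completionEmb_le_toCompletion {z : Completion A} {m : M} :
    completionEmb A z ≤ toCompletion m ↔ ∀ a : A, toCompletion a ≤ z → (a : M) ≤ m := by
  rw [le_toCompletion_iff]
  change m ∈ upperBounds (Subtype.val '' z.1.left) ↔ _
  simp only [mem_upperBounds, forall_mem_image, toCompletion_le_iff]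

theorem completionEmb_toCompletion (a : A) :
    completionEmb A (toCompletion a) = toCompletion (a : M) := by
  apply le_antisymm
  · exact completionEmb_le_toCompletion.2 fun b hb =>
      (toCompletion_le.1 hb : b ≤ a)
  · exact Completion.le_of_forall_right fun m hm =>
      toCompletion_le.2 (completionEmb_le_toCompletion.1 hm a le_rfl)

theorem toCompletion_le_completionEmb {z : Completion A} {a : A} :
    toCompletion (a : M) ≤ completionEmb A z ↔ toCompletion a ≤ z := by
  rw [← completionEmb_toCompletion, (completionEmb A).le_iff_le]

theorem Linked.toCompletion {a b : M} (h : Linked a b) :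
    Linked (toCompletion a) (toCompletion b) := by
  induction h with
  | refl => exact .refl
  | tail _ h ih => exact ih.tail (h.imp toCompletion_le.2 toCompletion_le.2)

namespace Gated

variable (hM : IsCFPO M) (hG : Gated A)
include hM hG

/-- A bound `m ∈ M` of both images can be replaced by a point of `A` below `m`
(`exists_between_of_upper`), and this point bounds `w`. So `completionEmb` preserves suprema of
bounded pairs. -/
theorem exists_sup {u v z : Completion A} (hu : u ≤ z) (hv : v ≤ z) :
    ∃ w, u ≤ w ∧ v ≤ w ∧ (∀ x, u ≤ x → v ≤ x → w ≤ x) ∧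
      ∀ x, completionEmb A u ≤ x → completionEmb A v ≤ x → completionEmb A w ≤ x := by
  obtain ⟨w, huw, hvw, hw⟩ := Completion.pairComplete.sup hu hv
  refine ⟨w, huw, hvw, hw, fun x hux hvx => Completion.le_of_forall_right fun m hm => ?_⟩
  have h1 := completionEmb_le_toCompletion.1 (hux.trans hm)
  have h2 := completionEmb_le_toCompletion.1 (hvx.trans hm)
  obtain ⟨a₀, ha₀⟩ := u.exists_le
  obtain ⟨a, ha, haU, ham⟩ := exists_between_of_upper hM hG
    (U := Subtype.val '' {a : A | toCompletion a ≤ u ∨ toCompletion a ≤ v})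
    (by rintro _ ⟨a, -, rfl⟩; exact a.2) ⟨a₀, a₀, Or.inl ha₀, rfl⟩ (m := m)
    (by rintro _ ⟨a, ha | ha, rfl⟩; exacts [h1 a ha, h2 a ha])
  have hwa : w ≤ toCompletion (⟨a, ha⟩ : A) := hw _
    (Completion.le_of_forall_left fun b hb => toCompletion_le.2 (haU b ⟨b, Or.inl hb, rfl⟩))
    (Completion.le_of_forall_left fun b hb => toCompletion_le.2 (haU b ⟨b, Or.inr hb, rfl⟩))
  have := (completionEmb A).monotone hwa
  rw [completionEmb_toCompletion] at this
  exact this.trans (toCompletion_le.2 ham)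

theorem exists_inf {u v z : Completion A} (hu : z ≤ u) (hv : z ≤ v) :
    ∃ w, w ≤ u ∧ w ≤ v ∧ (∀ x, x ≤ u → x ≤ v → x ≤ w) ∧
      ∀ x, x ≤ completionEmb A u → x ≤ completionEmb A v → x ≤ completionEmb A w := by
  obtain ⟨w, huw, hvw, hw⟩ := Completion.pairComplete.inf hu hv
  refine ⟨w, huw, hvw, hw, fun x hux hvx => Completion.le_of_forall_left fun m hm => ?_⟩
  have h1 : ∀ {u : Completion A}, x ≤ completionEmb A u → ∀ a : A, u ≤ toCompletion a →
      m ≤ a := fun hux a ha => by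
    have := (hm.trans hux).trans ((completionEmb A).monotone ha)
    rwa [completionEmb_toCompletion, toCompletion_le] at this
  obtain ⟨a₀, ha₀⟩ := u.exists_ge
  obtain ⟨a, ha, haU, ham⟩ := exists_between_of_lower hM hG
    (U := Subtype.val '' {a : A | u ≤ toCompletion a ∨ v ≤ toCompletion a})
    (by rintro _ ⟨a, -, rfl⟩; exact a.2) ⟨a₀, a₀, Or.inl ha₀, rfl⟩ (m := m)
    (by rintro _ ⟨a, ha | ha, rfl⟩; exacts [h1 hux a ha, h1 hvx a ha])
  have hwa : toCompletion (⟨a, ha⟩ : A) ≤ w := hw _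
    (Completion.le_of_forall_right fun b hb => toCompletion_le.2 (haU b ⟨b, Or.inl hb, rfl⟩))
    (Completion.le_of_forall_right fun b hb => toCompletion_le.2 (haU b ⟨b, Or.inr hb, rfl⟩))
  exact (toCompletion_le.2 ham).trans (toCompletion_le_completionEmb.2 hwa)

/-- Points joined in the completion of `A` are joined in `M^D`, where the conditions hold. The bound
`w` found there need not come from `A` and is replaced by the supremum or infimum `w'`. -/
theorem cycleFree : CycleFree (Completion A) where
  linked u v := by
    obtain ⟨a, ha⟩ := u.exists_le
    obtain ⟨b, hb⟩ := v.exists_le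
    exact (Relation.ReflTransGen.head (r := fun u v : Completion A => u ≤ v ∨ v ≤ u)
      (Or.inr ha) (linked hM hG a b).toCompletion).tail (Or.inl hb)
  not_joined {u z v} hu hv hj :=
    hM.cycleFree.not_joined ((completionEmb A).lt_iff_lt.2 hu) ((completionEmb A).lt_iff_lt.2 hv)
      (hj.map _)
  below {u z v} hu hv hj := by
    obtain ⟨w, hwz, huw, hvw⟩ := hM.cycleFree.below ((completionEmb A).lt_iff_lt.2 hu)
      ((completionEmb A).lt_iff_lt.2 hv) (hj.map _)
    obtain ⟨w', h1, h2, -, h3⟩ := exists_sup hM hG hu.le hv.le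
    exact ⟨w', (completionEmb A).lt_iff_lt.1 ((h3 w huw hvw).trans_lt hwz), h1, h2⟩
  above {u z v} hu hv hj := by
    obtain ⟨w, hwz, huw, hvw⟩ := hM.cycleFree.above ((completionEmb A).lt_iff_lt.2 hu)
      ((completionEmb A).lt_iff_lt.2 hv) (hj.map _)
    obtain ⟨w', h1, h2, -, h3⟩ := exists_inf hM hG hu.le hv.le
    exact ⟨w', (completionEmb A).lt_iff_lt.1 (hwz.trans_le (h3 w huw hvw)), h1, h2⟩

theorem isCFPO : IsCFPO A := isCFPO_of_cycleFree (cycleFree hM hG)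

omit hM hG in
/-- The first step on a way from `z` to a different point `x`. -/
theorem exists_neighbour {P : Type*} [PartialOrder P] {x z : P} (h : Linked x z) (hne : x ≠ z) :
    ∃ u, Joined z x u ∧ (u < z ∨ z < u) := by
  by_contra hcon
  push Not at hcon
  have key : ∀ {p}, Linked x p → Joined z x p := by
    intro p hp
    induction hp with
    | refl => exact .refl hne
    | @tail p q _ h ih =>
      have := hcon p ih
      rcases h with h | h
      · exact ih.trans (.of_le h fun h' => this.1 (h'.1.lt_of_ne ih.ne_right))
      · exact ih.trans (.of_ge h fun h' => this.2 (h'.2.lt_of_ne ih.ne_right.symm))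
  exact (key h).ne_right rfl

/-- A sequence in `M^D` may leave the completion of `A`. Moving `x` and `y` to points `u` and `v`
comparable with `z` reduces the claim to two cases. Opposite sides of `z` are never joined around
`z`; on the same side, `M^D` has a common bound that can be moved into the completion of `A`. -/
theorem joined_completionEmb {z x y : Completion A} :
    Joined (completionEmb A z) (completionEmb A x) (completionEmb A y) ↔ Joined z x y := by
  refine ⟨fun h => ?_, fun h => h.map _⟩
  have hQ := cycleFree hM hG
  obtain ⟨u, hxu, hu⟩ := exists_neighbour (hQ.linked x z) fun h' => h.ne_left (congrArg _ h')
  obtain ⟨v, hyv, hv⟩ := exists_neighbour (hQ.linked y z) fun h' => h.ne_right (congrArg _ h')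
  have huv : Joined (completionEmb A z) (completionEmb A u) (completionEmb A v) :=
    (hxu.map _).symm.trans (h.trans (hyv.map _))
  suffices Joined z u v from hxu.trans (this.trans hyv.symm)
  have hlt : ∀ {a b}, a < b → completionEmb A a < completionEmb A b :=
    fun h => (completionEmb A).lt_iff_lt.2 h
  rcases hu with hu | hu <;> rcases hv with hv | hv
  · obtain ⟨w, hwz, huw, hvw⟩ := hM.cycleFree.below (hlt hu) (hlt hv) huv
    obtain ⟨w', h1, h2, -, h3⟩ := exists_sup hM hG hu.le hv.le
    have hw' : w' < z := (completionEmb A).lt_iff_lt.1 ((h3 w huw hvw).trans_lt hwz)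
    exact (Joined.of_le h1 fun h => hw'.not_ge h.2).trans (.of_ge h2 fun h => hw'.not_ge h.2)
  · exact absurd huv (hM.cycleFree.not_joined (hlt hu) (hlt hv))
  · exact absurd huv.symm (hM.cycleFree.not_joined (hlt hv) (hlt hu))
  · obtain ⟨w, hwz, huw, hvw⟩ := hM.cycleFree.above (hlt hu) (hlt hv) huv
    obtain ⟨w', h1, h2, -, h3⟩ := exists_inf hM hG hu.le hv.le
    have hw' : z < w' := (completionEmb A).lt_iff_lt.1 (hwz.trans_le (h3 w huw hvw))
    exact (Joined.of_ge h1 fun h => hw'.not_ge h.1).trans (.of_le h2 fun h => hw'.not_ge h.1)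

theorem mem_path_coe {z x y : A} : z ∈ path x y ↔ (z : M) ∈ path (x : M) y := by
  rw [(isCFPO hM hG).mem_path_iff, hM.mem_path_iff, ← joined_completionEmb hM hG,
    completionEmb_toCompletion, completionEmb_toCompletion, completionEmb_toCompletion]

end Gated

end Embedding

/-! ### Cone transitivity of `A` and transitivity on adjacent pairs. -/

section ConeTransitive

variable {M : Type*} [PartialOrder M] {A : Set M}

theorem IsOneOrbit.map_mem_iff (hA : IsOneOrbit A) (φ : M ≃o M) (a : M) : φ a ∈ A ↔ a ∈ A := by
  obtain ⟨x, rfl⟩ := hA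
  constructor
  · rintro ⟨ψ, hψ⟩
    exact ⟨ψ.trans φ.symm, by simp [hψ]⟩
  · rintro ⟨ψ, rfl⟩
    exact ⟨ψ.trans φ, rfl⟩

/-- The restriction of an automorphism to an invariant set. -/
def restrictIso (φ : M ≃o M) (hφ : ∀ a, φ a ∈ A ↔ a ∈ A) : A ≃o A where
  toEquiv := φ.toEquiv.subtypeEquiv fun a => (hφ a).symm
  map_rel_iff' := φ.le_iff_le

theorem image_upperCone (hA : IsOneOrbit A) (hM : IsCFPO M) (hG : Gated A) {φ : M ≃o M} {a y y' : A}
    (h : φ '' {z | z ∈ A ∧ (a : M) < z ∧ (a : M) ∉ path (y : M) z} =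
      {z | z ∈ A ∧ (a : M) < z ∧ (a : M) ∉ path (y' : M) z}) :
    restrictIso φ (hA.map_mem_iff φ) '' {z | z ∈ univ ∧ a < z ∧ a ∉ path y z} =
      {z | z ∈ univ ∧ a < z ∧ a ∉ path y' z} := by
  apply Subtype.val_injective.image_injective
  have aux : ∀ y : A, Subtype.val '' {z : A | z ∈ univ ∧ a < z ∧ a ∉ path y z} =
      {z | z ∈ A ∧ (a : M) < z ∧ (a : M) ∉ path (y : M) z} := by
    intro y
    ext z
    constructor
    · rintro ⟨z, ⟨-, h1, h2⟩, rfl⟩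
      exact ⟨z.2, h1, fun h => h2 ((Gated.mem_path_coe hM hG).2 h)⟩
    · rintro ⟨h, h1, h2⟩
      exact ⟨⟨z, h⟩, ⟨trivial, h1, fun h => h2 ((Gated.mem_path_coe hM hG).1 h)⟩, rfl⟩
  rw [aux, ← h, ← aux, image_image, image_image]
  rfl

theorem image_lowerCone (hA : IsOneOrbit A) (hM : IsCFPO M) (hG : Gated A) {φ : M ≃o M} {a y y' : A}
    (h : φ '' {z | z ∈ A ∧ z < (a : M) ∧ (a : M) ∉ path (y : M) z} =
      {z | z ∈ A ∧ z < (a : M) ∧ (a : M) ∉ path (y' : M) z}) :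
    restrictIso φ (hA.map_mem_iff φ) '' {z | z ∈ univ ∧ z < a ∧ a ∉ path y z} =
      {z | z ∈ univ ∧ z < a ∧ a ∉ path y' z} := by
  apply Subtype.val_injective.image_injective
  have aux : ∀ y : A, Subtype.val '' {z : A | z ∈ univ ∧ z < a ∧ a ∉ path y z} =
      {z | z ∈ A ∧ z < (a : M) ∧ (a : M) ∉ path (y : M) z} := by
    intro y
    ext z
    constructor
    · rintro ⟨z, ⟨-, h1, h2⟩, rfl⟩
      exact ⟨z.2, h1, fun h => h2 ((Gated.mem_path_coe hM hG).2 h)⟩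
    · rintro ⟨h, h1, h2⟩
      exact ⟨⟨z, h⟩, ⟨trivial, h1, fun h => h2 ((Gated.mem_path_coe hM hG).1 h)⟩, rfl⟩
  rw [aux, ← h, ← aux, image_image, image_image]
  rfl

theorem isConeTransitiveCFPO_coe (hM : IsCFPO M) (hG : Gated A) (hA : IsOneOrbit A)
    (hcone : ActsConeTransitivelyOn A) : IsConeTransitiveCFPO A := by
  refine ⟨Gated.isCFPO hM hG, ?_, ?_, ?_⟩
  · intro x _ y _
    obtain ⟨φ, hφ⟩ := hcone.1 x x.2 y y.2
    exact ⟨restrictIso φ (hA.map_mem_iff φ), Subtype.ext hφ⟩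
  · rintro a - K ⟨y, -, hay, rfl⟩ K' ⟨y', -, hay', rfl⟩
    obtain ⟨φ, hφ, h⟩ := hcone.2.1 a a.2 _ ⟨y, y.2, hay, rfl⟩ _ ⟨y', y'.2, hay', rfl⟩
    exact ⟨restrictIso φ (hA.map_mem_iff φ), Subtype.ext hφ, image_upperCone hA hM hG h⟩
  · rintro a - K ⟨y, -, hay, rfl⟩ K' ⟨y', -, hay', rfl⟩
    obtain ⟨φ, hφ, h⟩ := hcone.2.2 a a.2 _ ⟨y, y.2, hay, rfl⟩ _ ⟨y', y'.2, hay', rfl⟩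
    exact ⟨restrictIso φ (hA.map_mem_iff φ), Subtype.ext hφ, image_lowerCone hA hM hG h⟩

/-- If some point has a pair of gates, then the automorphism group is transitive on the adjacent
pairs of `A`. -/
theorem exists_map_adjPair (hM : IsCFPO M) (hG : Gated A) (hA : IsOneOrbit A)
    (hcone : ActsConeTransitivelyOn A) (e₀ e : AdjPair A) {f : M}
    (hf : gates A f = {(e₀.1.1 : M), (e₀.1.2 : M)}) :
    ∃ φ : M ≃o M, φ e₀.1.1 = e.1.1 ∧ φ e₀.1.2 = e.1.2 := by
  obtain ⟨⟨a₀, b₀⟩, h₀⟩ := e₀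
  obtain ⟨⟨a, b⟩, h⟩ := e
  simp only at *
  -- Transitivity moves `a` to `a₀`, and cone transitivity at `a₀` then moves the cone of the image
  -- of `b` onto the cone of `b₀`. This only puts the final image `c` of `b` into the cone of `b₀`;
  -- the non-empty block at `e₀` forces `c = b₀`.
  obtain ⟨φ, hφ⟩ := hcone.1 a a.2 a₀ a₀.2
  have hφb : φ b ∈ A := (hA.map_mem_iff φ b).2 b.2
  have hlt : (a₀ : M) < φ b := hφ ▸ φ.lt_iff_lt.2 h.lt
  obtain ⟨ψ, hψ, hK⟩ := hcone.2.1 a₀ a₀.2 _ ⟨φ b, hφb, hlt, rfl⟩ _ ⟨b₀, b₀.2, h₀.lt, rfl⟩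
  have hmem : ψ (φ b) ∈ ψ '' {z | z ∈ A ∧ (a₀ : M) < z ∧ (a₀ : M) ∉ path (φ b) z} := by
    refine ⟨_, ⟨hφb, hlt, ?_⟩, rfl⟩
    rw [hM.path_self]
    exact hlt.ne
  rw [hK] at hmem
  obtain ⟨hcA, hac, hc⟩ := hmem
  set c := ψ (φ b) with hcdef
  have hb₀g : (b₀ : M) ∈ gates A f := by rw [hf]; exact Or.inr rfl
  have ha₀g : (a₀ : M) ∈ gates A f := by rw [hf]; exact Or.inl rfl
  -- The path from `f` to `c` passes a gate. If this is `a₀`, then `a₀` lies either between `f` and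
  -- the gate `b₀`, or between `b₀` and `c`, which share a cone; both are impossible. If it is `b₀`,
  -- then `b₀ ≤ c`, and `b₀ < c` would yield a point of `A` strictly between `a` and `b`.
  have hbc : (b₀ : M) = c := by
    obtain ⟨g, hg, hgc⟩ := hG.exists_gate f c hcA
    rw [hf] at hg
    rcases hg with rfl | rfl
    · rcases hM.mem_path_or hgc b₀ with h1 | h1
      · exact absurd (Subtype.ext (hb₀g.2 _ a₀.2 h1)) h₀.lt.ne
      · exact absurd h1 hc
    · rcases hM.mem_path_or hgc a₀ with h1 | h1
      · exact absurd (Subtype.ext (ha₀g.2 _ b₀.2 h1)) h₀.lt.ne'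
      · rw [hM.path_of_le hac.le] at h1
        refine h1.2.eq_of_not_lt fun h2 => ?_
        have ha : (φ.trans ψ).symm a₀ = a := (OrderIso.symm_apply_eq _).2 (by simp [hφ, hψ])
        have hb1 : (a : M) < (φ.trans ψ).symm b₀ := by
          rw [← ha]; exact (OrderIso.lt_iff_lt _).2 h₀.lt
        have hb2 : (φ.trans ψ).symm b₀ < b := by
          exact (φ.trans ψ).lt_iff_lt.1 (by simpa using h2)
        exact h.2 (c := ⟨(φ.trans ψ).symm b₀, (hA.map_mem_iff _ _).2 b₀.2⟩) hb1 hb2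
  refine ⟨(φ.trans ψ).symm, (OrderIso.symm_apply_eq _).2 (by simp [hφ, hψ]),
    (OrderIso.symm_apply_eq _).2 (by simpa using hbc)⟩

end ConeTransitive

end CFPO

namespace CFPO

open Set

/-! ### Wreath products over points and adjacent pairs. -/

section Wreath

/-- The action of an automorphism on adjacent pairs. -/
def AdjPair.map {X : Type*} [PartialOrder X] (φ : X ≃o X) (e : AdjPair X) : AdjPair X :=
  ⟨(φ e.1.1, φ e.1.2), (apply_covBy_apply_iff φ).2 e.2⟩

/-- The wreath product of `Aut X` with a group `G` indexed by the points and a group `H` indexed by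
the adjacent pairs of `X`. -/
@[ext]
structure Wreath (X G H : Type*) [PartialOrder X] where
  base : X ≃o X
  pt : X → G
  adj : AdjPair X → H

namespace Wreath

variable {X G H G' H' : Type*} [PartialOrder X] [Group G] [Group H] [Group G'] [Group H']

instance : Mul (Wreath X G H) where
  mul w w' := ⟨w.base * w'.base, fun x => w.pt (w'.base x) * w'.pt x,
    fun e => w.adj (e.map w'.base) * w'.adj e⟩

instance : One (Wreath X G H) where
  one := ⟨1, fun _ => 1, fun _ => 1⟩

instance : Inv (Wreath X G H) where
  inv w := ⟨w.base⁻¹, fun x => (w.pt (w.base⁻¹ x))⁻¹, fun e => (w.adj (e.map w.base⁻¹))⁻¹⟩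

theorem mul_def (w w' : Wreath X G H) : w * w' = ⟨w.base * w'.base,
    fun x => w.pt (w'.base x) * w'.pt x, fun e => w.adj (e.map w'.base) * w'.adj e⟩ := rfl

theorem one_def : (1 : Wreath X G H) = ⟨1, fun _ => 1, fun _ => 1⟩ := rfl

theorem inv_def (w : Wreath X G H) : w⁻¹ = ⟨w.base⁻¹, fun x => (w.pt (w.base⁻¹ x))⁻¹,
    fun e => (w.adj (e.map w.base⁻¹))⁻¹⟩ := rfl

theorem map_one (e : AdjPair X) : e.map 1 = e := rfl

theorem map_mul (φ ψ : X ≃o X) (e : AdjPair X) : e.map (φ * ψ) = (e.map ψ).map φ := rfl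

instance : Group (Wreath X G H) :=
  Group.ofLeftAxioms
    (fun a b c => by
      simp only [mul_def, mul_assoc, map_mul, RelIso.mul_apply])
    (fun a => by simp [mul_def, one_def])
    (fun a => by
      simp only [mul_def, inv_def, one_def, inv_mul_cancel]
      congr 1
      · funext x
        rw [← RelIso.mul_apply, inv_mul_cancel, RelIso.one_apply, inv_mul_cancel]
      · funext e
        rw [← map_mul, inv_mul_cancel, map_one, inv_mul_cancel])

/-- Wreath products over isomorphic groups are isomorphic. -/
def congr (α : G ≃* G') (β : H ≃* H') : Wreath X G H ≃* Wreath X G' H' where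
  toFun w := ⟨w.base, fun x => α (w.pt x), fun e => β (w.adj e)⟩
  invFun w := ⟨w.base, fun x => α.symm (w.pt x), fun e => β.symm (w.adj e)⟩
  left_inv w := by simp
  right_inv w := by simp
  map_mul' w w' := by simp [mul_def]

end Wreath

end Wreath

/-! ### `Aut(M)` as a wreath product. -/

section Charts

variable {M : Type*} [PartialOrder M] {A : Set M}

/-- The automorphisms that move only points of `Z`. -/
def supportedIn (Z : Set M) : Subgroup (M ≃o M) where
  carrier := {g | ∀ m ∉ Z, g m = m}
  mul_mem' {g h} hg hh m hm := by rw [RelIso.mul_apply, hh m hm, hg m hm]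
  one_mem' _ _ := rfl
  inv_mem' {g} hg m hm := by
    exact (OrderIso.symm_apply_eq g).2 (hg m hm).symm

theorem supportedIn_mapsTo {Z : Set M} {g : M ≃o M} (hg : g ∈ supportedIn Z) {m : M}
    (hm : m ∈ Z) : g m ∈ Z := by
  by_contra h
  rw [g.injective (hg _ h)] at h
  exact h hm

/-- The points outside `A` with a given set of gates. -/
def block (A S : Set M) : Set M := {m | m ∉ A ∧ gates A m = S}

theorem IsCFPO.gates_map_eq (hM : IsCFPO M) {φ : M ≃o M} (hφ : ∀ a, φ a ∈ A ↔ a ∈ A) (m : M) :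
    gates A (φ m) = φ '' gates A m := by
  ext g
  obtain ⟨g, rfl⟩ := φ.surjective g
  rw [hM.gates_map hφ, φ.injective.mem_set_image]

theorem IsCFPO.map_mem_block_iff (hM : IsCFPO M) {φ : M ≃o M} (hφ : ∀ a, φ a ∈ A ↔ a ∈ A)
    {S : Set M} {m : M} : φ m ∈ block A (φ '' S) ↔ m ∈ block A S := by
  refine and_congr (not_congr (hφ m)) ?_
  rw [hM.gates_map_eq hφ, φ.injective.image_injective.eq_iff]

open Classical in
/-- An automorphism that fixes the gates of a block can be replaced by the identity outside that
block. -/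
theorem Gated.exists_supportedIn (hM : IsCFPO M) (hG : Gated A) {S : Set M} {φ : M ≃o M}
    (hφ : ∀ a, φ a ∈ A ↔ a ∈ A) (hS : ∀ g ∈ S, φ g = g) :
    ∃ ψ ∈ supportedIn (block A S), ∀ m ∈ block A S, ψ m = φ m := by
  have maps : ∀ {φ : M ≃o M}, (∀ a, φ a ∈ A ↔ a ∈ A) → (∀ g ∈ S, φ g = g) →
      ∀ m ∈ block A S, φ m ∈ block A S := by
    intro φ hφ hS m hm
    have : φ '' S = S := by rw [image_congr hS, image_id']
    rw [← this]
    exact (hM.map_mem_block_iff hφ).2 hm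
  have mono : ∀ {φ : M ≃o M}, (∀ a, φ a ∈ A ↔ a ∈ A) → (∀ g ∈ S, φ g = g) →
      Monotone fun m => if m ∈ block A S then φ m else m := by
    intro φ hφ hS x y hxy
    by_cases hx : x ∈ block A S <;> by_cases hy : y ∈ block A S <;> simp only [hx, hy, if_true,
      if_false]
    · exact φ.monotone hxy
    -- A comparability that leaves the block passes through one of its gates, and these are fixed.
    · rcases Gated.crossing_left hM hG hxy with h | ⟨g, hg, h1, h2⟩
      · exact absurd ⟨h.2.1, h.2.2.symm.trans hx.2⟩ hy
      · have := φ.monotone h1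
        rw [hS g (hx.2 ▸ hg)] at this
        exact this.trans h2
    · rcases Gated.crossing_right hM hG hxy with h | ⟨g, hg, h1, h2⟩
      · exact absurd ⟨h.1, h.2.2.trans hy.2⟩ hx
      · have := φ.monotone h2
        rw [hS g (hy.2 ▸ hg)] at this
        exact h1.trans this
    · exact hxy
  have hφ' : ∀ a, φ.symm a ∈ A ↔ a ∈ A := fun a => by rw [← hφ, φ.apply_symm_apply]
  have hS' : ∀ g ∈ S, φ.symm g = g := fun g hg => by rw [φ.symm_apply_eq, hS g hg]
  let ψ : M ≃o M := Equiv.toOrderIso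
    { toFun := fun m => if m ∈ block A S then φ m else m
      invFun := fun m => if m ∈ block A S then φ.symm m else m
      left_inv := fun m => by
        by_cases hm : m ∈ block A S
        · simp [hm, maps hφ hS m hm]
        · simp [hm]
      right_inv := fun m => by
        by_cases hm : m ∈ block A S
        · simp [hm, maps hφ' hS' m hm]
        · simp [hm] } (mono hφ hS) (mono hφ' hS')
  exact ⟨ψ, fun m hm => if_neg hm, fun m hm => if_pos hm⟩

/-- Blocks are indexed by the points and the adjacent pairs of `A`. -/
abbrev BlockIndex (A : Set M) : Type _ := A ⊕ AdjPair A

namespace BlockIndex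

/-- The gates of a block. -/
def gateSet : BlockIndex A → Set M
  | .inl x => {(x : M)}
  | .inr e => {(e.1.1 : M), (e.1.2 : M)}

/-- The action of an automorphism on the index set. -/
def map (φ : A ≃o A) : BlockIndex A → BlockIndex A
  | .inl x => .inl (φ x)
  | .inr e => .inr (e.map φ)

/-- A choice of a set for all points and a set for all pairs. -/
def pick {α : Type*} (D F : α) : BlockIndex A → α
  | .inl _ => D
  | .inr _ => F

theorem pick_map {α : Type*} (D F : α) (φ : A ≃o A) (i : BlockIndex A) :
    pick D F (i.map φ) = pick D F i := by cases i <;> rfl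

theorem gateSet_injective : Function.Injective (gateSet : BlockIndex A → Set M) := by
  rintro (x | ⟨⟨a, b⟩, h⟩) (y | ⟨⟨c, d⟩, h'⟩) hxy <;> simp only [gateSet] at hxy
  · rw [Subtype.ext (singleton_injective hxy)]
  · have h1 : (c : M) ∈ ({(x : M)} : Set M) := hxy ▸ Or.inl rfl
    have h2 : (d : M) ∈ ({(x : M)} : Set M) := hxy ▸ Or.inr rfl
    exact absurd (Subtype.ext (h1.trans h2.symm)) h'.lt.ne
  · have h1 : (a : M) ∈ ({(y : M)} : Set M) := hxy ▸ Or.inl rfl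
    have h2 : (b : M) ∈ ({(y : M)} : Set M) := hxy ▸ Or.inr rfl
    exact absurd (Subtype.ext (h1.trans h2.symm)) h.lt.ne
  · have h1 : (a : M) ∈ ({(c : M), (d : M)} : Set M) := hxy ▸ Or.inl rfl
    have h2 : (b : M) ∈ ({(c : M), (d : M)} : Set M) := hxy ▸ Or.inr rfl
    have hab : (a : M) < b := h.lt
    have hcd : (c : M) < d := h'.lt
    rcases h1 with h1 | h1 <;> rcases h2 with h2 | h2
    · exact absurd (h1.trans h2.symm) hab.ne
    · obtain rfl := Subtype.ext h1
      obtain rfl := Subtype.ext h2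
      rfl
    · rw [h1, h2] at hab
      exact absurd hab hcd.not_gt
    · exact absurd (h1.trans h2.symm) hab.ne

end BlockIndex

/-- Automorphisms that identify all the blocks at points with a fixed set `D`, and all the blocks at
adjacent pairs with a fixed set `F`. -/
structure Charts (A D F : Set M) where
  chart : BlockIndex A → (M ≃o M)
  mem_iff : ∀ i m, chart i m ∈ block A i.gateSet ↔ m ∈ i.pick D F
  compat : ∀ (φ : A ≃o A) (i : BlockIndex A), (i.pick D F).Nonempty → ∀ a : A,
    (a : M) ∈ i.gateSet → chart (i.map φ) ((chart i).symm a) = φ a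

namespace Charts

variable {D F : Set M} (c : Charts A D F)

/-- The components of an element of the wreath product, as automorphisms. -/
def comp (w : Wreath A (supportedIn D) (supportedIn F)) : BlockIndex A → (M ≃o M)
  | .inl x => w.pt x
  | .inr e => w.adj e

theorem comp_mem (w : Wreath A (supportedIn D) (supportedIn F)) (i : BlockIndex A) :
    comp w i ∈ supportedIn (i.pick D F) := by
  rcases i with x | e
  · exact (w.pt x).2
  · exact (w.adj e).2

theorem comp_mul (w w' : Wreath A (supportedIn D) (supportedIn F)) (i : BlockIndex A) :
    comp (w * w') i = comp w (i.map w'.base) * comp w' i := by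
  rcases i with x | e <;> rfl

/-- The automorphism that describes an element of the wreath product on a block. -/
def loc (w : Wreath A (supportedIn D) (supportedIn F)) (i : BlockIndex A) : M ≃o M :=
  c.chart (i.map w.base) * comp w i * (c.chart i)⁻¹

theorem loc_apply (w : Wreath A (supportedIn D) (supportedIn F)) (i : BlockIndex A) (m : M) :
    c.loc w i m = c.chart (i.map w.base) (comp w i ((c.chart i).symm m)) := rfl

theorem map_base_mul (w w' : Wreath A (supportedIn D) (supportedIn F)) (i : BlockIndex A) :
    i.map (w * w').base = (i.map w'.base).map w.base := by
  rcases i with x | e <;> rfl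

theorem loc_mul (w w' : Wreath A (supportedIn D) (supportedIn F)) (i : BlockIndex A) (m : M) :
    c.loc (w * w') i m = c.loc w (i.map w'.base) (c.loc w' i m) := by
  simp only [loc_apply, comp_mul, map_base_mul, RelIso.mul_apply, OrderIso.symm_apply_apply]

theorem loc_mem (w : Wreath A (supportedIn D) (supportedIn F)) {i : BlockIndex A} {m : M}
    (hm : m ∈ block A i.gateSet) : c.loc w i m ∈ block A (i.map w.base).gateSet := by
  rw [loc_apply, c.mem_iff, BlockIndex.pick_map]
  refine supportedIn_mapsTo (comp_mem w i) ?_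
  rw [← c.mem_iff, OrderIso.apply_symm_apply]
  exact hm

/-- The component fixes the point of the model that corresponds to a gate, so only the charts act
there, and `compat` computes their effect. This is what glues the local maps along `A`. -/
theorem loc_gate (w : Wreath A (supportedIn D) (supportedIn F)) {i : BlockIndex A}
    (hi : (block A i.gateSet).Nonempty) {a : A} (ha : (a : M) ∈ i.gateSet) :
    c.loc w i a = w.base a := by
  rw [loc_apply, comp_mem w i, c.compat w.base i _ a ha]
  · obtain ⟨m, hm⟩ := hi
    exact ⟨(c.chart i).symm m, by rw [← c.mem_iff, OrderIso.apply_symm_apply]; exact hm⟩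
  · rw [← c.mem_iff, OrderIso.apply_symm_apply]
    exact fun h => h.1 a.2

end Charts

theorem Gated.exists_index (hG : Gated A) (m : M) :
    ∃ i : BlockIndex A, gates A m = i.gateSet := by
  rcases hG.gates_cases m with ⟨a, h⟩ | ⟨a, a', haa, h⟩
  · exact ⟨.inl a, h⟩
  · exact ⟨.inr ⟨(a, a'), haa⟩, h⟩

/-- The index of the block of a point. -/
noncomputable def Gated.index (hG : Gated A) (m : M) : BlockIndex A := (hG.exists_index m).choose

theorem Gated.gateSet_index (hG : Gated A) (m : M) : (hG.index m).gateSet = gates A m :=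
  (hG.exists_index m).choose_spec.symm

theorem Gated.mem_block_index (hG : Gated A) {m : M} (hm : m ∉ A) :
    m ∈ block A (hG.index m).gateSet := ⟨hm, (hG.gateSet_index m).symm⟩

theorem Gated.index_eq (hG : Gated A) {m : M} {i : BlockIndex A} (h : m ∈ block A i.gateSet) :
    hG.index m = i :=
  BlockIndex.gateSet_injective ((hG.gateSet_index m).trans h.2)

namespace Charts

variable {D F : Set M} (c : Charts A D F) (hM : IsCFPO M) (hG : Gated A)

open Classical in
/-- The action of the wreath product on the points. -/
noncomputable def act (w : Wreath A (supportedIn D) (supportedIn F)) (m : M) : M :=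
  if h : m ∈ A then w.base ⟨m, h⟩ else c.loc w (hG.index m) m

theorem act_coe (w : Wreath A (supportedIn D) (supportedIn F)) (a : A) :
    c.act hG w a = w.base a := dif_pos a.2

theorem act_of_mem_block (w : Wreath A (supportedIn D) (supportedIn F)) {m : M} {i : BlockIndex A}
    (h : m ∈ block A i.gateSet) : c.act hG w m = c.loc w i m := by
  rw [act, dif_neg h.1, hG.index_eq h]

theorem act_mul (w w' : Wreath A (supportedIn D) (supportedIn F)) (m : M) :
    c.act hG (w * w') m = c.act hG w (c.act hG w' m) := by
  by_cases h : m ∈ A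
  · lift m to A using h
    rw [act_coe, act_coe, act_coe]
    rfl
  · have hm := hG.mem_block_index h
    rw [c.act_of_mem_block hG _ hm, c.act_of_mem_block hG _ hm,
      c.act_of_mem_block hG _ (c.loc_mem w' hm), loc_mul]

theorem act_one (m : M) : c.act hG 1 m = m := by
  by_cases h : m ∈ A
  · lift m to A using h
    exact c.act_coe hG 1 m
  · have hm := hG.mem_block_index h
    rw [c.act_of_mem_block hG _ hm, loc_apply]
    generalize hG.index m = i
    rcases i with x | e
    · exact (c.chart _).apply_symm_apply m
    · exact (c.chart _).apply_symm_apply m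

include hM in
theorem act_gate (w : Wreath A (supportedIn D) (supportedIn F)) {m g : M} (hg : g ∈ gates A m) :
    (m ≤ g → c.act hG w m ≤ c.act hG w g) ∧ (g ≤ m → c.act hG w g ≤ c.act hG w m) := by
  by_cases h : m ∈ A
  · rw [hM.gates_of_mem h] at hg
    rw [mem_singleton_iff.1 hg]
    exact ⟨fun _ => le_rfl, fun _ => le_rfl⟩
  · have hm := hG.mem_block_index h
    have hgA := gates_subset m hg
    have : c.act hG w g = c.loc w (hG.index m) g := by
      lift g to A using hgA
      rw [act_coe, c.loc_gate w ⟨m, hm⟩]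
      rwa [hG.gateSet_index]
    rw [c.act_of_mem_block hG w hm, this]
    exact ⟨fun h => (c.loc w _).monotone h, fun h => (c.loc w _).monotone h⟩

-- Within a block a single automorphism of `M` acts. A comparability between a block and anything
-- else factors through a gate, where the local map agrees with `w.base`.
include hM in
theorem act_monotone (w : Wreath A (supportedIn D) (supportedIn F)) : Monotone (c.act hG w) := by
  have key : ∀ {g y : M}, g ∈ A → g ≤ y → c.act hG w g ≤ c.act hG w y := by
    intro g y hg hgy
    rcases Gated.crossing_right hM hG hgy with h | ⟨k, hk, h1, h2⟩
    · exact absurd hg h.1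
    · refine le_trans ?_ ((c.act_gate hM hG w hk).2 h2)
      have hkA := gates_subset y hk
      lift g to A using hg
      lift k to A using hkA
      rw [act_coe, act_coe]
      exact w.base.monotone h1
  intro x y hxy
  rcases Gated.crossing_left hM hG hxy with h | ⟨g, hg, h1, h2⟩
  · have hx := hG.mem_block_index h.1
    have hy : y ∈ block A (hG.index x).gateSet := ⟨h.2.1, h.2.2.symm.trans hx.2⟩
    rw [c.act_of_mem_block hG w hx, c.act_of_mem_block hG w hy]
    exact (c.loc w _).monotone hxy
  · exact ((c.act_gate hM hG w hg).1 h1).trans (key (gates_subset x hg) h2)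

/-- The wreath product acts by automorphisms. -/
noncomputable def toAut : Wreath A (supportedIn D) (supportedIn F) →* (M ≃o M) where
  toFun w := Equiv.toOrderIso
    { toFun := c.act hG w
      invFun := c.act hG w⁻¹
      left_inv := fun m => by rw [← act_mul, inv_mul_cancel, act_one]
      right_inv := fun m => by rw [← act_mul, mul_inv_cancel, act_one] }
    (c.act_monotone hM hG w) (c.act_monotone hM hG w⁻¹)
  map_one' := by
    ext m
    exact c.act_one hG m
  map_mul' w w' := by
    ext m
    exact c.act_mul hG w w' m

theorem toAut_apply (w : Wreath A (supportedIn D) (supportedIn F)) (m : M) :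
    c.toAut hM hG w m = c.act hG w m := rfl

theorem toAut_injective : Function.Injective (c.toAut hM hG) := by
  intro w w' h
  have h' : ∀ m, c.act hG w m = c.act hG w' m := fun m => DFunLike.congr_fun h m
  have hb : w.base = w'.base := by
    ext a
    rw [← c.act_coe hG, h', c.act_coe hG]
  have ht : ∀ i, comp w i = comp w' i := by
    intro i
    ext m
    by_cases hm : m ∈ i.pick D F
    · have hm' := (c.mem_iff i m).2 hm
      have := h' (c.chart i m)
      rw [c.act_of_mem_block hG w hm', c.act_of_mem_block hG w' hm', loc_apply, loc_apply,
        OrderIso.symm_apply_apply, hb] at this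
      exact (c.chart _).injective this
    · rw [comp_mem w i m hm, comp_mem w' i m hm]
  ext1
  · exact hb
  · funext x
    exact Subtype.ext (ht (.inl x))
  · funext e
    exact Subtype.ext (ht (.inr e))

theorem toAut_surjective (hA : IsOneOrbit A) : Function.Surjective (c.toAut hM hG) := by
  intro f
  let φ := restrictIso f (hA.map_mem_iff f)
  have ht : ∀ i : BlockIndex A, ∃ ψ ∈ supportedIn (i.pick D F), ∀ m ∈ i.pick D F,
      c.chart (i.map φ) (ψ m) = f (c.chart i m) := by
    intro i
    by_cases hi : (i.pick D F).Nonempty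
    · have hblock : i.pick D F = block A ((c.chart i).symm '' i.gateSet) := by
        ext m
        rw [← c.mem_iff, ← hM.map_mem_block_iff (hA.map_mem_iff (c.chart i)) (m := m), image_image]
        simp
      -- Read in the charts, `f` fixes the gates of the model block by `compat`, so it can be cut
      -- down to an automorphism supported in that block.
      obtain ⟨ψ, hψ, h⟩ := Gated.exists_supportedIn hM hG (S := (c.chart i).symm '' i.gateSet)
        (φ := (c.chart (i.map φ))⁻¹ * f * c.chart i) (hA.map_mem_iff _) (by
          rintro _ ⟨a, ha, rfl⟩
          have haA : a ∈ A := by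
            rcases i with x | e
            · rw [mem_singleton_iff.1 ha]
              exact x.2
            · rcases ha with rfl | rfl
              exacts [e.1.1.2, e.1.2.2]
          have := c.compat φ i hi ⟨a, haA⟩ ha
          simp only [RelIso.mul_apply, OrderIso.apply_symm_apply]
          exact (OrderIso.symm_apply_eq _).2 this.symm)
      rw [← hblock] at hψ h
      refine ⟨ψ, hψ, fun m hm => ?_⟩
      rw [h m hm]
      exact (c.chart (i.map φ)).apply_symm_apply _
    · exact ⟨1, one_mem _, fun m hm => absurd ⟨m, hm⟩ hi⟩
  choose ψ hψ h using ht
  refine ⟨⟨φ, fun x => ⟨ψ (.inl x), hψ (.inl x)⟩, fun e => ⟨ψ (.inr e), hψ (.inr e)⟩⟩, ?_⟩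
  ext m
  rw [toAut_apply]
  by_cases hm : m ∈ A
  · lift m to A using hm
    rw [act_coe]
    rfl
  · have hm' := hG.mem_block_index hm
    rw [c.act_of_mem_block hG _ hm', loc_apply]
    generalize hG.index m = i at hm'
    have h1 : (c.chart i).symm m ∈ i.pick D F := by
      rw [← c.mem_iff, OrderIso.apply_symm_apply]
      exact hm'
    have h2 := h i _ h1
    rw [OrderIso.apply_symm_apply] at h2
    rw [← h2]
    rcases i with x | e <;> rfl

/-- The automorphism group is a wreath product. -/
noncomputable def autEquiv (hA : IsOneOrbit A) :
    Wreath A (supportedIn D) (supportedIn F) ≃* (M ≃o M) :=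
  MulEquiv.ofBijective (c.toAut hM hG) ⟨c.toAut_injective hM hG, c.toAut_surjective hM hG hA⟩

end Charts

/-- The model blocks are one block at a point and, if there is one, a non-empty block at an adjacent
pair. Charts are automorphisms of `M` carrying the model gates, in order, to the gates of the other
blocks. -/
theorem exists_charts (hM : IsCFPO M) (hG : Gated A) (hA : IsOneOrbit A)
    (hcone : ActsConeTransitivelyOn A) (a₀ : A) :
    ∃ D F : Set M, Disjoint D A ∧ Disjoint F A ∧ Nonempty (Charts A D F) := by
  choose g hg using fun x : A => hcone.1 a₀ a₀.2 x x.2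
  have hD : ∀ (x : A) (m : M), g x m ∈ block A {(x : M)} ↔ m ∈ block A {(a₀ : M)} := by
    intro x m
    rw [← hM.map_mem_block_iff (hA.map_mem_iff (g x)) (S := {(a₀ : M)}), image_singleton, hg]
  have hg' : ∀ x : A, (g x).symm x = a₀ := fun x => by rw [OrderIso.symm_apply_eq, hg]
  have hdisj : ∀ S, Disjoint (block A S) A := fun S =>
    disjoint_left.2 fun m hm => hm.1
  by_cases hF : ∃ (e₀ : AdjPair A) (f : M), f ∈ block A {(e₀.1.1 : M), (e₀.1.2 : M)}
  · obtain ⟨e₀, f, hf⟩ := hF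
    choose k hk using fun e : AdjPair A => exists_map_adjPair hM hG hA hcone e₀ e hf.2
    have hk1 : ∀ e : AdjPair A, (k e).symm e.1.1 = e₀.1.1 := fun e => by
      rw [OrderIso.symm_apply_eq, (hk e).1]
    have hk2 : ∀ e : AdjPair A, (k e).symm e.1.2 = e₀.1.2 := fun e => by
      rw [OrderIso.symm_apply_eq, (hk e).2]
    refine ⟨block A {(a₀ : M)}, block A {(e₀.1.1 : M), (e₀.1.2 : M)}, hdisj _, hdisj _,
      ⟨⟨Sum.elim g k, ?_, ?_⟩⟩⟩
    · rintro (x | e) m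
      · exact hD x m
      · have := hM.map_mem_block_iff (hA.map_mem_iff (k e)) (S := {(e₀.1.1 : M), (e₀.1.2 : M)})
          (m := m)
        rw [image_pair, (hk e).1, (hk e).2] at this
        exact this
    · rintro φ (x | e) - a ha
      · obtain rfl := Subtype.ext ha
        simp only [BlockIndex.map, Sum.elim_inl, hg', hg]
      · rcases ha with ha | ha
        · obtain rfl := Subtype.ext ha
          simp only [BlockIndex.map, Sum.elim_inr, hk1, (hk _).1, AdjPair.map]
        · obtain rfl := Subtype.ext ha
          simp only [BlockIndex.map, Sum.elim_inr, hk2, (hk _).2, AdjPair.map]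
  -- All blocks at adjacent pairs are empty here, so the empty set is a model for them and the
  -- identity is a chart.
  · refine ⟨block A {(a₀ : M)}, ∅, hdisj _, disjoint_bot_left,
      ⟨⟨Sum.elim g fun _ => 1, ?_, ?_⟩⟩⟩
    · rintro (x | e) m
      · exact hD x m
      · exact ⟨fun h => (hF ⟨e, _, h⟩).elim, fun h => h.elim⟩
    · rintro φ (x | e) hne a ha
      · obtain rfl := Subtype.ext ha
        simp only [BlockIndex.map, Sum.elim_inl, hg', hg]
      · exact absurd hne Set.not_nonempty_empty

end Charts

end CFPO

namespace CFPO

open Set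

/-! ### Recovering a cycle-free order from the paths from a root. -/

section RootedTree

variable {P : Type*} [PartialOrder P]

/-- `z` is approached from below on the path from `r`. -/
def upFrom (r z : P) : Prop := ∃ w, w < z ∧ ¬Joined w r z

/-- `z` is approached from above on the path from `r`. -/
def dnFrom (r z : P) : Prop := ∃ w, z < w ∧ ¬Joined w r z

namespace CycleFree

variable (hP : CycleFree P)
include hP

theorem not_joined_mid {r x y z : P} (hxz : ¬Joined x r z) (hzy : ¬Joined z r y) :
    ¬Joined z x y := by
  intro h
  have : Joined z r x := by
    by_contra hcon
    exact h.ne_left (hP.eq_of_not_joined hxz hcon)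
  exact hzy (this.trans h)

theorem not_joined_insert {r x y c : P} (hxy : ¬Joined x r y) (hc : ¬Joined c x y) :
    ¬Joined c r y ∧ ¬Joined x r c := by
  constructor
  · intro h
    exact (h.split x).elim hxy fun h' => hc (h'.symm.trans h)
  · intro h
    exact h.ne_right (hP.eq_of_not_joined (m := y) (fun h' => hxy (h.trans h'.symm))
      fun h' => hc h'.symm).symm

/-- One of `x` and `x'` can be reached from `y` around the other. If it could also be reached from
`r` around the other, then so could `y`. Hence the points on the path to `y` are linearly ordered.
-/
theorem not_joined_or {r x x' y : P} (h : ¬Joined x r y) (h' : ¬Joined x' r y) :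
    ¬Joined x r x' ∨ ¬Joined x' r x := by
  by_contra hcon
  push Not at hcon
  rcases joined_or_joined hcon.1.ne_right.symm (hP.linked y x) with h1 | h1
  · exact h (hcon.1.trans h1.symm)
  · exact h' (hcon.2.trans h1.symm)

theorem upFrom_of_le {r x y z : P} (hxy : x ≤ y) (hxz : ¬Joined x r z) (hzy : ¬Joined z r y)
    (hne : z ≠ x) : upFrom r z := by
  have := (hP.not_joined_iff hxy).1 (hP.not_joined_mid hxz hzy)
  exact ⟨x, this.1.lt_of_ne hne.symm, hxz⟩

theorem dnFrom_of_le {r x y z : P} (hxy : y ≤ x) (hxz : ¬Joined x r z) (hzy : ¬Joined z r y)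
    (hne : z ≠ x) : dnFrom r z := by
  have := (hP.not_joined_iff hxy).1 fun h => hP.not_joined_mid hxz hzy h.symm
  exact ⟨x, this.2.lt_of_ne hne, hxz⟩

/-- Two points on the path to `z` are ordered along it. The later one lies in the interval between
the earlier one and `z`, hence on the same side of `z`. -/
theorem not_upFrom_and_dnFrom {r z : P} (h : upFrom r z) (h' : dnFrom r z) : False := by
  obtain ⟨w, hw, hwz⟩ := h
  obtain ⟨w', hw', hwz'⟩ := h'
  rcases hP.not_joined_or hwz hwz' with h | h
  · exact hw'.not_ge ((hP.not_joined_iff hw.le).1 (hP.not_joined_mid h hwz')).2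
  · exact hw.not_ge ((hP.not_joined_iff hw'.le).1
      fun hj => hP.not_joined_mid h hwz hj.symm).1

/-- The alternating path from `x` to `y` must be a single ascent: a final descent makes `y`
approached from above, and a turn before a final ascent is itself approached from above. -/
theorem le_of_upFrom (hl : PairComplete P) {r x y : P} (hxy : ¬Joined x r y)
    (h : ∀ t, ¬Joined t r y → ¬Joined x r t → t ≠ x → upFrom r t) : x ≤ y := by
  by_cases hne : y = x
  · exact hne.ge
  obtain ⟨d, p, hp⟩ := (hP.linked x y).exists_pth hP.chainIntervals hl
  have hsep := hp.not_joined hP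
  cases hp with
  | nil => exact le_rfl
  | @up c _ p h0 hcy _ =>
    have hc := hP.not_joined_insert hxy (hsep c (Or.inl h0.end_mem))
    rcases h0.prev_dn with rfl | ⟨e, he, hce, -⟩
    · exact hcy.le
    have hec := h0.not_joined hP e he
    refine (hP.not_upFrom_and_dnFrom (h c hc.1 hc.2 ?_)
      ⟨e, hce, (hP.not_joined_insert hc.2 hec).1⟩).elim
    rintro rfl
    exact hec (.refl hce.ne)
  | @dn c _ p h0 hcy _ =>
    have hc := hP.not_joined_insert hxy (hsep c (Or.inl h0.end_mem))
    exact (hP.not_upFrom_and_dnFrom (h y (fun h => h.ne_right rfl) hxy hne)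
      ⟨c, hcy, hc.1⟩).elim

theorem le_of_dnFrom (hl : PairComplete P) {r x y : P} (hxy : ¬Joined x r y)
    (h : ∀ t, ¬Joined t r y → ¬Joined x r t → t ≠ x → dnFrom r t) : y ≤ x := by
  by_cases hne : y = x
  · exact hne.le
  obtain ⟨d, p, hp⟩ := (hP.linked x y).exists_pth hP.chainIntervals hl
  have hsep := hp.not_joined hP
  cases hp with
  | nil => exact le_rfl
  | @dn c _ p h0 hcy _ =>
    have hc := hP.not_joined_insert hxy (hsep c (Or.inl h0.end_mem))
    rcases h0.prev_up with rfl | ⟨e, he, hce, -⟩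
    · exact hcy.le
    have hec := h0.not_joined hP e he
    refine (hP.not_upFrom_and_dnFrom ⟨e, hce, (hP.not_joined_insert hc.2 hec).1⟩
      (h c hc.1 hc.2 ?_)).elim
    rintro rfl
    exact hec (.refl hce.ne')
  | @up c _ p h0 hcy _ =>
    have hc := hP.not_joined_insert hxy (hsep c (Or.inl h0.end_mem))
    exact (hP.not_upFrom_and_dnFrom ⟨c, hcy, hc.1⟩
      (h y (fun h => h.ne_right rfl) hxy hne)).elim

/-- The interval between comparable points contains a point of both paths from the root. -/
theorem exists_meet (hl : PairComplete P) (r : P) {x y : P} (hxy : x ≤ y) :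
    ∃ z, ¬Joined z r x ∧ ¬Joined z r y ∧ x ≤ z ∧ z ≤ y := by
  by_cases hx : Joined x r y
  swap
  · exact ⟨x, fun h => h.ne_right rfl, hx, le_rfl, hxy⟩
  by_cases hy : Joined y r x
  swap
  · exact ⟨y, hy, fun h => h.ne_right rfl, hxy, le_rfl⟩
  have hxy' : x < y := hxy.lt_of_ne hy.ne_right
  obtain ⟨d, p, hp⟩ := (hP.linked r y).exists_pth hP.chainIntervals hl
  have hsep := hp.not_joined hP
  have joined_of_ne : ∀ {a b : P}, ¬Joined a r b → a ≠ b → Joined b r a := fun h hne =>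
    by_contra fun h' => hne (hP.eq_of_not_joined h h')
  cases hp with
  | nil => exact absurd rfl hy.ne_left
  | @dn c _ p h0 hcy _ =>
    have hc := hsep c (Or.inl h0.end_mem)
    exact (hP.not_joined_of_le hxy hcy.le
      (hy.symm.trans (joined_of_ne hc hcy.ne'))).elim
  | @up c _ p h0 hcy _ =>
    have hc := hsep c (Or.inl h0.end_mem)
    -- The path to `y` ends with an ascent from `c`, and the meeting point is the least upper bound
    -- of `c` and `x`. If it were not on the path to `x`, there would be a smaller upper bound; or,
    -- when `w = c`, either `w` would be the root or `x` would be joined around `w` to a point above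
    -- `w`.
    obtain ⟨w, hcw, hxw, hw⟩ := hl.sup hcy.le hxy
    have hwy : w ≤ y := hw y hcy.le hxy
    have hwr := hP.not_joined_insert hc (hP.not_joined_of_le hcw hwy)
    refine ⟨w, fun hj => ?_, hwr.1, hxw, hwy⟩
    have hxw' : x < w := hxw.lt_of_ne hj.ne_right
    rcases hcw.eq_or_lt with rfl | hcw
    · rcases h0.prev_dn with rfl | ⟨e, he, hce, -⟩
      · exact hj.ne_left rfl
      · exact hP.not_joined hxw' hce
          (hj.symm.trans (joined_of_ne (h0.not_joined hP e he) hce.ne'))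
    · obtain ⟨w', h1, h2, h3⟩ := hP.below hcw hxw' ((joined_of_ne hwr.2 hcw.ne).symm.trans hj)
      exact h1.not_ge (hw w' h2 h3)

/-- The order can be recovered from the tree of paths from `r` and the directions. -/
theorem le_iff_exists_meet (hl : PairComplete P) (r : P) {x y : P} :
    x ≤ y ↔ ∃ z, ¬Joined z r x ∧ ¬Joined z r y ∧
      (∀ t, ¬Joined t r x → ¬Joined z r t → t ≠ z → dnFrom r t) ∧
      ∀ t, ¬Joined t r y → ¬Joined z r t → t ≠ z → upFrom r t := by
  constructor
  · intro h
    obtain ⟨z, h1, h2, h3, h4⟩ := hP.exists_meet hl r h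
    exact ⟨z, h1, h2, fun t ht ht' => hP.dnFrom_of_le h3 ht' ht,
      fun t ht ht' => hP.upFrom_of_le h4 ht' ht⟩
  · rintro ⟨z, h1, h2, h3, h4⟩
    exact (hP.le_of_dnFrom hl h1 h3).trans (hP.le_of_upFrom hl h2 h4)

end CycleFree

/-- The points of a cycle-free order, ordered by their position on the paths from a root. -/
def Rooted {P : Type*} [PartialOrder P] (_ : CycleFree P) (_ : P) : Type _ := P

instance (hP : CycleFree P) (r : P) : PartialOrder (Rooted hP r) where
  le x y := ¬Joined (P := P) x r y
  le_refl _ h := h.ne_right rfl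
  le_trans _ _ _ h h' := not_joined_trans h h'
  le_antisymm _ _ h h' := hP.eq_of_not_joined h h'

theorem Rooted.root_le {hP : CycleFree P} {r : P} (x : Rooted hP r) :
    (show Rooted hP r from r) ≤ x := fun h => h.ne_left rfl

end RootedTree

/-! ### Coding colours of a tree by attached chains. -/

section Enc

variable {P κ : Type*} [LinearOrder κ]

/-- The tree that encodes a coloured tree: every point gets a leaf and a chain, whose length
describes the colour. -/
inductive Enc (c : P → κ) : Type _
  | node (p : P) : Enc c
  | leaf (p : P) : Enc c
  | tick (p : P) (j : WithBot κ) (h : j ≤ c p) : Enc c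

variable [PartialOrder P] {c : P → κ}

namespace Enc

/-- The order of the tree. -/
protected def LE : Enc c → Enc c → Prop
  | node p, node q => p ≤ q
  | node p, leaf q => p ≤ q
  | node p, tick q _ _ => p ≤ q
  | leaf p, leaf q => p = q
  | tick p i _, tick q j _ => p = q ∧ i ≤ j
  | _, _ => False

instance : PartialOrder (Enc c) where
  le := Enc.LE
  le_refl x := by cases x <;> simp [Enc.LE]
  le_trans x y z h h' := by
    cases x <;> cases y <;> cases z <;> simp only [Enc.LE] at * <;>
      first
        | exact h.trans h'
        | exact h.trans h'.le
        | exact ⟨h.1.trans h'.1, h.2.trans h'.2⟩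
        | exact h.trans h'.1.le
  le_antisymm x y h h' := by
    cases x <;> cases y <;> simp only [Enc.LE] at *
    · rw [h.antisymm h']
    · rw [h]
    · obtain ⟨rfl, h⟩ := h
      obtain rfl := h.antisymm h'.2
      rfl

@[simp] theorem node_le_node {p q : P} : (node p : Enc c) ≤ node q ↔ p ≤ q := Iff.rfl
@[simp] theorem node_le_leaf {p q : P} : (node p : Enc c) ≤ leaf q ↔ p ≤ q := Iff.rfl
@[simp] theorem node_le_tick {p q : P} {j h} : (node p : Enc c) ≤ tick q j h ↔ p ≤ q := Iff.rfl
@[simp] theorem leaf_le_leaf {p q : P} : (leaf p : Enc c) ≤ leaf q ↔ p = q := Iff.rfl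
@[simp] theorem tick_le_tick {p q : P} {i j h h'} :
    (tick p i h : Enc c) ≤ tick q j h' ↔ p = q ∧ i ≤ j := Iff.rfl
@[simp] theorem not_leaf_le_node {p q : P} : ¬(leaf p : Enc c) ≤ node q := id
@[simp] theorem not_leaf_le_tick {p q : P} {j h} : ¬(leaf p : Enc c) ≤ tick q j h := id
@[simp] theorem not_tick_le_node {p q : P} {j h} : ¬(tick p j h : Enc c) ≤ node q := id
@[simp] theorem not_tick_le_leaf {p q : P} {j h} : ¬(tick p j h : Enc c) ≤ leaf q := id

/-- The node to which a point of the encoding belongs. -/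
def foot : Enc c → P
  | node p => p
  | leaf p => p
  | tick p _ _ => p

theorem node_le_iff {p : P} {x : Enc c} : node p ≤ x ↔ p ≤ x.foot := by
  cases x <;> exact Iff.rfl

theorem foot_mono {x y : Enc c} (h : x ≤ y) : x.foot ≤ y.foot := by
  cases x <;> cases y <;> simp only [node_le_iff, leaf_le_leaf, tick_le_tick, not_leaf_le_node,
    not_leaf_le_tick, not_tick_le_node, not_tick_le_leaf] at h
  · exact h
  · exact h
  · exact h
  · exact h.le
  · exact h.1.le

theorem isTree (hlin : ∀ x y z : P, y ≤ x → z ≤ x → y ≤ z ∨ z ≤ y) {r : P} (hr : ∀ p, r ≤ p) :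
    IsTree (Enc c) := by
  refine ⟨fun x y z h h' => ?_, fun x y => ⟨node r, node_le_iff.2 (hr _), node_le_iff.2 (hr _)⟩⟩
  have h1 := foot_mono h
  have h2 := foot_mono h'
  have hl := hlin _ _ _ h1 h2
  cases y with
  | node p =>
    cases z with
    | node q => exact hl
    | leaf q =>
      cases x <;> simp at h'
      subst h'
      exact Or.inl h1
    | tick q j hj =>
      cases x <;> simp at h'
      obtain ⟨rfl, -⟩ := h'
      exact Or.inl h1
  | leaf p =>
    cases x <;> simp at h
    subst h
    cases z <;> simp at h'
    · exact Or.inr h'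
    · exact Or.inl h'.symm
  | tick p i hi =>
    cases x <;> simp at h
    obtain ⟨rfl, h⟩ := h
    cases z <;> simp at h'
    · exact Or.inr h'
    · obtain ⟨rfl, h'⟩ := h'
      exact (le_total _ _).imp (fun h => ⟨rfl, h⟩) fun h => ⟨rfl, h⟩

/-- The chain of the root, with the root. -/
def rootChain (c : P → κ) (r : P) : Set (Enc c) := {x | x = node r ∨ ∃ j h, x = tick r j h}

theorem isMaxChain_rootChain {r : P} (hr : ∀ p, r ≤ p) :
    IsMaxChain (· ≤ ·) (rootChain c r) := by
  constructor
  · rintro _ (rfl | ⟨i, hi, rfl⟩) _ (rfl | ⟨j, hj, rfl⟩) -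
    · exact Or.inl le_rfl
    · exact Or.inl (node_le_tick.2 le_rfl)
    · exact Or.inr (node_le_tick.2 le_rfl)
    · exact (le_total i j).imp (fun h => ⟨rfl, h⟩) fun h => ⟨rfl, h⟩
  · intro t ht hst
    refine hst.antisymm fun x hx => ?_
    have h1 : ∀ j h, tick r j h ≤ x ∨ x ≤ tick r j h := fun j h =>
      ht.total (hst (Or.inr ⟨j, h, rfl⟩)) hx
    -- The lowest tick of `r` is comparable only with the ticks of `r` and with nodes below `r`, and
    -- the only such node is `r`.
    have h2 := h1 ⊥ bot_le
    cases x with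
    | node p =>
      simp only [not_tick_le_node, node_le_tick, false_or] at h2
      exact Or.inl (by rw [h2.antisymm (hr p)])
    | leaf p => simp at h2
    | tick p j h =>
      simp only [tick_le_tick] at h2
      obtain rfl : p = r := h2.elim (fun h => h.1.symm) And.left
      exact Or.inr ⟨j, h, rfl⟩

/-- The automorphisms of a coloured tree. -/
def colourAut (c : P → κ) : Subgroup (P ≃o P) where
  carrier := {f | ∀ p, c (f p) = c p}
  mul_mem' {f g} hf hg p := (hf (g p)).trans (hg p)
  one_mem' _ := rfl
  inv_mem' {f} hf p := by
    have := hf (f⁻¹ p)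
    rw [← this]
    exact congrArg c (f.apply_symm_apply p)

/-- The map of encodings induced by an automorphism of a coloured tree. -/
def mapFun (f : P → P) (hf : ∀ p, c (f p) = c p) : Enc c → Enc c
  | node p => node (f p)
  | leaf p => leaf (f p)
  | tick p j h => tick (f p) j (by rwa [hf])

/-- The automorphism of the encoding induced by an automorphism of a coloured tree. -/
def mapIso : colourAut c →* (Enc c ≃o Enc c) where
  toFun f :=
    { toFun := mapFun f.1 f.2
      invFun := mapFun (f⁻¹).1 (f⁻¹).2
      left_inv := fun x => by cases x <;> simp [mapFun]
      right_inv := fun x => by cases x <;> simp [mapFun]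
      map_rel_iff' := fun {x y} => by
        cases x <;> cases y <;> simp [mapFun] }
  map_one' := by
    ext x
    cases x <;> rfl
  map_mul' f g := by
    ext x
    cases x <;> rfl

/-- The points with two incomparable points above them. -/
def Branches {X : Type*} [PartialOrder X] (x : X) : Prop :=
  ∃ u v, x ≤ u ∧ x ≤ v ∧ ¬u ≤ v ∧ ¬v ≤ u

/-- Above a node there are its leaf and its ticks, which are incomparable; above a leaf or a tick
there is only a chain. Nodes are therefore preserved by automorphisms. -/
theorem branches_iff {x : Enc c} : Branches x ↔ ∃ p, x = node p := by
  constructor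
  · rintro ⟨u, v, hu, hv, huv, hvu⟩
    cases x with
    | node p => exact ⟨p, rfl⟩
    | leaf p =>
      cases u <;> simp at hu
      cases v <;> simp at hv
      exact absurd (leaf_le_leaf.2 (hu.symm.trans hv)) huv
    | tick p j h =>
      cases u <;> simp at hu
      cases v <;> simp at hv
      obtain ⟨rfl, -⟩ := hu
      obtain ⟨rfl, -⟩ := hv
      simp only [tick_le_tick, true_and, not_le] at huv hvu
      exact absurd huv hvu.not_gt
  · rintro ⟨p, rfl⟩
    exact ⟨leaf p, tick p ⊥ bot_le, by simp, by simp, by simp, by simp⟩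

theorem branches_map {X : Type*} [PartialOrder X] {f : X ≃o X} {x : X} (h : Branches x) :
    Branches (f x) := by
  obtain ⟨u, v, h1, h2, h3, h4⟩ := h
  exact ⟨f u, f v, by simpa, by simpa, by simpa, by simpa⟩

theorem exists_node (f : Enc c ≃o Enc c) (p : P) : ∃ q, f (node p) = node q :=
  branches_iff.1 (branches_map (branches_iff.2 ⟨p, rfl⟩))

/-- The effect of an automorphism of the encoding on the nodes. -/
noncomputable def nodeFun (f : Enc c ≃o Enc c) (p : P) : P := (exists_node f p).choose

theorem apply_node (f : Enc c ≃o Enc c) (p : P) : f (node p) = node (nodeFun f p) :=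
  (exists_node f p).choose_spec

/-- The effect of an automorphism of the encoding on the nodes, as an automorphism. -/
noncomputable def nodeIso (f : Enc c ≃o Enc c) : P ≃o P where
  toFun := nodeFun f
  invFun := nodeFun f.symm
  left_inv p := by
    have : node (nodeFun f.symm (nodeFun f p)) = (node p : Enc c) := by
      rw [← apply_node, ← apply_node, f.symm_apply_apply]
    exact (Enc.node.injEq ..).mp this
  right_inv p := by
    have : node (nodeFun f (nodeFun f.symm p)) = (node p : Enc c) := by
      rw [← apply_node, ← apply_node, f.apply_symm_apply]
    exact (Enc.node.injEq ..).mp this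
  map_rel_iff' {p q} := by
    rw [← node_le_node (c := c), Equiv.coe_fn_mk, ← apply_node, ← apply_node, f.le_iff_le,
      node_le_node]

/-- The foot carries the greatest node below a point, so the order determines it. -/
theorem foot_apply (f : Enc c ≃o Enc c) (x : Enc c) : (f x).foot = nodeIso f x.foot := by
  have h : ∀ p, nodeIso f p ≤ (f x).foot ↔ p ≤ x.foot := fun p => by
    rw [← node_le_iff, ← node_le_iff, ← f.le_iff_le (x := node p), apply_node]
    rfl
  obtain ⟨q, hq⟩ := (nodeIso f).surjective (f x).foot
  rw [← hq]
  apply le_antisymm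
  · exact (nodeIso f).monotone ((h q).1 hq.le)
  · rw [hq]
    exact (h _).2 le_rfl

theorem apply_ne_node {f : Enc c ≃o Enc c} {x : Enc c} (hx : ∀ p, x ≠ node p) (q : P) :
    f x ≠ node q := by
  intro h
  have := apply_node f.symm q
  rw [← h, f.symm_apply_apply] at this
  exact hx _ this

/-- A leaf is comparable with no other point except nodes, whereas each chain contains the two
different ticks `⊥` and `c p`. This is why the ticks are indexed by `WithBot κ`. -/
theorem apply_tick_ne_leaf (f : Enc c ≃o Enc c) {p q : P} {j : WithBot κ} (h : j ≤ c p) :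
    f (tick p j h) ≠ leaf q := by
  intro hf
  have key : ∀ (i : WithBot κ) (_ : i ≤ c p), i ≤ j ∨ j ≤ i → i = j := by
    intro i hi hij
    have hcomp : f (tick p i hi) ≤ leaf q ∨ leaf q ≤ f (tick p i hi) := by
      rw [← hf, f.le_iff_le, f.le_iff_le]
      exact hij.imp (fun h => ⟨rfl, h⟩) fun h => ⟨rfl, h⟩
    have hne : ∀ q, f (tick p i hi) ≠ node q := apply_ne_node (by simp)
    have : f (tick p i hi) = leaf q := by
      generalize f (tick p i hi) = y at *
      cases y with
      | node p => exact absurd rfl (hne p)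
      | leaf p =>
        rw [leaf_le_leaf, leaf_le_leaf] at hcomp
        rw [hcomp.elim id Eq.symm]
      | tick p i hi => simp at hcomp
    have := f.injective (this.trans hf.symm)
    simp only [tick.injEq, true_and] at this
    exact this
  have h1 := key ⊥ bot_le (Or.inl bot_le)
  have h2 := key (c p) le_rfl (Or.inr h)
  exact WithBot.bot_ne_coe (h1.trans h2.symm)

theorem exists_tick (f : Enc c ≃o Enc c) {p : P} {j : WithBot κ} (h : j ≤ c p) :
    ∃ i hi, f (tick p j h) = tick (nodeIso f p) i hi := by
  have h1 := foot_apply f (tick p j h)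
  have h2 := apply_ne_node (f := f) (x := tick p j h) (by simp)
  have h3 := fun q => apply_tick_ne_leaf f (q := q) h
  generalize f (tick p j h) = y at *
  cases y with
  | node q => exact absurd rfl (h2 q)
  | leaf q => exact absurd rfl (h3 q)
  | tick q i hi =>
    simp only [foot] at h1
    subst h1
    exact ⟨i, hi, rfl⟩

theorem apply_leaf (f : Enc c ≃o Enc c) (p : P) : f (leaf p) = leaf (nodeIso f p) := by
  have h1 := foot_apply f (leaf p)
  have h2 := apply_ne_node (f := f) (x := leaf p) (by simp)
  have h3 : ∀ q i hi, f (leaf p) ≠ tick q i hi := by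
    intro q i hi h
    have := apply_tick_ne_leaf f.symm (q := p) hi
    rw [← h, f.symm_apply_apply] at this
    exact this rfl
  generalize f (leaf p) = y at *
  cases y with
  | node q => exact absurd rfl (h2 q)
  | leaf q => exact congrArg leaf h1
  | tick q i hi => exact absurd rfl (h3 q i hi)

/-- A strictly increasing map of well-ordered chains cannot lower a level. Applied to `f` and to its
inverse, this shows that levels are preserved. -/
theorem le_of_apply_tick [WellFoundedLT κ] (f : Enc c ≃o Enc c) {p q : P} :
    ∀ (j : WithBot κ) (h : j ≤ c p) {i hi}, f (tick p j h) = tick q i hi → j ≤ i := by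
  intro j
  induction j using WellFoundedLT.induction with
  | ind j ih =>
    intro h i hi hf
    obtain rfl : q = nodeIso f p := by
      have := foot_apply f (tick p j h)
      rw [hf] at this
      exact this
    by_contra hij
    push Not at hij
    obtain ⟨k, hk, hfk⟩ := exists_tick f (hij.le.trans h)
    have h1 := ih i hij (hij.le.trans h) hfk
    have h2 : f (tick p i (hij.le.trans h)) < f (tick p j h) :=
      f.lt_iff_lt.2 (lt_of_le_not_ge ⟨rfl, hij.le⟩ fun h' => hij.not_ge h'.2)
    rw [hf, hfk] at h2
    exact h2.not_ge ⟨(tick_le_tick.1 h2.le).1.symm, h1⟩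

theorem apply_tick [WellFoundedLT κ] (f : Enc c ≃o Enc c) {p : P} {j : WithBot κ} (h : j ≤ c p) :
    ∃ h', f (tick p j h) = tick (nodeIso f p) j h' := by
  obtain ⟨i, hi, hf⟩ := exists_tick f h
  have h1 := le_of_apply_tick f j h hf
  have h2 := le_of_apply_tick f.symm i hi (q := p) (i := j) (hi := h)
    ((f.symm_apply_eq).2 hf.symm)
  obtain rfl := h1.antisymm h2
  exact ⟨hi, hf⟩

/-- The top tick at `p` has level `c p`, and its image has the same level, so the image node has at
least this colour. The inverse gives equality. -/
theorem nodeIso_mem [WellFoundedLT κ] (f : Enc c ≃o Enc c) : nodeIso f ∈ colourAut c := by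
  have key : ∀ (f : Enc c ≃o Enc c) p, c p ≤ c (nodeIso f p) := fun f p => by
    obtain ⟨h, -⟩ := apply_tick f (le_refl (c p : WithBot κ))
    exact WithBot.coe_le_coe.1 h
  intro p
  refine le_antisymm ?_ (key f p)
  have := key f.symm (nodeIso f p)
  rwa [show nodeIso f.symm (nodeIso f p) = p from (nodeIso f).symm_apply_apply p] at this

/-- The automorphisms of the encoding are those of the coloured tree. -/
noncomputable def autEquiv (c : P → κ) [WellFoundedLT κ] : colourAut c ≃* (Enc c ≃o Enc c) :=
  MulEquiv.ofBijective mapIso ⟨fun f g h => by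
    ext p
    have := DFunLike.congr_fun h (node p)
    exact (Enc.node.injEq ..).mp this, fun f => by
    refine ⟨⟨nodeIso f, nodeIso_mem f⟩, ?_⟩
    ext x
    cases x with
    | node p => exact (apply_node f p).symm
    | leaf p => exact (apply_leaf f p).symm
    | tick p j h => exact (apply_tick f h).choose_spec.symm⟩

end Enc

end Enc

/-! ### Automorphisms supported in a set, as automorphisms of a tree. -/

section Colour

variable {M : Type*} [PartialOrder M]

/-- The colours that describe the automorphisms supported in a given set. -/
abbrev Colour (M : Type*) : Type _ := Set M × Prop × Prop × Prop

/-- The colour of a point of the completion: its name if it is not in `Z`, whether it belongs to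
`M`, and the direction in which it is reached from `r`. -/
def colour (r : M) (Z : Set M) (p : Completion M) : Colour M :=
  ({m | m ∉ Z ∧ toCompletion m = p}, (∃ m, toCompletion m = p), upFrom (toCompletion r) p,
    dnFrom (toCompletion r) p)

variable (hM : IsCFPO M) {r : M} {Z : Set M} (hr : r ∉ Z)

theorem upFrom_map {P : Type*} [PartialOrder P] (f : P ≃o P) {r p : P} :
    upFrom (f r) (f p) ↔ upFrom r p := by
  rw [upFrom, upFrom, f.surjective.exists]
  simp only [f.lt_iff_lt, joined_map_iff]

theorem dnFrom_map {P : Type*} [PartialOrder P] (f : P ≃o P) {r p : P} :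
    dnFrom (f r) (f p) ↔ dnFrom r p := by
  rw [dnFrom, dnFrom, f.surjective.exists]
  simp only [f.lt_iff_lt, joined_map_iff]

include hr in
theorem completionMap_root {g : M ≃o M} (hg : g ∈ supportedIn Z) :
    completionMap g (toCompletion r) = toCompletion r := by
  rw [completionMap_toCompletion, hg r hr]

include hr in
theorem colour_completionMap {g : M ≃o M} (hg : g ∈ supportedIn Z) (p : Completion M) :
    colour r Z (completionMap g p) = colour r Z p := by
  have key : ∀ m, toCompletion (g m) = completionMap g p ↔ toCompletion m = p := fun m => by
    rw [← completionMap_toCompletion, (completionMap g).injective.eq_iff]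
  refine Prod.ext ?_ (Prod.ext ?_ (Prod.ext ?_ ?_))
  · ext m
    refine and_congr_right fun hm => ?_
    rw [← key, hg m hm]
  · apply propext
    exact g.surjective.exists.trans (exists_congr key)
  · apply propext
    simp only [colour]
    nth_rw 1 [← completionMap_root hr hg]
    exact upFrom_map _
  · apply propext
    simp only [colour]
    nth_rw 1 [← completionMap_root hr hg]
    exact dnFrom_map _

/-- The automorphism of the tree of paths from `r` induced by an automorphism that fixes `r`. -/
def rootedIso {g : M ≃o M} (hg : completionMap g (toCompletion r) = toCompletion r) :
    Rooted hM.cycleFree (toCompletion r) ≃o Rooted hM.cycleFree (toCompletion r) where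
  toEquiv := (completionMap g).toEquiv
  map_rel_iff' {x y} := by
    refine not_congr ?_
    change Joined (completionMap g x) (toCompletion r) (completionMap g y) ↔ _
    nth_rw 1 [← hg]
    exact joined_map_iff (completionMap g)

section Encode

variable {κ : Type*} [LinearOrder κ] (e : Colour M → κ)

/-- The colouring of the tree of paths from `r`. -/
def rootedColour (r : M) (Z : Set M) (p : Rooted hM.cycleFree (toCompletion r)) : κ :=
  e (colour r Z p)

/-- The automorphisms supported in `Z` as automorphisms of a coloured tree. -/
def supportedHom : supportedIn Z →* Enc.colourAut (rootedColour hM e r Z) where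
  toFun g := ⟨rootedIso hM (completionMap_root hr g.2),
    fun p => congrArg e (colour_completionMap hr g.2 p)⟩
  map_one' := rfl
  map_mul' _ _ := rfl

omit [LinearOrder κ] in
theorem supportedHom_injective : Function.Injective (supportedHom hM hr e) := by
  intro g g' h
  ext m
  have h1 : completionMap g.1 (toCompletion m) = completionMap g'.1 (toCompletion m) :=
    DFunLike.congr_fun (congrArg Subtype.val h) (toCompletion m)
  rw [completionMap_toCompletion, completionMap_toCompletion] at h1
  exact toCompletion_injective h1

/-- An automorphism of the completion that preserves the original points comes from an automorphism
of the original order. -/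
theorem exists_completionMap_eq (f : Completion M ≃o Completion M)
    (hf : ∀ x, (∃ m, toCompletion m = f x) ↔ ∃ m, toCompletion m = x) :
    ∃ g : M ≃o M, completionMap g = f := by
  choose g hg using fun m : M => (hf (toCompletion m)).2 ⟨m, rfl⟩
  have hf' : ∀ m : M, ∃ m', toCompletion m' = f.symm (toCompletion m) := fun m => by
    rw [← hf, f.apply_symm_apply]
    exact ⟨m, rfl⟩
  choose g' hg' using hf'
  let φ : M ≃o M :=
    { toFun := g
      invFun := g'
      left_inv := fun m => toCompletion_injective (by rw [hg', hg, f.symm_apply_apply])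
      right_inv := fun m => toCompletion_injective (by rw [hg, hg', f.apply_symm_apply])
      map_rel_iff' := fun {a b} => by
        rw [Equiv.coe_fn_mk, ← toCompletion_le, hg, hg, f.le_iff_le, toCompletion_le] }
  refine ⟨φ, ?_⟩
  have key : ∀ x m, toCompletion m ≤ completionMap φ x ↔ toCompletion m ≤ f x := fun x m => by
    rw [toCompletion_le_completionMap, show φ.symm m = g' m from rfl, hg', f.symm_apply_le]
  exact DFunLike.ext _ _ fun x => le_antisymm
    (Completion.le_of_forall_left fun m => (key x m).1)
    (Completion.le_of_forall_left fun m => (key x m).2)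

-- The components of the colour are designed for this. The directions let the tree determine the
-- order of `M^D`, membership in `M` brings the map down to `M`, and the names force it to fix every
-- point outside `Z`.
omit [LinearOrder κ] in
theorem supportedHom_surjective (he : Function.Injective e) :
    Function.Surjective (supportedHom hM hr e) := by
  rintro ⟨f, hf⟩
  -- The underlying bijection is separated from the tree order, since it has to be shown to preserve
  -- the original order.
  obtain ⟨F, hF⟩ : ∃ F : Completion M ≃ Completion M, ∀ x, F x = f x := ⟨f.toEquiv, fun _ => rfl⟩
  have hc : ∀ p, colour r Z (F p) = colour r Z p := fun p => he ((congrArg _ (hF p)).trans (hf p))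
  have hname : ∀ m ∉ Z, F (toCompletion m) = toCompletion m := by
    intro m hm
    have h1 : m ∈ (colour r Z (toCompletion m)).1 := ⟨hm, rfl⟩
    rw [← hc] at h1
    exact h1.2.symm
  have hup : ∀ p, upFrom (toCompletion r) (F p) ↔ upFrom (toCompletion r) p :=
    fun p => iff_of_eq (congrArg (fun x => x.2.2.1) (hc p))
  have hdn : ∀ p, dnFrom (toCompletion r) (F p) ↔ dnFrom (toCompletion r) p :=
    fun p => iff_of_eq (congrArg (fun x => x.2.2.2) (hc p))
  have hj : ∀ x y, Joined (F x) (toCompletion r) (F y) ↔ Joined x (toCompletion r) y := by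
    intro x y
    rw [hF, hF]
    exact not_iff_not.1 f.le_iff_le
  have hle : ∀ {x y}, F x ≤ F y ↔ x ≤ y := by
    intro x y
    rw [hM.cycleFree.le_iff_exists_meet Completion.pairComplete (toCompletion r),
      hM.cycleFree.le_iff_exists_meet Completion.pairComplete (toCompletion r),
      F.surjective.exists]
    refine exists_congr fun z => and_congr (not_congr (hj z x)) (and_congr (not_congr (hj z y))
      (and_congr (F.surjective.forall.trans ?_) (F.surjective.forall.trans ?_)))
    · simp only [hj, hdn, F.injective.ne_iff]
    · simp only [hj, hup, F.injective.ne_iff]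
  obtain ⟨g, hg⟩ := exists_completionMap_eq ⟨F, hle⟩
    fun x => iff_of_eq (congrArg (fun x => x.2.1) (hc x))
  have hg' : ∀ x, completionMap g x = F x := fun x => DFunLike.congr_fun hg x
  refine ⟨⟨g, fun m hm => toCompletion_injective ?_⟩, ?_⟩
  · rw [← completionMap_toCompletion, hg', hname m hm]
  · exact Subtype.ext (DFunLike.ext _ _ fun x => (hg' x).trans (hF x))

/-- The automorphisms supported in `Z` are the automorphisms of a tree. -/
noncomputable def supportedEquiv [WellFoundedLT κ] (he : Function.Injective e) :
    supportedIn Z ≃* (Enc (rootedColour hM e r Z) ≃o Enc (rootedColour hM e r Z)) :=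
  (MulEquiv.ofBijective (supportedHom hM hr e)
    ⟨supportedHom_injective hM hr e, supportedHom_surjective hM hr e he⟩).trans
    (Enc.autEquiv _)

end Encode

end Colour

end CFPO

namespace CFPO

open Set

namespace Dec

/-! ### The order of a decoration. -/

section Order

variable {X S T : Type*} [PartialOrder X] [PartialOrder S] [PartialOrder T] {L : Set T}

/-- An explicit description of the order of a decoration. -/
def Below : Dec X S L → Dec X S L → Prop
  | base x, base y => x ≤ y
  | base x, above y _ => x ≤ y
  | base x, between e _ => x ≤ e.1.1
  | above x s, above y s' => x = y ∧ s ≤ s'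
  | above _ _, _ => False
  | between e t, base y => t ∈ L ∧ e.1.2 ≤ y
  | between e t, above y _ => t ∈ L ∧ e.1.2 ≤ y
  | between e t, between e' t' => (e = e' ∧ t ≤ t') ∨ (t ∈ L ∧ e.1.2 ≤ e'.1.1)

theorem Below.step (hL : IsLowerSet L) {a b c : Dec X S L} (h : Below a b) (h' : Step b c) :
    Below a c := by
  cases h' with
  | @base x y hxy =>
    cases a with
    | base z => exact le_trans h hxy
    | above z s => exact h
    | between e t => exact ⟨h.1, h.2.trans hxy⟩
  | @above x s s' hs =>
    cases a with
    | base z => exact h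
    | above z s => exact ⟨h.1, h.2.trans hs⟩
    | between e t => exact h
  | base_above x s =>
    cases a with
    | base z => exact h
    | above z s => exact h.elim
    | between e t => exact h
  | @between e t t' ht =>
    cases a with
    | base z => exact h
    | above z s => exact h
    | between e' t'' => exact h.imp (fun h => ⟨h.1, h.2.trans ht⟩) id
  | @base_between e t ht =>
    cases a with
    | base z => exact h
    | above z s => exact h
    | between e' t'' => exact Or.inr h
  | @between_base e t ht =>
    cases a with
    | base z => exact le_trans h e.2.le
    | above z s => exact h
    | between e' t'' =>
      rcases h with ⟨rfl, h⟩ | h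
      · exact ⟨hL h ht, le_rfl⟩
      · exact ⟨h.1, h.2.trans e.2.le⟩

theorem Below.refl (a : Dec X S L) : Below a a := by
  cases a with
  | base z => exact le_refl z
  | above z s => exact ⟨rfl, le_rfl⟩
  | between e t => exact Or.inl ⟨rfl, le_rfl⟩

theorem le_of_step {a b : Dec X S L} (h : Step a b) : a ≤ b := Relation.ReflTransGen.single h

/-- Because `L` is a lower set, only points of `L` lie below the upper end of an adjacent pair.
Because the least point of the tree is in `L`, the whole copy lies above the lower end. -/
theorem le_iff_below (hL : IsLowerSet L) {b₀ : T} (hb : b₀ ∈ L) (hb₀ : ∀ t, b₀ ≤ t)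
    {a b : Dec X S L} : a ≤ b ↔ Below a b := by
  constructor
  · intro h
    change Relation.ReflTransGen Step a b at h
    induction h with
    | refl => exact .refl a
    | tail _ h ih => exact ih.step hL h
  · have h1 : ∀ {x y : X}, x ≤ y → (base x : Dec X S L) ≤ base y := fun h => le_of_step (.base h)
    have h2 : ∀ (x : X) (s : S), (base x : Dec X S L) ≤ above x s := fun x s =>
      le_of_step (.base_above x s)
    have h3 : ∀ (e : AdjPair X) (t : T), (base e.1.1 : Dec X S L) ≤ between e t := fun e t =>
      (le_of_step (.base_between e hb)).trans (le_of_step (.between (hb₀ t)))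
    have h4 : ∀ (e : AdjPair X) {t : T}, t ∈ L → (between e t : Dec X S L) ≤ base e.1.2 :=
      fun e t ht => le_of_step (.between_base e ht)
    intro h
    cases a with
    | base x =>
      cases b with
      | base y => exact h1 h
      | above y s => exact (h1 h).trans (h2 y s)
      | between e t => exact (h1 h).trans (h3 e t)
    | above x s =>
      cases b with
      | base y => exact h.elim
      | above y s' =>
        obtain ⟨rfl, h⟩ := h
        exact le_of_step (.above h)
      | between e t => exact h.elim
    | between e t =>
      cases b with
      | base y => exact (h4 e h.1).trans (h1 h.2)
      | above y s => exact ((h4 e h.1).trans (h1 h.2)).trans (h2 y s)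
      | between e' t' =>
        rcases h with ⟨rfl, h⟩ | h
        · exact le_of_step (.between h)
        · exact ((h4 e h.1).trans (h1 h.2)).trans (h3 e' t')

end Order

/-! ### Automorphisms of a decoration by encoded trees. -/

section Enc

variable {X P Q κ μ : Type*} [PartialOrder X] [PartialOrder P] [PartialOrder Q] [LinearOrder κ]
  [LinearOrder μ] {c : P → κ} {d : Q → μ} {p₀ : P} {q₀ : Q}

open Enc

theorem isLowerSet_rootChain (hq₀ : ∀ q, q₀ ≤ q) : IsLowerSet (rootChain d q₀) := by
  rintro _ t ht (rfl | ⟨j, h, rfl⟩)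
  · cases t <;> simp at ht
    exact Or.inl (by rw [ht.antisymm (hq₀ _)])
  · cases t <;> simp at ht
    · exact Or.inl (by rw [ht.antisymm (hq₀ _)])
    · obtain ⟨rfl, -⟩ := ht
      exact Or.inr ⟨_, _, rfl⟩

variable (hq₀ : ∀ q, q₀ ≤ q)

include hq₀ in
theorem le_iff {a b : Dec X (Enc c) (rootChain d q₀)} : a ≤ b ↔ Below a b :=
  le_iff_below (isLowerSet_rootChain hq₀) (Or.inl rfl) fun _ => node_le_iff.2 (hq₀ _)

omit [PartialOrder Q] in
@[simp] theorem leaf_notMem_rootChain {q : Q} : leaf q ∉ rootChain d q₀ := by simp [rootChain]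

omit [PartialOrder Q] in
@[simp] theorem tick_mem_rootChain {q : Q} {j : WithBot μ} {h : j ≤ d q} :
    tick q j h ∈ rootChain d q₀ ↔ q = q₀ := by
  constructor
  · rintro (h | ⟨j, h, h'⟩)
    · simp at h
    · simp only [tick.injEq] at h'
      exact h'.1
  · rintro rfl
    exact Or.inr ⟨j, h, rfl⟩

local notation "𝒟" => Dec X (Enc c) (rootChain d q₀)

section

include hq₀

theorem base_le_base {x y : X} : (base x : 𝒟) ≤ base y ↔ x ≤ y := le_iff hq₀

theorem base_le_above {x y : X} {s : Enc c} : (base x : 𝒟) ≤ above y s ↔ x ≤ y := le_iff hq₀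

theorem base_le_between {x : X} {e : AdjPair X} {t : Enc d} :
    (base x : 𝒟) ≤ between e t ↔ x ≤ e.1.1 := le_iff hq₀

theorem above_le_iff {x : X} {s : Enc c} {b : 𝒟} :
    above x s ≤ b ↔ ∃ s', b = above x s' ∧ s ≤ s' := by
  rw [le_iff hq₀]
  cases b with
  | base y => exact ⟨False.elim, by rintro ⟨s', h, -⟩; cases h⟩
  | above y s' =>
    constructor
    · rintro ⟨rfl, h⟩
      exact ⟨s', rfl, h⟩
    · rintro ⟨s'', h, h'⟩
      cases h
      exact ⟨rfl, h'⟩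
  | between e t => exact ⟨False.elim, by rintro ⟨s', h, -⟩; cases h⟩

theorem between_le_iff {e : AdjPair X} {t : Enc d} {b : 𝒟} :
    between e t ≤ b ↔ (∃ t', b = between e t' ∧ t ≤ t') ∨ (t ∈ rootChain d q₀ ∧ base e.1.2 ≤ b) := by
  rw [le_iff hq₀, le_iff hq₀]
  cases b with
  | base y => exact ⟨Or.inr, fun h => h.resolve_left (by rintro ⟨t', h, -⟩; cases h)⟩
  | above y s' => exact ⟨Or.inr, fun h => h.resolve_left (by rintro ⟨t', h, -⟩; cases h)⟩
  | between e' t' =>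
    refine or_congr_left ⟨?_, ?_⟩
    · rintro ⟨rfl, h⟩
      exact ⟨t', rfl, h⟩
    · rintro ⟨t'', h, h'⟩
      cases h
      exact ⟨rfl, h'⟩

theorem base_lt_above {x : X} {s : Enc c} : (base x : 𝒟) < above x s :=
  lt_of_le_not_ge ((base_le_above hq₀).2 le_rfl) fun h => by
    obtain ⟨s', h, -⟩ := (above_le_iff hq₀).1 h
    cases h

theorem not_between_le_base {e : AdjPair X} {t : Enc d} : ¬(between e t : 𝒟) ≤ base e.1.1 := by
  intro h
  rcases (between_le_iff hq₀).1 h with ⟨t', h, -⟩ | ⟨-, h⟩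
  · cases h
  · exact e.2.lt.not_ge ((base_le_base hq₀).1 h)

theorem base_lt_between {e : AdjPair X} {t : Enc d} : (base e.1.1 : 𝒟) < between e t :=
  lt_of_le_not_ge ((base_le_between hq₀).2 le_rfl) (not_between_le_base hq₀)

theorem between_le_between {e : AdjPair X} {t t' : Enc d} :
    (between e t : 𝒟) ≤ between e t' ↔ t ≤ t' := by
  rw [between_le_iff hq₀]
  constructor
  · rintro (⟨t', h, h'⟩ | ⟨-, h⟩)
    · cases h
      exact h'
    · exact absurd ((base_le_between hq₀).1 h) e.2.lt.not_ge
  · exact fun h => Or.inl ⟨t', rfl, h⟩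

theorem above_le_above {x : X} {s s' : Enc c} : (above x s : 𝒟) ≤ above x s' ↔ s ≤ s' := by
  rw [above_le_iff hq₀]
  constructor
  · rintro ⟨t', h, h'⟩
    cases h
    exact h'
  · exact fun h => ⟨s', rfl, h⟩

theorem between_lt_base {e : AdjPair X} {t : Enc d} (ht : t ∈ rootChain d q₀) :
    (between e t : 𝒟) < base e.1.2 :=
  lt_of_le_not_ge ((between_le_iff hq₀).2 (Or.inr ⟨ht, le_rfl⟩)) fun h =>
    e.2.lt.not_ge ((base_le_between hq₀).1 h)

theorem base_covBy_above (hp₀ : ∀ p, p₀ ≤ p) (x : X) : (base x : 𝒟) ⋖ above x (node p₀) := by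
  refine ⟨base_lt_above hq₀, fun b h1 h2 => ?_⟩
  cases b with
  | base y =>
    have h3 := (base_le_above hq₀).1 h2.le
    exact h1.not_ge ((base_le_base hq₀).2 h3)
  | above y s =>
    obtain ⟨s', h, h'⟩ := (above_le_iff hq₀).1 h2.le
    cases h
    exact h2.not_ge ((above_le_above hq₀).2 (node_le_iff.2 (hp₀ _)))
  | between e t =>
    rcases (between_le_iff hq₀).1 h2.le with ⟨t', h, -⟩ | ⟨-, h⟩
    · cases h
    · exact (e.2.lt.trans_le ((base_le_above hq₀).1 h)).not_ge ((base_le_between hq₀).1 h1.le)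

theorem base_covBy_between (e : AdjPair X) : (base e.1.1 : 𝒟) ⋖ between e (node q₀) := by
  refine ⟨base_lt_between hq₀, fun b h1 h2 => ?_⟩
  cases b with
  | base y =>
    have h3 := (base_le_between hq₀).1 h2.le
    exact h1.not_ge ((base_le_base hq₀).2 h3)
  | above y s =>
    obtain ⟨s', h, h'⟩ := (above_le_iff hq₀).1 h2.le
    cases h
  | between e' t =>
    rcases (between_le_iff hq₀).1 h2.le with ⟨t', h, -⟩ | ⟨-, h⟩
    · cases h
      exact h2.not_ge ((between_le_between hq₀).2 (node_le_iff.2 (hq₀ _)))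
    · exact (e'.2.lt.trans_le ((base_le_between hq₀).1 h)).not_ge ((base_le_between hq₀).1 h1.le)

theorem isMax_above_leaf (x : X) (p : P) : IsMax (above x (leaf p) : 𝒟) := by
  intro b h
  obtain ⟨s, rfl, hs⟩ := (above_le_iff hq₀).1 h
  cases s <;> simp at hs
  subst hs
  exact le_rfl

theorem isMax_between_leaf (e : AdjPair X) (q : Q) : IsMax (between e (leaf q) : 𝒟) := by
  intro b h
  obtain ⟨s, rfl, hs⟩ := ((between_le_iff hq₀).1 h).resolve_right fun h =>
    leaf_notMem_rootChain h.1
  cases s <;> simp at hs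
  subst hs
  exact le_rfl

theorem not_isMax_base (p₀ : P) (x : X) : ¬IsMax (base x : 𝒟) := fun h =>
  (base_lt_above hq₀ (s := node p₀)).not_isMax h

theorem not_isMax_above_node (x : X) (p : P) : ¬IsMax (above x (node p) : 𝒟) := fun h =>
  not_leaf_le_node ((above_le_above hq₀).1
    (h ((above_le_above hq₀).2 (node_le_leaf.2 (le_refl p)))))

theorem not_isMax_between_node (e : AdjPair X) (q : Q) : ¬IsMax (between e (node q) : 𝒟) := fun h =>
  not_leaf_le_node ((between_le_between hq₀).1
    (h ((between_le_between hq₀).2 (node_le_leaf.2 (le_refl q)))))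

end

/-- The points with a maximal cover and another point above them. -/
def HasLeaf {Y : Type*} [PartialOrder Y] (y : Y) : Prop := ∃ u, y ⋖ u ∧ IsMax u ∧ ∃ v, y < v ∧ v ≠ u

theorem HasLeaf.map {Y : Type*} [PartialOrder Y] (f : Y ≃o Y) {y : Y} (h : HasLeaf y) :
    HasLeaf (f y) := by
  obtain ⟨u, h1, h2, v, h3, h4⟩ := h
  exact ⟨f u, (apply_covBy_apply_iff f).2 h1, f.isMax_apply.2 h2, f v, f.lt_iff_lt.2 h3,
    f.injective.ne h4⟩

section

include hq₀

theorem hasLeaf_above_node (x : X) (p : P) : HasLeaf (above x (node p) : 𝒟) := by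
  refine ⟨above x (leaf p), ⟨?_, fun b h1 h2 => ?_⟩, isMax_above_leaf hq₀ x p,
    above x (tick p ⊥ bot_le), ?_, by simp⟩
  · exact lt_of_le_not_ge ((above_le_above hq₀).2 (node_le_leaf.2 le_rfl)) fun h =>
      not_leaf_le_node ((above_le_above hq₀).1 h)
  · obtain ⟨s, rfl, hs⟩ := (above_le_iff hq₀).1 h1.le
    have hs' := (above_le_above hq₀).1 h2.le
    cases s <;> simp at hs'
    · exact h1.not_ge ((above_le_above hq₀).2 (node_le_node.2 hs'))
    · subst hs'
      exact h2.false
  · exact lt_of_le_not_ge ((above_le_above hq₀).2 (node_le_tick.2 le_rfl)) fun h =>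
      not_tick_le_node ((above_le_above hq₀).1 h)

theorem hasLeaf_between_node (e : AdjPair X) (q : Q) : HasLeaf (between e (node q) : 𝒟) := by
  refine ⟨between e (leaf q), ⟨?_, fun b h1 h2 => ?_⟩, isMax_between_leaf hq₀ e q,
    between e (tick q ⊥ bot_le), ?_, by simp⟩
  · exact lt_of_le_not_ge ((between_le_between hq₀).2 (node_le_leaf.2 le_rfl)) fun h =>
      not_leaf_le_node ((between_le_between hq₀).1 h)
  · rcases (between_le_iff hq₀).1 h1.le with ⟨s, rfl, hs⟩ | ⟨-, h⟩
    · have hs' := (between_le_between hq₀).1 h2.le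
      cases s <;> simp at hs'
      · exact h1.not_ge ((between_le_between hq₀).2 (node_le_node.2 hs'))
      · subst hs'
        exact h2.false
    · exact e.2.lt.not_ge ((base_le_between hq₀).1 (h.trans h2.le))
  · exact lt_of_le_not_ge ((between_le_between hq₀).2 (node_le_tick.2 le_rfl)) fun h =>
      not_tick_le_node ((between_le_between hq₀).1 h)

/-- A cover of a point of `X` is another point of `X` or the root of an attached tree, and none of
these is maximal. -/
theorem not_hasLeaf_base (hp₀ : ∀ p, p₀ ≤ p) (x : X) : ¬HasLeaf (base x : 𝒟) := by
  rintro ⟨u, h1, h2, -⟩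
  cases u with
  | base y => exact not_isMax_base hq₀ p₀ y h2
  | above y s =>
    have h3 := (base_le_above hq₀).1 h1.le
    have h4 : (above y (node p₀) : 𝒟) = above y s :=
      ((above_le_above hq₀).2 (node_le_iff.2 (hp₀ _))).eq_of_not_lt fun h =>
        h1.2 (((base_le_base hq₀).2 h3).trans_lt (base_lt_above hq₀)) h
    exact not_isMax_above_node hq₀ y p₀ (h4 ▸ h2)
  | between e t =>
    have h3 := (base_le_between hq₀).1 h1.le
    have h4 : (between e (node q₀) : 𝒟) = between e t :=
      ((between_le_between hq₀).2 (node_le_iff.2 (hq₀ _))).eq_of_not_lt fun h =>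
        h1.2 (((base_le_base hq₀).2 h3).trans_lt (base_lt_between hq₀)) h
    exact not_isMax_between_node hq₀ e q₀ (h4 ▸ h2)

/-- Above a tick there are only later ticks, so a maximal cover leaves room for no second point
above it. -/
theorem hasLeaf_above_iff {x : X} {s : Enc c} :
    HasLeaf (above x s : 𝒟) ↔ ∃ p, s = node p := by
  refine ⟨?_, by rintro ⟨p, rfl⟩; exact hasLeaf_above_node hq₀ x p⟩
  rintro ⟨u, h1, h2, v, h3, h4⟩
  cases s with
  | node p => exact ⟨p, rfl⟩
  | leaf p => exact absurd (isMax_above_leaf hq₀ x p) h1.lt.not_isMax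
  | tick p j h =>
    obtain ⟨s, rfl, hs⟩ := (above_le_iff hq₀).1 h1.le
    obtain ⟨s', rfl, hs'⟩ := (above_le_iff hq₀).1 h3.le
    cases s <;> simp at hs
    cases s' <;> simp at hs'
    obtain ⟨rfl, -⟩ := hs
    obtain ⟨rfl, -⟩ := hs'
    rename_i i k hi hk
    have hle : (above x (tick p k hk) : 𝒟) ≤ above x (tick p i hi) := by
      rcases le_total i k with h | h
      · exact h2 ((above_le_above hq₀).2 ⟨rfl, h⟩)
      · exact (above_le_above hq₀).2 ⟨rfl, h⟩
    exact (h1.2 h3 (hle.lt_of_ne h4)).elim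

theorem hasLeaf_between_iff (p₀ : P) {e : AdjPair X} {t : Enc d} :
    HasLeaf (between e t : 𝒟) ↔ ∃ q, t = node q := by
  refine ⟨?_, by rintro ⟨q, rfl⟩; exact hasLeaf_between_node hq₀ e q⟩
  rintro ⟨u, h1, h2, v, h3, h4⟩
  cases t with
  | node q => exact ⟨q, rfl⟩
  | leaf q => exact absurd (isMax_between_leaf hq₀ e q) h1.lt.not_isMax
  | tick q j h =>
    -- Ticks at the root also lie below the upper end of the pair, so no tick above them is maximal;
    -- that upper end lies strictly below its own attached tree. At the other nodes only ticks are
    -- above, and they form a chain.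
    by_cases hq : q = q₀
    · have hL : tick q j h ∈ rootChain d q₀ := tick_mem_rootChain.2 hq
      rcases (between_le_iff hq₀).1 h1.le with ⟨s, rfl, hs⟩ | ⟨-, hs⟩
      · cases s <;> simp at hs
        exact absurd h2 (between_lt_base hq₀ (tick_mem_rootChain.2 (hs.1 ▸ hq))).not_isMax
      · rcases hs.eq_or_lt with rfl | hs
        · exact absurd h2 (not_isMax_base hq₀ p₀ _)
        · exact (h1.2 (between_lt_base hq₀ hL) hs).elim
    · have hL : tick q j h ∉ rootChain d q₀ := fun h => hq (tick_mem_rootChain.1 h)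
      obtain ⟨s, rfl, hs⟩ := ((between_le_iff hq₀).1 h1.le).resolve_right fun h => hL h.1
      obtain ⟨s', rfl, hs'⟩ := ((between_le_iff hq₀).1 h3.le).resolve_right fun h => hL h.1
      cases s <;> simp at hs
      cases s' <;> simp at hs'
      obtain ⟨rfl, -⟩ := hs
      obtain ⟨rfl, -⟩ := hs'
      rename_i i k hi hk
      have hle : (between e (tick q k hk) : 𝒟) ≤ between e (tick q i hi) := by
        rcases le_total i k with h | h
        · exact h2 ((between_le_between hq₀).2 ⟨rfl, h⟩)
        · exact (between_le_between hq₀).2 ⟨rfl, h⟩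
      exact (h1.2 h3 (hle.lt_of_ne h4)).elim

/-- The points of `X` can be recognized in the order of the decoration. -/
theorem exists_base_iff (hp₀ : ∀ p, p₀ ≤ p) {y : 𝒟} :
    (∃ x, y = base x) ↔ ¬HasLeaf y ∧ ∃ z, y ⋖ z ∧ HasLeaf z := by
  constructor
  · rintro ⟨x, rfl⟩
    exact ⟨not_hasLeaf_base hq₀ hp₀ x, _, base_covBy_above hq₀ hp₀ x, hasLeaf_above_node hq₀ x p₀⟩
  · rintro ⟨h1, z, h2, h3⟩
    cases y with
    | base x => exact ⟨x, rfl⟩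
    | above x s =>
      rw [hasLeaf_above_iff hq₀] at h1
      obtain ⟨s', rfl, hs⟩ := (above_le_iff hq₀).1 h2.le
      obtain ⟨p, rfl⟩ := (hasLeaf_above_iff hq₀).1 h3
      cases s <;> simp at hs
      exact absurd ⟨_, rfl⟩ h1
    | between e t =>
      rw [hasLeaf_between_iff hq₀ p₀] at h1
      rcases (between_le_iff hq₀).1 h2.le with ⟨t', rfl, ht⟩ | ⟨ht, hz⟩
      · obtain ⟨q, rfl⟩ := (hasLeaf_between_iff hq₀ p₀).1 h3
        cases t <;> simp at ht
        exact absurd ⟨_, rfl⟩ h1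
      · rcases hz.eq_or_lt with rfl | hz
        · exact absurd h3 (not_hasLeaf_base hq₀ hp₀ _)
        · exact (h2.2 (between_lt_base hq₀ ht) hz).elim

end

section Automorphism

variable (hp₀ : ∀ p, p₀ ≤ p)
include hq₀ hp₀

theorem exists_apply_base (f : 𝒟 ≃o 𝒟) (x : X) : ∃ y, f (base x) = base y := by
  obtain ⟨h, z, hz, h'⟩ := (exists_base_iff (X := X) (c := c) (d := d) hq₀ hp₀).1 ⟨x, rfl⟩
  refine (exists_base_iff hq₀ hp₀).2 ⟨fun h1 => h ?_, f z, (apply_covBy_apply_iff f).2 hz,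
    h'.map f⟩
  simpa using h1.map f.symm

theorem exists_baseIso (f : 𝒟 ≃o 𝒟) : ∃ φ : X ≃o X, ∀ x, f (base x) = base (φ x) := by
  choose φ hφ using exists_apply_base hq₀ hp₀ f
  choose ψ hψ using exists_apply_base hq₀ hp₀ f.symm
  have h1 : ∀ x, ψ (φ x) = x := fun x => by
    have : (base (ψ (φ x)) : 𝒟) = base x := by rw [← hψ, ← hφ, f.symm_apply_apply]
    exact (Dec.base.injEq ..).mp this
  have h2 : ∀ x, φ (ψ x) = x := fun x => by
    have : (base (φ (ψ x)) : 𝒟) = base x := by rw [← hφ, ← hψ, f.apply_symm_apply]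
    exact (Dec.base.injEq ..).mp this
  exact ⟨⟨⟨φ, ψ, h1, h2⟩, fun {x y} => by
    rw [Equiv.coe_fn_mk, ← base_le_base hq₀ (c := c) (d := d), ← hφ, ← hφ, f.le_iff_le,
      base_le_base hq₀]⟩, hφ⟩

theorem exists_apply_above {f : 𝒟 ≃o 𝒟} {φ : X ≃o X} (hφ : ∀ x, f (base x) = base (φ x)) (x : X)
    (s : Enc c) : ∃ s', f (above x s) = above (φ x) s' := by
  have key : f (above x (node p₀)) = above (φ x) (node p₀) := by
    have h1 : base (φ x) ⋖ f (above x (node p₀)) := by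
      rw [← hφ]
      exact (apply_covBy_apply_iff f).2 (base_covBy_above hq₀ hp₀ x)
    have h2 := (hasLeaf_above_node hq₀ (d := d) x p₀).map f
    -- This tells the two kinds of trees apart: the root of a copy of `T` lies below the upper end
    -- of its pair, whereas no point of a copy of `S` lies below a point of `X`.
    have h3 : ∀ z, ¬f (above x (node p₀)) ≤ base z := by
      intro z h
      obtain ⟨z, rfl⟩ := φ.surjective z
      rw [← hφ, f.le_iff_le, above_le_iff hq₀] at h
      obtain ⟨s', h, -⟩ := h
      cases h
    generalize f (above x (node p₀)) = y at *
    cases y with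
    | base z => exact absurd le_rfl (h3 z)
    | above z s =>
      have h4 : (base (φ x) : 𝒟) ≤ base z := (base_le_base hq₀).2 ((base_le_above hq₀).1 h1.le)
      have h5 := h4.eq_of_not_lt fun h => h1.2 h (base_lt_above hq₀)
      rw [h5] at h1
      rw [show φ x = z from (Dec.base.injEq ..).mp h5]
      exact (((above_le_above hq₀).2 (node_le_iff.2 (hp₀ _))).eq_of_not_lt fun h =>
        h1.2 (base_lt_above hq₀) h).symm
    | between e t =>
      have h4 := (base_le_base hq₀ (c := c) (d := d)).2 ((base_le_between hq₀).1 h1.le)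
      have h5 : (between e (node q₀) : 𝒟) = between e t :=
        ((between_le_between hq₀).2 (node_le_iff.2 (hq₀ _))).eq_of_not_lt fun h =>
          h1.2 (h4.trans_lt (base_lt_between hq₀)) h
      rw [← h5] at h3
      exact absurd (between_lt_base hq₀ (Or.inl rfl)).le (h3 e.1.2)
  have h : f (above x (node p₀)) ≤ f (above x s) :=
    f.monotone ((above_le_above hq₀).2 (node_le_iff.2 (hp₀ _)))
  rw [key] at h
  obtain ⟨s', h, -⟩ := (above_le_iff hq₀).1 h
  exact ⟨s', h⟩

theorem exists_apply_between {f : 𝒟 ≃o 𝒟} {φ : X ≃o X} (hφ : ∀ x, f (base x) = base (φ x))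
    (e : AdjPair X) (t : Enc d) : ∃ t', f (between e t) = between (e.map φ) t' := by
  have key : ∃ t', f (between e (node q₀)) = between (e.map φ) t' := by
    have h1 : base (φ e.1.1) ⋖ f (between e (node q₀)) := by
      rw [← hφ]
      exact (apply_covBy_apply_iff f).2 (base_covBy_between hq₀ e)
    have h2 := (hasLeaf_between_node hq₀ (c := c) e q₀).map f
    have h3 : f (between e (node q₀)) ≤ base (φ e.1.2) := by
      rw [← hφ]
      exact f.monotone (between_lt_base hq₀ (Or.inl rfl)).le
    generalize f (between e (node q₀)) = y at *
    cases y with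
    | base z => exact absurd h2 (not_hasLeaf_base hq₀ hp₀ z)
    | above z s =>
      obtain ⟨s', h, -⟩ := (above_le_iff hq₀).1 h3
      cases h
    | between e' t =>
      rcases (between_le_iff hq₀).1 h3 with ⟨t', h, -⟩ | ⟨-, h⟩
      · cases h
      · have h4 : base (φ e.1.1) ≤ base e'.1.1 :=
          (base_le_base hq₀ (c := c) (d := d)).2 ((base_le_between hq₀).1 h1.le)
        have h5 := h4.eq_of_not_lt fun h => h1.2 h (base_lt_between hq₀)
        have h6 : φ e.1.1 = e'.1.1 := (Dec.base.injEq ..).mp h5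
        have h7 : e'.1.2 ≤ φ e.1.2 := (base_le_base hq₀).1 h
        -- The lower ends agree, so an upper end strictly below `φ e.1.2` would contradict
        -- adjacency.
        have h8 : e'.1.2 = φ e.1.2 := h7.eq_of_not_lt
          ((apply_covBy_apply_iff φ).2 e.2 |>.2 (h6 ▸ e'.2.lt))
        exact ⟨t, by rw [show e' = e.map φ from Subtype.ext (Prod.ext h6.symm h8)]⟩
  obtain ⟨t₀, key⟩ := key
  have h : f (between e (node q₀)) ≤ f (between e t) :=
    f.monotone ((between_le_between hq₀).2 (node_le_iff.2 (hq₀ _)))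
  rw [key] at h
  rcases (between_le_iff hq₀).1 h with ⟨t', h, -⟩ | ⟨-, h⟩
  · exact ⟨t', h⟩
  · have h' : base (φ e.1.2) ≤ f (between e t) := h
    rw [← hφ, f.le_iff_le, base_le_between hq₀] at h'
    exact absurd h' e.2.lt.not_ge

theorem exists_aboveIso {f : 𝒟 ≃o 𝒟} {φ : X ≃o X} (hφ : ∀ x, f (base x) = base (φ x)) (x : X) :
    ∃ σ : Enc c ≃o Enc c, ∀ s, f (above x s) = above (φ x) (σ s) := by
  have hφ' : ∀ x, f.symm (base x) = base (φ.symm x) := fun x => by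
    rw [f.symm_apply_eq, hφ, φ.apply_symm_apply]
  choose σ hσ using exists_apply_above hq₀ hp₀ hφ x
  refine ⟨RelIso.ofSurjective (OrderEmbedding.ofMapLEIff σ fun s s' => ?_) fun s => ?_, hσ⟩
  · rw [← above_le_above hq₀ (d := d) (x := φ x), ← hσ, ← hσ, f.le_iff_le, above_le_above hq₀]
  · obtain ⟨s', hs'⟩ := exists_apply_above hq₀ hp₀ hφ' (φ x) s
    rw [f.symm_apply_eq, φ.symm_apply_apply, hσ] at hs'
    exact ⟨s', ((Dec.above.injEq ..).mp hs').2.symm⟩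

theorem exists_betweenIso {f : 𝒟 ≃o 𝒟} {φ : X ≃o X} (hφ : ∀ x, f (base x) = base (φ x))
    (e : AdjPair X) : ∃ τ : Enc d ≃o Enc d, ∀ t, f (between e t) = between (e.map φ) (τ t) := by
  have hφ' : ∀ x, f.symm (base x) = base (φ.symm x) := fun x => by
    rw [f.symm_apply_eq, hφ, φ.apply_symm_apply]
  choose τ hτ using exists_apply_between hq₀ hp₀ hφ e
  refine ⟨RelIso.ofSurjective (OrderEmbedding.ofMapLEIff τ fun s s' => ?_) fun s => ?_, hτ⟩
  · rw [← between_le_between hq₀ (c := c) (e := e.map φ), ← hτ, ← hτ, f.le_iff_le,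
      between_le_between hq₀]
  · obtain ⟨s', hs'⟩ := exists_apply_between hq₀ hp₀ hφ' (e.map φ) s
    rw [f.symm_apply_eq, show (e.map φ).map φ.symm = e from Subtype.ext
      (Prod.ext (φ.symm_apply_apply _) (φ.symm_apply_apply _)), hτ] at hs'
    exact ⟨s', ((Dec.between.injEq ..).mp hs').2.symm⟩

end Automorphism

-- The least node is fixed and its ticks go to its ticks. So every automorphism of `T` preserves
-- `L`, and the full group acts on each copy in the decoration.
include hq₀ in
theorem apply_mem_rootChain (f : Enc d ≃o Enc d) {t : Enc d} (ht : t ∈ rootChain d q₀) :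
    f t ∈ rootChain d q₀ := by
  have h : nodeIso f q₀ = q₀ := by
    refine le_antisymm ?_ (hq₀ _)
    obtain ⟨q, hq⟩ := (nodeIso f).surjective q₀
    calc nodeIso f q₀ ≤ nodeIso f q := (nodeIso f).monotone (hq₀ q)
      _ = q₀ := hq
  rcases ht with rfl | ⟨j, hj, rfl⟩
  · rw [apply_node]
    exact Or.inl (congrArg node h)
  · obtain ⟨i, hi, h'⟩ := exists_tick f hj
    rw [h']
    exact tick_mem_rootChain.2 h

/-- The action of the wreath product on the decoration. -/
def act (w : Wreath X (Enc c ≃o Enc c) (Enc d ≃o Enc d)) : 𝒟 → 𝒟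
  | base x => base (w.base x)
  | above x s => above (w.base x) (w.pt x s)
  | between e t => between (e.map w.base) (w.adj e t)

theorem act_mul (w w' : Wreath X (Enc c ≃o Enc c) (Enc d ≃o Enc d)) (y : 𝒟) :
    act (w * w') y = act w (act w' y) := by
  cases y <;> rfl

theorem act_one (y : 𝒟) : act 1 y = y := by
  cases y <;> rfl

include hq₀ in
theorem act_monotone (w : Wreath X (Enc c ≃o Enc c) (Enc d ≃o Enc d)) :
    Monotone (act w : 𝒟 → 𝒟) := by
  intro a b h
  rw [le_iff hq₀] at h ⊢
  cases a with
  | base x =>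
    cases b with
    | base y => exact w.base.monotone h
    | above y s => exact w.base.monotone h
    | between e t => exact w.base.monotone h
  | above x s =>
    cases b with
    | base y => exact h
    | above y s' =>
      obtain ⟨rfl, h⟩ := h
      exact ⟨rfl, (w.pt x).monotone h⟩
    | between e t => exact h
  | between e t =>
    cases b with
    | base y => exact ⟨apply_mem_rootChain hq₀ _ h.1, w.base.monotone h.2⟩
    | above y s => exact ⟨apply_mem_rootChain hq₀ _ h.1, w.base.monotone h.2⟩
    | between e' t' =>
      rcases h with ⟨rfl, h⟩ | h
      · exact Or.inl ⟨rfl, (w.adj e).monotone h⟩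
      · exact Or.inr ⟨apply_mem_rootChain hq₀ _ h.1, w.base.monotone h.2⟩

/-- The wreath product acts by automorphisms of the decoration. -/
def toAut : Wreath X (Enc c ≃o Enc c) (Enc d ≃o Enc d) →* (𝒟 ≃o 𝒟) where
  toFun w := Equiv.toOrderIso
    { toFun := act w
      invFun := act w⁻¹
      left_inv := fun y => by rw [← act_mul, inv_mul_cancel, act_one]
      right_inv := fun y => by rw [← act_mul, mul_inv_cancel, act_one] }
    (act_monotone hq₀ w) (act_monotone hq₀ w⁻¹)
  map_one' := DFunLike.ext _ _ act_one
  map_mul' w w' := DFunLike.ext _ _ (act_mul w w')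

theorem toAut_injective : Function.Injective (toAut (X := X) (c := c) (d := d) hq₀) := by
  intro w w' h
  have h' : ∀ y : 𝒟, act w y = act w' y := fun y => DFunLike.congr_fun h y
  ext1
  · exact DFunLike.ext _ _ fun x => (Dec.base.injEq ..).mp (h' (base x))
  · funext x
    exact DFunLike.ext _ _ fun s => ((Dec.above.injEq ..).mp (h' (above x s))).2
  · funext e
    exact DFunLike.ext _ _ fun t => ((Dec.between.injEq ..).mp (h' (between e t))).2

theorem toAut_surjective (hp₀ : ∀ p, p₀ ≤ p) :
    Function.Surjective (toAut (X := X) (c := c) (d := d) hq₀) := by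
  intro f
  obtain ⟨φ, hφ⟩ := exists_baseIso hq₀ hp₀ f
  choose σ hσ using exists_aboveIso hq₀ hp₀ hφ
  choose τ hτ using exists_betweenIso hq₀ hp₀ hφ
  refine ⟨⟨φ, σ, τ⟩, DFunLike.ext _ _ fun y => ?_⟩
  cases y with
  | base x => exact (hφ x).symm
  | above x s => exact (hσ x s).symm
  | between e t => exact (hτ e t).symm

/-- The automorphism group of the decoration is a wreath product. -/
noncomputable def autEquiv (hp₀ : ∀ p, p₀ ≤ p) :
    Wreath X (Enc c ≃o Enc c) (Enc d ≃o Enc d) ≃* (𝒟 ≃o 𝒟) :=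
  MulEquiv.ofBijective (toAut hq₀) ⟨toAut_injective hq₀, toAut_surjective hq₀ hp₀⟩

end Enc

end Dec

end CFPO

/-- Both trees encode the same rooted completion of `M`; they differ only in the colouring, which
pins the points outside `D` for `S` and outside `F` for `T`. -/
theorem mainTheorem4 {M : Type u} [PartialOrder M] (hM : CFPO.IsCFPO M)
    (A : Set M) (hA : CFPO.IsOneOrbit A) (hcone : CFPO.ActsConeTransitivelyOn A)
    (hC : ∀ C ∈ CFPO.pathClasses A, CFPO.AttachedAtPoint A C ∧ CFPO.LiesBetweenAdjacent A C) :
    ∃ (X S T : Type u) (_ : PartialOrder X) (_ : PartialOrder S) (_ : PartialOrder T) (L : Set T),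
      CFPO.IsConeTransitiveCFPO X ∧ CFPO.IsTree S ∧ CFPO.IsTree T ∧ IsMaxChain (· ≤ ·) L ∧
      Nonempty ((M ≃o M) ≃* (CFPO.Dec X S L ≃o CFPO.Dec X S L)) := by
  open CFPO in
  have hG := hM.gated hC
  have ⟨a, ha⟩ : A.Nonempty := by
    obtain ⟨x, rfl⟩ := hA
    exact ⟨x, 1, rfl⟩
  obtain ⟨D, F, hD, hF, ⟨c⟩⟩ := exists_charts hM hG hA hcone ⟨a, ha⟩
  -- Any well-ordering of the colours will do, and the colours then serve directly as lengths of
  -- chains.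
  obtain ⟨_, _⟩ := exists_wellFoundedLT (Colour M)
  have hroot := Rooted.root_le (hP := hM.cycleFree) (r := toCompletion a)
  -- The root lies outside the model blocks, so the automorphisms supported there fix it.
  have haD : a ∉ D := fun h => Set.disjoint_left.1 hD h ha
  have haF : a ∉ F := fun h => Set.disjoint_left.1 hF h ha
  have hlin : ∀ x y z : Rooted hM.cycleFree (toCompletion a), y ≤ x → z ≤ x → y ≤ z ∨ z ≤ y :=
    fun x y z => hM.cycleFree.not_joined_or
  exact ⟨A, Enc (rootedColour hM id a D), Enc (rootedColour hM id a F), inferInstance,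
    inferInstance, inferInstance, Enc.rootChain _ _, isConeTransitiveCFPO_coe hM hG hA hcone,
    Enc.isTree hlin hroot, Enc.isTree hlin hroot, Enc.isMaxChain_rootChain hroot,
    ⟨(c.autEquiv hM hG hA).symm.trans
      ((Wreath.congr (supportedEquiv hM haD id Function.injective_id)
        (supportedEquiv hM haF id Function.injective_id)).trans (Dec.autEquiv hroot hroot))⟩⟩
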